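/- Let $m\ge 1$ and let $n_i\ge 1$, $p_i>0$, $q_i\neq 0$ ($1\le i\le m$) be integers. For $Y\in\mathbb{R}^m$ put $$E(Y)=\sum_{i=1}^m n_iq_i^2Y_i^2,\qquad F_i(Y)=2p_iY_i-q_i^2Y_i^2-E(Y),$$ and consider the system $$\frac{dY_i}{du}=-Y_iF_i(Y),\qquad 1\le i\le m. \tag{1}$$ For a nonempty $\theta\subset\{1,\dots,m\}$ let $v_\theta$ be the point with $v_{\theta,i}>0$, $F_i(v_\theta)=0$ for $i\in\theta$ and $v_{\theta,j}=0$ for $j\notin\theta$ (it exists and is unique); write $\xi=v_{\{1,\dots,m\}}$ (the Einstein point). Let $P_Q$ be any smooth principal circle bundle $\pi=(\pi_1,\dots,\pi_m):P_Q\to M_1\times\cdots\times M_m$, where $(M_i,g_i)$ is a closed connected Kähler–Einstein manifold of complex dimension $n_i$ with $\mathrm{Rc}(g_i)=p_ig_i$ and Kähler form $\omega_i$, equipped with a principal connection $\sigma$ with $d\sigma=\sum_i q_i\pi_i^*\omega_i$. For $a>0$, $b_i>0$ let $g_{a,\vec b}=a\,\sigma\otimes\sigma+\sum_i b_i\,\pi_i^*g_i$.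 A solution $Y:[0,\infty)\to\mathbb{R}^m$ of (1) and functions $a,b_i>0$ on $[0,\infty)$ (with $a$ continuous) correspond to each other if, with $u(\tau)=\int_0^\tau a(\zeta)^{-1}d\zeta$, one has $Y_i(u(\tau))=a(\tau)/b_i(\tau)$ and $a(\tau)=a(0)\exp\int_0^{u(\tau)}E(Y(\zeta))\,d\zeta$ for all $\tau\ge 0$. We say that $Y$ gives an ancient Ricci flow on $P_Q$ if for every $a_0>0$ there are corresponding $a,b_i$ with $a(0)=a_0$, defined for all $\tau\ge0$, such that $g_{a,\vec b}(\tau)$ with $t=-\tau$ is a smooth solution of the Ricci flow $\partial_tg=-2\,\mathrm{Rc}(g)$ for all $t\in(-\infty,0]$. By a $C^0$ family of solutions with $k-1$ parameters tending to a point $v$ we mean a family $Y_s:[0,\infty)\to\mathbb{R}^m_{\ge0}$ of solutions of (1), indexed by the unit sphere $S^{k-1}\subset\mathbb{R}^k$ (empty for $k=0$), such that $(s,u)\mapsto Y_s(u)$ is continuous, $\lim_{u\to\infty}Y_s(u)=v$, $Y_s(u)\ne v$ for all $u\ge 0$, and different parameters give disjoint trajectories. Then the following hold. (i) There is a constant $c_0>0$,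 depending only on the $n_i,p_i,q_i$, such that for every $y\in\mathbb{R}^m_{\ge0}$ with $\sum_iy_i\le c_0$ there is a solution $Y:[0,\infty)\to\mathbb{R}^m_{\ge 0}$ of (1) with $Y(0)=y$, and every solution $Y:[0,\infty)\to\mathbb{R}^m_{\ge0}$ with $\sum_iY_i(0)\le c_0$ satisfies $\lim_{u\to\infty}Y(u)=0$. If moreover $Y(u)\in\mathbb{R}^m_{>0}$ for all $u\ge0$, then $Y$ gives an ancient Ricci flow on every $P_Q$. (ii) There is a $C^0$ family $(Y_s)_{s\in S^{m-2}}$ of solutions with $m-2$ parameters tending to $\xi$. All $Y_s(u)$ have positive entries, and each $Y_s$ gives an ancient Ricci flow on every $P_Q$. (iii) For each nonempty proper subset $\theta\subset\{1,\dots,m\}$ there is a $C^0$ family $(Y_s)_{s\in S^{|\theta|-2}}$ of solutions with $|\theta|-2$ parameters tending to $v_\theta$ and with $(Y_s)_k\equiv0$ for $k\notin\theta$. These solutions do not give ancient Ricci flows on $P_Q$: for no $s$ and no $P_Q$ are there $a,b_i>0$ on $[0,\infty)$ corresponding to $Y_s$ for which $g_{a,\vec b}(\tau)$, $\tau=-t$,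 is an ancient solution of the Ricci flow on $P_Q$. -/

import Mathlib

open Set Filter Topology Manifold Bundle
open scoped ContDiff

universe u

noncomputable section

namespace CircleFlow

/-! ## The polynomial system -/

/-- `E(Y) = ∑ nᵢ qᵢ² Yᵢ²`. -/
def energy {m : ℕ} (n : Fin m → ℕ) (q : Fin m → ℤ) (Y : Fin m → ℝ) : ℝ :=
  ∑ i, (n i : ℝ) * (q i : ℝ) ^ 2 * Y i ^ 2

/-- `Fᵢ(Y) = 2 pᵢ Yᵢ - qᵢ² Yᵢ² - E(Y)`. -/
def rate {m : ℕ} (n : Fin m → ℕ) (p q : Fin m → ℤ) (i : Fin m) (Y : Fin m → ℝ) : ℝ :=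
  2 * (p i : ℝ) * Y i - (q i : ℝ) ^ 2 * Y i ^ 2 - energy n q Y

/-- `Y` solves `dYᵢ/du = -Yᵢ Fᵢ(Y)` for all `u ≥ 0` (one-sided derivative at `u = 0`). -/
def IsSolution {m : ℕ} (n : Fin m → ℕ) (p q : Fin m → ℤ) (Y : ℝ → Fin m → ℝ) : Prop :=
  ∀ u, 0 ≤ u → ∀ i,
    HasDerivWithinAt (fun s => Y s i) (-(Y u i * rate n p q i (Y u))) (Ici 0) u

/-- The zero of the vector field with support `θ`: `vᵢ > 0` and `Fᵢ(v) = 0` for `i ∈ θ`, and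
`vⱼ = 0` for `j ∉ θ`. For `θ` the whole index set this is the Einstein point. -/
def IsRestPoint {m : ℕ} (n : Fin m → ℕ) (p q : Fin m → ℤ) (θ : Finset (Fin m))
    (v : Fin m → ℝ) : Prop :=
  (∀ i ∈ θ, 0 < v i ∧ rate n p q i v = 0) ∧ ∀ j, j ∉ θ → v j = 0

/-- A `C⁰` family of solutions on `[0, ∞)`, parametrized by the unit sphere of `ℝᵏ` (a compact
`(k - 1)`-dimensional parameter space, empty for `k = 0` and two points for `k = 1`), all tending
to the point `v` without being constant, and such that different parameters give different
trajectories (so the parameters do not merely shift time). -/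
structure IsSolutionFamily {m : ℕ} (n : Fin m → ℕ) (p q : Fin m → ℤ) (k : ℕ) (v : Fin m → ℝ)
    (Y : Metric.sphere (0 : EuclideanSpace ℝ (Fin k)) 1 → ℝ → Fin m → ℝ) : Prop where
  solution : ∀ s, IsSolution n p q (Y s)
  nonneg : ∀ s u, 0 ≤ u → ∀ i, 0 ≤ Y s u i
  continuous : ContinuousOn (fun su : Metric.sphere (0 : EuclideanSpace ℝ (Fin k)) 1 × ℝ =>
    Y su.1 su.2) (univ ×ˢ Ici 0)
  tendsto : ∀ s, Tendsto (Y s) atTop (𝓝 v)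
  nonconstant : ∀ s u, 0 ≤ u → Y s u ≠ v
  distinct : ∀ s s' u u', 0 ≤ u → 0 ≤ u' → Y s u = Y s' u' → s = s'

/-! ## Tensor calculus in charts

All manifolds are modelled on `EuclideanSpace ℝ (Fin d)`; the components below are taken in the
preferred chart at a point `x₀`. -/

section Charts

variable {d : ℕ} {M : Type u} [TopologicalSpace M] [ChartedSpace (EuclideanSpace ℝ (Fin d)) M]

/-- The `i`-th coordinate vector field of the chart at `x₀`, at the point with coordinates `y`. -/
def coordVec (x₀ : M) (y : EuclideanSpace ℝ (Fin d)) (i : Fin d) :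
    TangentSpace (𝓡 d) ((extChartAt (𝓡 d) x₀).symm y) :=
  mfderiv 𝓘(ℝ, EuclideanSpace ℝ (Fin d)) (𝓡 d) (extChartAt (𝓡 d) x₀).symm y
    (EuclideanSpace.single i (1 : ℝ))

/-- The `i`-th component of a tangent vector at `x₀` in the chart at `x₀`. -/
def comp (x₀ : M) (v : TangentSpace (𝓡 d) x₀) (i : Fin d) : ℝ :=
  (EuclideanSpace.proj i : EuclideanSpace ℝ (Fin d) →L[ℝ] ℝ)
    (mfderiv (𝓡 d) 𝓘(ℝ, EuclideanSpace ℝ (Fin d)) (extChartAt (𝓡 d) x₀) x₀ v)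

/-- Partial derivative `∂ᵢ f`. -/
def pd (i : Fin d) (f : EuclideanSpace ℝ (Fin d) → ℝ) (y : EuclideanSpace ℝ (Fin d)) : ℝ :=
  fderiv ℝ f y (EuclideanSpace.single i (1 : ℝ))

/-- The component matrix `B(∂ᵢ, ∂ⱼ)` of a field of bilinear forms in the chart at `x₀`. -/
def coeff (B : ∀ x : M, TangentSpace (𝓡 d) x →L[ℝ] TangentSpace (𝓡 d) x →L[ℝ] ℝ)
    (x₀ : M) (y : EuclideanSpace ℝ (Fin d)) : Matrix (Fin d) (Fin d) ℝ :=
  Matrix.of fun i j => B ((extChartAt (𝓡 d) x₀).symm y) (coordVec x₀ y i) (coordVec x₀ y j)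

/-- Christoffel symbols `Γᵏᵢⱼ` of the metric `g` in the chart at `x₀`. -/
def christoffel (g : ∀ x : M, TangentSpace (𝓡 d) x →L[ℝ] TangentSpace (𝓡 d) x →L[ℝ] ℝ)
    (x₀ : M) (k i j : Fin d) (y : EuclideanSpace ℝ (Fin d)) : ℝ :=
  1 / 2 * ∑ l, (coeff g x₀ y)⁻¹ k l *
    (pd i (fun z => coeff g x₀ z j l) y + pd j (fun z => coeff g x₀ z i l) y
      - pd l (fun z => coeff g x₀ z i j) y)

/-- Components `R_{jk}` of the Ricci tensor of `g` in the chart at `x₀`. -/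
def ricciCoeff (g : ∀ x : M, TangentSpace (𝓡 d) x →L[ℝ] TangentSpace (𝓡 d) x →L[ℝ] ℝ)
    (x₀ : M) (j k : Fin d) (y : EuclideanSpace ℝ (Fin d)) : ℝ :=
  ∑ i, (pd i (christoffel g x₀ i j k) y - pd j (christoffel g x₀ i i k) y)
    + ∑ i, ∑ l, (christoffel g x₀ i i l y * christoffel g x₀ l j k y
      - christoffel g x₀ i j l y * christoffel g x₀ l i k y)

/-- The Ricci tensor of `g` at `x`. -/
def ricci (g : ∀ x : M, TangentSpace (𝓡 d) x →L[ℝ] TangentSpace (𝓡 d) x →L[ℝ] ℝ)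
    (x : M) (v w : TangentSpace (𝓡 d) x) : ℝ :=
  ∑ j, ∑ k, ricciCoeff g x j k (extChartAt (𝓡 d) x x) * comp x v j * comp x w k

/-- Components `∇ᵢ B_{jk}` of the covariant derivative of a field `B` of bilinear forms with respect
to the Levi-Civita connection of `g`, in the chart at `x₀`. -/
def covDeriv (g B : ∀ x : M, TangentSpace (𝓡 d) x →L[ℝ] TangentSpace (𝓡 d) x →L[ℝ] ℝ)
    (x₀ : M) (i j k : Fin d) (y : EuclideanSpace ℝ (Fin d)) : ℝ :=
  pd i (fun z => coeff B x₀ z j k) y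
    - ∑ l, (christoffel g x₀ l i j y * coeff B x₀ y l k
      + christoffel g x₀ l i k y * coeff B x₀ y j l)

/-- The component `σ(∂ᵢ)` of a one-form in the chart at `x₀`. -/
def formCoeff (σ : ∀ x : M, TangentSpace (𝓡 d) x →L[ℝ] ℝ) (x₀ : M) (i : Fin d)
    (y : EuclideanSpace ℝ (Fin d)) : ℝ :=
  σ ((extChartAt (𝓡 d) x₀).symm y) (coordVec x₀ y i)

/-- The exterior derivative of a one-form, `dσ(∂ᵢ, ∂ⱼ) = ∂ᵢ σⱼ - ∂ⱼ σᵢ`, at `x`. -/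
def extD (σ : ∀ x : M, TangentSpace (𝓡 d) x →L[ℝ] ℝ) (x : M)
    (v w : TangentSpace (𝓡 d) x) : ℝ :=
  ∑ i, ∑ j, (pd i (formCoeff σ x j) (extChartAt (𝓡 d) x x)
    - pd j (formCoeff σ x i) (extChartAt (𝓡 d) x x)) * comp x v i * comp x w j

/-- `g` is a smooth solution of the Ricci flow `∂g/∂t = -2 Rc(g)` through Riemannian metrics, for
`t` in the set `S` of times. -/
structure IsRicciFlowOn [IsManifold (𝓡 d) ∞ M] (S : Set ℝ)
    (g : ℝ → ∀ x : M, TangentSpace (𝓡 d) x →L[ℝ] TangentSpace (𝓡 d) x →L[ℝ] ℝ) : Prop where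
  smooth : ContMDiffOn (𝓘(ℝ, ℝ).prod (𝓡 d))
    ((𝓡 d).prod 𝓘(ℝ, EuclideanSpace ℝ (Fin d) →L[ℝ] EuclideanSpace ℝ (Fin d) →L[ℝ] ℝ)) ∞
    (fun tx : ℝ × M => (TotalSpace.mk' (EuclideanSpace ℝ (Fin d) →L[ℝ] EuclideanSpace ℝ (Fin d)
      →L[ℝ] ℝ) tx.2 (g tx.1 tx.2) : TotalSpace _
        (fun x : M => TangentSpace (𝓡 d) x →L[ℝ] TangentSpace (𝓡 d) x →L[ℝ] ℝ)))
    (S ×ˢ univ)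
  symm : ∀ t ∈ S, ∀ x v w, g t x v w = g t x w v
  pos : ∀ t ∈ S, ∀ x v, v ≠ 0 → 0 < g t x v v
  flow : ∀ t ∈ S, ∀ x v w,
    HasDerivWithinAt (fun s => g s x v w) (-2 * ricci (g t) x v w) S t

/-- An ancient solution of the Ricci flow, normalized to exist for all times `t ≤ 0`. -/
def IsAncientRicciFlow [IsManifold (𝓡 d) ∞ M]
    (g : ℝ → ∀ x : M, TangentSpace (𝓡 d) x →L[ℝ] TangentSpace (𝓡 d) x →L[ℝ] ℝ) : Prop :=
  IsRicciFlowOn (Iic 0) g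

end Charts

/-! ## Kähler-Einstein manifolds and circle bundles over their products -/

/-- A closed connected Kähler-Einstein manifold of complex dimension `n` with `Rc(g) = p g`. The
Kähler condition is that the Kähler form `ω(v, w) = g(J v, w)` of the orthogonal almost complex
structure `J` is parallel. -/
structure KEManifold (n : ℕ) (p : ℤ) where
  carrier : Type u
  [top : TopologicalSpace carrier]
  [charted : ChartedSpace (EuclideanSpace ℝ (Fin (2 * n))) carrier]
  [manifold : IsManifold (𝓡 (2 * n)) ∞ carrier]
  [compact : CompactSpace carrier]
  [hausdorff : T2Space carrier]
  [connected : ConnectedSpace carrier]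
  metric : ContMDiffRiemannianMetric (𝓡 (2 * n)) ∞ (EuclideanSpace ℝ (Fin (2 * n)))
    (fun x : carrier => TangentSpace (𝓡 (2 * n)) x)
  J : ∀ x : carrier, TangentSpace (𝓡 (2 * n)) x →L[ℝ] TangentSpace (𝓡 (2 * n)) x
  J_smooth : ContMDiff (𝓡 (2 * n)) ((𝓡 (2 * n)).prod
      𝓘(ℝ, EuclideanSpace ℝ (Fin (2 * n)) →L[ℝ] EuclideanSpace ℝ (Fin (2 * n)))) ∞
    (fun x : carrier => (TotalSpace.mk' (EuclideanSpace ℝ (Fin (2 * n)) →L[ℝ]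
      EuclideanSpace ℝ (Fin (2 * n))) x (J x) : TotalSpace _
        (fun x : carrier => TangentSpace (𝓡 (2 * n)) x →L[ℝ] TangentSpace (𝓡 (2 * n)) x)))
  J_sq : ∀ x v, J x (J x v) = -v
  J_orthogonal : ∀ x v w, metric.inner x (J x v) (J x w) = metric.inner x v w
  kahler : ∀ x i j k,
    covDeriv metric.inner (fun x => (metric.inner x).comp (J x)) x i j k
      (extChartAt (𝓡 (2 * n)) x x) = 0
  einstein : ∀ x v w, ricci metric.inner x v w = (p : ℝ) * metric.inner x v w

attribute [instance] KEManifold.top KEManifold.charted KEManifold.manifold KEManifold.compact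
  KEManifold.hausdorff KEManifold.connected

/-- The Kähler form `ω(v, w) = g(J v, w)`. -/
def KEManifold.kahlerForm {n : ℕ} {p : ℤ} (M : KEManifold.{u} n p) (x : M.carrier) :
    TangentSpace (𝓡 (2 * n)) x →L[ℝ] TangentSpace (𝓡 (2 * n)) x →L[ℝ] ℝ :=
  (M.metric.inner x).comp (M.J x)

/-- The real dimension of a circle bundle over a product of `m` manifolds of complex
dimensions `nᵢ`. -/
def totalDim {m : ℕ} (n : Fin m → ℕ) : ℕ := 1 + ∑ i, 2 * n i

/-- A smooth principal circle bundle `π = (π₁, …, π_m) : P → M₁ × ⋯ × M_m` over a product of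
Kähler-Einstein manifolds, with a principal connection `σ` whose curvature is
`dσ = ∑ qᵢ πᵢ^* ωᵢ`. The circle acts smoothly and freely, and `π` is a smooth surjective submersion
whose fibres are the orbits. -/
structure KECircleBundle {m : ℕ} (n : Fin m → ℕ) (p q : Fin m → ℤ) where
  base : ∀ i, KEManifold.{u} (n i) (p i)
  total : Type u
  [top : TopologicalSpace total]
  [charted : ChartedSpace (EuclideanSpace ℝ (Fin (totalDim n))) total]
  [manifold : IsManifold (𝓡 (totalDim n)) ∞ total]
  [compact : CompactSpace total]
  [hausdorff : T2Space total]
  [action : MulAction Circle total]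
  [action_smooth : ContMDiffSMul (𝓡 1) (𝓡 (totalDim n)) ∞ Circle total]
  action_free : ∀ (z : Circle) (x : total), z • x = x → z = 1
  proj : ∀ i, total → (base i).carrier
  proj_smooth : ∀ i, ContMDiff (𝓡 (totalDim n)) (𝓡 (2 * n i)) ∞ (proj i)
  proj_surjective : ∀ y : ∀ i, (base i).carrier, ∃ x, ∀ i, proj i x = y i
  proj_submersion : ∀ x (w : ∀ i, TangentSpace (𝓡 (2 * n i)) (proj i x)),
    ∃ v : TangentSpace (𝓡 (totalDim n)) x,
      ∀ i, mfderiv (𝓡 (totalDim n)) (𝓡 (2 * n i)) (proj i) x v = w i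
  proj_fibre : ∀ x x', (∀ i, proj i x = proj i x') ↔ ∃ z : Circle, z • x = x'
  σ : ∀ x : total, TangentSpace (𝓡 (totalDim n)) x →L[ℝ] ℝ
  σ_smooth : ContMDiff (𝓡 (totalDim n)) ((𝓡 (totalDim n)).prod
      𝓘(ℝ, EuclideanSpace ℝ (Fin (totalDim n)) →L[ℝ] ℝ)) ∞
    (fun x : total => (TotalSpace.mk' (EuclideanSpace ℝ (Fin (totalDim n)) →L[ℝ] ℝ) x (σ x) :
      TotalSpace _ (fun x : total => TangentSpace (𝓡 (totalDim n)) x →L[ℝ] ℝ)))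
  σ_vertical : ∀ x : total, σ (Circle.exp 0 • x)
    (mfderiv 𝓘(ℝ, ℝ) (𝓡 (totalDim n)) (fun s : ℝ => Circle.exp s • x) 0 (1 : ℝ)) = 1
  σ_invariant : ∀ (z : Circle) (x : total) (v : TangentSpace (𝓡 (totalDim n)) x),
    σ (z • x) (mfderiv (𝓡 (totalDim n)) (𝓡 (totalDim n)) (fun x' : total => z • x') x v) = σ x v
  σ_curvature : ∀ (x : total) (v w : TangentSpace (𝓡 (totalDim n)) x),
    extD σ x v w = ∑ i, (q i : ℝ) * (base i).kahlerForm (proj i x)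
      (mfderiv (𝓡 (totalDim n)) (𝓡 (2 * n i)) (proj i) x v)
      (mfderiv (𝓡 (totalDim n)) (𝓡 (2 * n i)) (proj i) x w)

attribute [instance] KECircleBundle.top KECircleBundle.charted KECircleBundle.manifold
  KECircleBundle.compact KECircleBundle.hausdorff KECircleBundle.action
  KECircleBundle.action_smooth

/-- The connection-type metric `a σ ⊗ σ + ∑ bᵢ πᵢ^* gᵢ` on the total space. -/
def KECircleBundle.connMetric {m : ℕ} {n : Fin m → ℕ} {p q : Fin m → ℤ}
    (P : KECircleBundle.{u} n p q) (a : ℝ) (b : Fin m → ℝ) (x : P.total) :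
    TangentSpace (𝓡 (totalDim n)) x →L[ℝ] TangentSpace (𝓡 (totalDim n)) x →L[ℝ] ℝ :=
  a • (P.σ x).smulRight (P.σ x) +
    ∑ i, b i • (ContinuousLinearMap.precomp ℝ
        (mfderiv (𝓡 (totalDim n)) (𝓡 (2 * n i)) (P.proj i) x)).comp
      (((P.base i).metric.inner (P.proj i x)).comp
        (mfderiv (𝓡 (totalDim n)) (𝓡 (2 * n i)) (P.proj i) x))

/-- The change of variables between `Y(u)` and the metric coefficients `a(τ)`, `bᵢ(τ)` for all
`τ ≥ 0`: with `u(τ) = ∫₀^τ dζ / a(ζ)` one has `Yᵢ(u(τ)) = a(τ) / bᵢ(τ)`, and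
`a(τ) = a(0) exp (∫₀^{u(τ)} E(Y(ζ)) dζ)`. -/
structure Corresponds {m : ℕ} (n : Fin m → ℕ) (q : Fin m → ℤ) (Y : ℝ → Fin m → ℝ)
    (a : ℝ → ℝ) (b : ℝ → Fin m → ℝ) : Prop where
  a_pos : ∀ τ, 0 ≤ τ → 0 < a τ
  b_pos : ∀ τ, 0 ≤ τ → ∀ i, 0 < b τ i
  a_cont : ContinuousOn a (Ici 0)
  ratio : ∀ τ, 0 ≤ τ → ∀ i, Y (∫ ζ in (0 : ℝ)..τ, 1 / a ζ) i = a τ / b τ i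
  fibre : ∀ τ, 0 ≤ τ →
    a τ = a 0 * Real.exp (∫ ζ in (0 : ℝ)..(∫ ζ in (0 : ℝ)..τ, 1 / a ζ), energy n q (Y ζ))

/-- The metrics `g_{a,b}(τ)`, with `t = -τ`, form an ancient solution of the Ricci flow on the
total space. -/
def KECircleBundle.IsAncient {m : ℕ} {n : Fin m → ℕ} {p q : Fin m → ℤ}
    (P : KECircleBundle.{u} n p q) (a : ℝ → ℝ) (b : ℝ → Fin m → ℝ) : Prop :=
  IsAncientRicciFlow fun t : ℝ => P.connMetric (a (-t)) (b (-t))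

/-- `Y` gives rise to an ancient solution on `P`: for every initial fibre scale `a₀ > 0` the
corresponding `a`, `b` exist for all `τ ≥ 0`, and `g_{a,b}` is an ancient Ricci flow. -/
def KECircleBundle.GivesAncient {m : ℕ} {n : Fin m → ℕ} {p q : Fin m → ℤ}
    (P : KECircleBundle.{u} n p q) (Y : ℝ → Fin m → ℝ) : Prop :=
  ∀ a₀ : ℝ, 0 < a₀ → ∃ (a : ℝ → ℝ) (b : ℝ → Fin m → ℝ),
    a 0 = a₀ ∧ Corresponds n q Y a b ∧ P.IsAncient a b

end CircleFlow

end

/-! The geometry reduces to ordinary differential equations because the metrics `a σ ⊗ σ + ∑ bᵢ πᵢ^*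
gᵢ` have Ricci tensor of the same shape, with coefficient `∑ nᵢ qᵢ² a² / (2 bᵢ²)` on `σ ⊗ σ` and `pᵢ
- a qᵢ² / (2 bᵢ)` on `πᵢ^* gᵢ` (`ricci_connMetric`). With `τ = -t` the flow reads `a' = ∑ nᵢ qᵢ² a²
/ bᵢ²`, `bᵢ' = 2 pᵢ - qᵢ² a / bᵢ`, and `Yᵢ = a / bᵢ`, `du = dτ / a` turn it into the polynomial
system. Conversely, along a positive solution `a` is nondecreasing in `u`, since `E ≥ 0`. Hence `τ =
∫ a du` exhausts `[0, ∞)`, and every positive solution gives an ancient flow (`exists_corresponds`,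
`isAncient`). A solution with a vanishing coordinate gives none, as `a / bₖ` is never zero.

The Ricci tensor is computed in a chart with the coframe formed by the connection form `s` and the
differentials of the chart expressions `fᵢ` of the projections. The Levi-Civita connection is the
only symmetric metric one, which determines `s (Γ X Y)` and `dfᵢ (Γ X Y)` (`form_christoffel`,
`map_christoffel`). Differentiating these identities gives the curvature. Parallel complex
structures leave only algebraic terms in `J`, and the trace splits along the coframe
(`trace_curvatureEnd`).

Near the origin `∑ Yᵢ` is a Lyapunov function: the quadratic terms `-2 pᵢ Yᵢ²` dominate the cubic
ones (`sum_field_le`).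

At a rest point with support `θ`, `|θ| ≥ 2`, rescaling by `√nᵢ |qᵢ|` makes `E` the squared norm. The
linearization on `ℝ^θ` becomes the symmetric operator `2 ξ ⊗ ξ - diag(|ξ|² - ξᵢ² / nᵢ)`. Its
diagonal part is positive, so the operator is negative on `ξ^⊥`, yet it is positive on `ξ`: there is
exactly one expanding direction (`exists_isSaddle_cubicDeriv`).

The stable set of such a saddle is found with invariant cones (`exists_stable_family`). After a
cutoff, the form `2⟪e, x⟫² - ‖x‖²` grows along differences of trajectories. The points whose
trajectories stay where it is nonpositive form a Lipschitz graph over `e^⊥`: connectedness of a line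
parallel to `e` gives a point over each base point, and monotonicity gives the Lipschitz bound. The
part of this graph over a small sphere of `e^⊥` is the parameter sphere, and decay of the transverse
norm shows that each trajectory meets it once.

For the rest points, `E(v) = c` makes each `vᵢ` a root of a quadratic, and `nᵢ ≥ 1` selects the
smaller one. Existence is then an intermediate value argument in `c`, and uniqueness is monotonicity
on that branch. -/

noncomputable section

set_option maxSynthPendingDepth 3

namespace CircleFlow

local notation "𝔼" d:max => EuclideanSpace ℝ (Fin d)

/-! ## Tensor fields in charts -/

section Charts

variable {d : ℕ} {M : Type u} [TopologicalSpace M] [ChartedSpace (𝔼 d) M]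

/-- The derivative of the inverse of the chart at `x₀`. -/
def chartFrame (x₀ : M) (y : 𝔼 d) :
    𝔼 d →L[ℝ] TangentSpace (𝓡 d) ((extChartAt (𝓡 d) x₀).symm y) :=
  mfderiv 𝓘(ℝ, 𝔼 d) (𝓡 d) (extChartAt (𝓡 d) x₀).symm y

/-- The expression of a one-form in the chart at `x₀`. -/
def formRep (σ : ∀ x : M, TangentSpace (𝓡 d) x →L[ℝ] ℝ) (x₀ : M) (y : 𝔼 d) : 𝔼 d →L[ℝ] ℝ :=
  (σ ((extChartAt (𝓡 d) x₀).symm y)).comp (chartFrame x₀ y)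

/-- The expression of a field of bilinear forms in the chart at `x₀`. -/
def bilinRep (B : ∀ x : M, TangentSpace (𝓡 d) x →L[ℝ] TangentSpace (𝓡 d) x →L[ℝ] ℝ) (x₀ : M)
    (y : 𝔼 d) : 𝔼 d →L[ℝ] 𝔼 d →L[ℝ] ℝ :=
  (ContinuousLinearMap.precomp ℝ (chartFrame x₀ y)).comp
    ((B ((extChartAt (𝓡 d) x₀).symm y)).comp (chartFrame x₀ y))

/-- The expression of a field of endomorphisms in the chart at `x₀`. -/
def endRep (J : ∀ x : M, TangentSpace (𝓡 d) x →L[ℝ] TangentSpace (𝓡 d) x) (x₀ : M)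
    (y : 𝔼 d) : 𝔼 d →L[ℝ] 𝔼 d :=
  (mfderiv (𝓡 d) 𝓘(ℝ, 𝔼 d) (extChartAt (𝓡 d) x₀) ((extChartAt (𝓡 d) x₀).symm y)).comp
    ((J ((extChartAt (𝓡 d) x₀).symm y)).comp (chartFrame x₀ y))

lemma formRep_apply (σ : ∀ x : M, TangentSpace (𝓡 d) x →L[ℝ] ℝ) (x₀ : M) (y v : 𝔼 d) :
    formRep σ x₀ y v = σ ((extChartAt (𝓡 d) x₀).symm y) (chartFrame x₀ y v) := rfl

lemma bilinRep_apply
    (B : ∀ x : M, TangentSpace (𝓡 d) x →L[ℝ] TangentSpace (𝓡 d) x →L[ℝ] ℝ) (x₀ : M)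
    (y v w : 𝔼 d) :
    bilinRep B x₀ y v w =
      B ((extChartAt (𝓡 d) x₀).symm y) (chartFrame x₀ y v) (chartFrame x₀ y w) := rfl

lemma coeff_eq_bilinRep
    (B : ∀ x : M, TangentSpace (𝓡 d) x →L[ℝ] TangentSpace (𝓡 d) x →L[ℝ] ℝ) (x₀ : M)
    (y : 𝔼 d) (i j : Fin d) :
    coeff B x₀ y i j =
      bilinRep B x₀ y (EuclideanSpace.single i 1) (EuclideanSpace.single j 1) := rfl

lemma mfderivWithin_range_eq_chartFrame (x₀ : M) (y : 𝔼 d) :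
    mfderivWithin 𝓘(ℝ, 𝔼 d) (𝓡 d) (extChartAt (𝓡 d) x₀).symm (range (𝓡 d)) y =
      chartFrame x₀ y := by
  rw [ModelWithCorners.range_eq_univ, mfderivWithin_univ]; rfl

lemma extChartAt_symm_mem_chart_source {x₀ : M} {y : 𝔼 d}
    (hy : y ∈ (extChartAt (𝓡 d) x₀).target) :
    (extChartAt (𝓡 d) x₀).symm y ∈ (chartAt (𝔼 d) x₀).source := by
  simpa using (extChartAt (𝓡 d) x₀).map_target hy

/-- All tangent spaces are the same model space by definition, so a change of base point can be made
while keeping model vectors fixed. -/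
lemma bilin_congr_point
    (B : ∀ x : M, TangentSpace (𝓡 d) x →L[ℝ] TangentSpace (𝓡 d) x →L[ℝ] ℝ) {x x' : M}
    (h : x = x') (v w : 𝔼 d) : B x v w = B x' v w := by
  subst h; rfl

lemma form_congr_point (σ : ∀ x : M, TangentSpace (𝓡 d) x →L[ℝ] ℝ) {x x' : M}
    (h : x = x') (v : 𝔼 d) : σ x v = σ x' v := by
  subst h; rfl

variable [IsManifold (𝓡 d) ∞ M]

lemma mdifferentiableAt_extChartAt_symm {x₀ : M} {y : 𝔼 d}
    (hy : y ∈ (extChartAt (𝓡 d) x₀).target) :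
    MDifferentiableAt 𝓘(ℝ, 𝔼 d) (𝓡 d) (extChartAt (𝓡 d) x₀).symm y := by
  have := mdifferentiableWithinAt_extChartAt_symm (I := 𝓡 d) hy
  rwa [ModelWithCorners.range_eq_univ, mdifferentiableWithinAt_univ] at this

lemma symmL_trivializationAt_eq_chartFrame {x₀ : M} {y : 𝔼 d}
    (hy : y ∈ (extChartAt (𝓡 d) x₀).target) :
    (trivializationAt (𝔼 d) (TangentSpace (𝓡 d)) x₀).symmL ℝ
      ((extChartAt (𝓡 d) x₀).symm y) = chartFrame x₀ y := by
  have h := TangentBundle.symmL_trivializationAt (𝕜 := ℝ) (I := 𝓡 d)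
    (extChartAt_symm_mem_chart_source hy)
  have hr := (extChartAt (𝓡 d) x₀).right_inv hy
  rw [← mfderivWithin_range_eq_chartFrame]
  refine h.trans ?_
  congr

lemma mfderiv_extChartAt_chartFrame {x₀ : M} {y : 𝔼 d}
    (hy : y ∈ (extChartAt (𝓡 d) x₀).target) (v : 𝔼 d) :
    mfderiv (𝓡 d) 𝓘(ℝ, 𝔼 d) (extChartAt (𝓡 d) x₀) ((extChartAt (𝓡 d) x₀).symm y)
      (chartFrame x₀ y v) = v := by
  have h := mfderiv_extChartAt_comp_mfderivWithin_extChartAt_symm (I := 𝓡 d) hy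
  rw [mfderivWithin_range_eq_chartFrame] at h
  exact congrArg (fun L => L v) h

lemma chartFrame_mfderiv_extChartAt {x₀ : M} {y : 𝔼 d}
    (hy : y ∈ (extChartAt (𝓡 d) x₀).target)
    (v : TangentSpace (𝓡 d) ((extChartAt (𝓡 d) x₀).symm y)) :
    chartFrame x₀ y (mfderiv (𝓡 d) 𝓘(ℝ, 𝔼 d) (extChartAt (𝓡 d) x₀)
      ((extChartAt (𝓡 d) x₀).symm y) v) = v := by
  have h := mfderivWithin_extChartAt_symm_comp_mfderiv_extChartAt (I := 𝓡 d) hy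
  rw [mfderivWithin_range_eq_chartFrame] at h
  exact congrArg (fun L => L v) h

lemma chartFrame_endRep (J : ∀ x : M, TangentSpace (𝓡 d) x →L[ℝ] TangentSpace (𝓡 d) x)
    {x₀ : M} {y : 𝔼 d} (hy : y ∈ (extChartAt (𝓡 d) x₀).target) (v : 𝔼 d) :
    chartFrame x₀ y (endRep J x₀ y v) =
      J ((extChartAt (𝓡 d) x₀).symm y) (chartFrame x₀ y v) :=
  chartFrame_mfderiv_extChartAt hy _

lemma chartFrame_injective {x₀ : M} {y : 𝔼 d} (hy : y ∈ (extChartAt (𝓡 d) x₀).target) :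
    Function.Injective (chartFrame x₀ y) :=
  Function.LeftInverse.injective
    (g := mfderiv (𝓡 d) 𝓘(ℝ, 𝔼 d) (extChartAt (𝓡 d) x₀) ((extChartAt (𝓡 d) x₀).symm y))
    fun v => mfderiv_extChartAt_chartFrame hy v

lemma inCoordinates_form (σ : ∀ x : M, TangentSpace (𝓡 d) x →L[ℝ] ℝ) {x₀ : M} {y : 𝔼 d}
    (hy : y ∈ (extChartAt (𝓡 d) x₀).target) :
    ContinuousLinearMap.inCoordinates (𝔼 d) (TangentSpace (𝓡 d) (M := M)) ℝ (Bundle.Trivial M ℝ)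
      x₀ ((extChartAt (𝓡 d) x₀).symm y) x₀ ((extChartAt (𝓡 d) x₀).symm y) (σ _) =
      formRep σ x₀ y := by
  ext v
  rw [ContinuousLinearMap.inCoordinates, symmL_trivializationAt_eq_chartFrame hy]
  simp [formRep]

lemma inCoordinates_end (J : ∀ x : M, TangentSpace (𝓡 d) x →L[ℝ] TangentSpace (𝓡 d) x)
    {x₀ : M} {y : 𝔼 d} (hy : y ∈ (extChartAt (𝓡 d) x₀).target) :
    ContinuousLinearMap.inCoordinates (𝔼 d) (TangentSpace (𝓡 d) (M := M)) (𝔼 d)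
      (TangentSpace (𝓡 d) (M := M))
      x₀ ((extChartAt (𝓡 d) x₀).symm y) x₀ ((extChartAt (𝓡 d) x₀).symm y) (J _) =
      endRep J x₀ y := by
  rw [ContinuousLinearMap.inCoordinates, symmL_trivializationAt_eq_chartFrame hy,
    TangentBundle.continuousLinearMapAt_trivializationAt (extChartAt_symm_mem_chart_source hy)]
  rfl

lemma inCoordinates_bilin
    (B : ∀ x : M, TangentSpace (𝓡 d) x →L[ℝ] TangentSpace (𝓡 d) x →L[ℝ] ℝ)
    {x₀ : M} {y : 𝔼 d} (hy : y ∈ (extChartAt (𝓡 d) x₀).target) :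
    ContinuousLinearMap.inCoordinates (𝔼 d) (TangentSpace (𝓡 d) (M := M)) (𝔼 d →L[ℝ] ℝ)
      (fun x : M => TangentSpace (𝓡 d) x →L[ℝ] ℝ) x₀ ((extChartAt (𝓡 d) x₀).symm y)
      x₀ ((extChartAt (𝓡 d) x₀).symm y) (B _) = bilinRep B x₀ y := by
  ext v w
  have hs : (extChartAt (𝓡 d) x₀).symm y ∈
      (trivializationAt (𝔼 d) (fun x : M => TangentSpace (𝓡 d) x) x₀).baseSet := by
    simpa using extChartAt_symm_mem_chart_source hy
  have := inCoordinates_apply_eq₂ (𝕜 := ℝ) (E₁ := fun x : M => TangentSpace (𝓡 d) x)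
    (E₂ := fun x : M => TangentSpace (𝓡 d) x) (F₁ := 𝔼 d) (F₂ := 𝔼 d) (F₃ := ℝ)
    (E₃ := Bundle.Trivial M ℝ) (x₀ := x₀) (x := (extChartAt (𝓡 d) x₀).symm y) (ϕ := B _)
    (v := v) (w := w) hs hs (mem_univ _)
  refine this.trans ?_
  rw [← Trivialization.symmL_apply (R := ℝ) _ hs, ← Trivialization.symmL_apply (R := ℝ) _ hs,
    symmL_trivializationAt_eq_chartFrame hy, bilinRep_apply]
  simp

lemma contDiffAt_comp_extChartAt_symm {F : Type*} [NormedAddCommGroup F] [NormedSpace ℝ F]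
    {f : M → F} {x₀ : M} (hf : ContMDiffAt (𝓡 d) 𝓘(ℝ, F) ∞ f x₀) :
    ContDiffAt ℝ ∞ (fun y => f ((extChartAt (𝓡 d) x₀).symm y)) (extChartAt (𝓡 d) x₀ x₀) := by
  rw [← contMDiffAt_iff_contDiffAt]
  have h1 : ContMDiffAt 𝓘(ℝ, 𝔼 d) (𝓡 d) ∞ (extChartAt (𝓡 d) x₀).symm
      (extChartAt (𝓡 d) x₀ x₀) :=
    (contMDiffOn_extChartAt_symm x₀).contMDiffAt (extChartAt_target_mem_nhds x₀)
  exact ContMDiffAt.comp (extChartAt (𝓡 d) x₀ x₀) (g := f) (by simpa using hf) h1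

lemma contDiffAt_formRep {σ : ∀ x : M, TangentSpace (𝓡 d) x →L[ℝ] ℝ} {x₀ : M}
    (hσ : ContMDiffAt (𝓡 d) ((𝓡 d).prod 𝓘(ℝ, 𝔼 d →L[ℝ] ℝ)) ∞
      (fun x : M => (TotalSpace.mk' (𝔼 d →L[ℝ] ℝ) x (σ x) :
        TotalSpace _ (fun x : M => TangentSpace (𝓡 d) x →L[ℝ] ℝ))) x₀) :
    ContDiffAt ℝ ∞ (formRep σ x₀) (extChartAt (𝓡 d) x₀ x₀) := by
  rw [contMDiffAt_hom_bundle] at hσ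
  refine (contDiffAt_comp_extChartAt_symm hσ.2).congr_of_eventuallyEq ?_
  filter_upwards [extChartAt_target_mem_nhds (I := 𝓡 d) x₀] with y hy
  exact (inCoordinates_form σ hy).symm

lemma contDiffAt_endRep {J : ∀ x : M, TangentSpace (𝓡 d) x →L[ℝ] TangentSpace (𝓡 d) x} {x₀ : M}
    (hJ : ContMDiffAt (𝓡 d) ((𝓡 d).prod 𝓘(ℝ, 𝔼 d →L[ℝ] 𝔼 d)) ∞
      (fun x : M => (TotalSpace.mk' (𝔼 d →L[ℝ] 𝔼 d) x (J x) :
        TotalSpace _ (fun x : M => TangentSpace (𝓡 d) x →L[ℝ] TangentSpace (𝓡 d) x))) x₀) :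
    ContDiffAt ℝ ∞ (endRep J x₀) (extChartAt (𝓡 d) x₀ x₀) := by
  rw [contMDiffAt_hom_bundle] at hJ
  refine (contDiffAt_comp_extChartAt_symm hJ.2).congr_of_eventuallyEq ?_
  filter_upwards [extChartAt_target_mem_nhds (I := 𝓡 d) x₀] with y hy
  exact (inCoordinates_end J hy).symm

lemma contMDiffAt_bilin_iff
    {B : ∀ x : M, TangentSpace (𝓡 d) x →L[ℝ] TangentSpace (𝓡 d) x →L[ℝ] ℝ} {x₀ : M} :
    ContMDiffAt (𝓡 d) ((𝓡 d).prod 𝓘(ℝ, 𝔼 d →L[ℝ] 𝔼 d →L[ℝ] ℝ)) ∞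
      (fun x : M => (TotalSpace.mk' (𝔼 d →L[ℝ] 𝔼 d →L[ℝ] ℝ) x (B x) :
        TotalSpace _ (fun x : M => TangentSpace (𝓡 d) x →L[ℝ] TangentSpace (𝓡 d) x →L[ℝ] ℝ)))
      x₀ ↔
    ContDiffAt ℝ ∞ (bilinRep B x₀) (extChartAt (𝓡 d) x₀ x₀) := by
  rw [contMDiffAt_hom_bundle]
  constructor
  · intro hB
    refine (contDiffAt_comp_extChartAt_symm hB.2).congr_of_eventuallyEq ?_
    filter_upwards [extChartAt_target_mem_nhds (I := 𝓡 d) x₀] with y hy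
    exact (inCoordinates_bilin B hy).symm
  · intro h
    refine ⟨contMDiffAt_id, ?_⟩
    refine (ContMDiffAt.comp x₀ (contMDiffAt_iff_contDiffAt.2 h)
      (contMDiffAt_extChartAt' (I := 𝓡 d) (by simp))).congr_of_eventuallyEq ?_
    filter_upwards [extChartAt_source_mem_nhds (I := 𝓡 d) x₀] with x hx
    rw [Function.comp_apply, ← inCoordinates_bilin B ((extChartAt (𝓡 d) x₀).map_source hx),
      (extChartAt (𝓡 d) x₀).left_inv hx]

/-! ### Evaluation at the centre of the chart -/

/-- The tangent space at `x` is identified with the model space through the preferred chart at `x`,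
so the derivative of that chart at `x` is the identity. Thus `ricci` and `extD`, which read
components in the chart at the point itself, become plain multilinear algebra. -/
lemma comp_self (x : M) (v : 𝔼 d) (i : Fin d) :
    comp (d := d) x v i = v i := by
  have h : comp (d := d) x v i = (EuclideanSpace.proj i : 𝔼 d →L[ℝ] ℝ)
    (mfderiv (𝓡 d) 𝓘(ℝ, 𝔼 d) (extChartAt (𝓡 d) x) x v) := rfl
  rw [h, mfderiv_extChartAt_self]; rfl

lemma chartFrame_self (x : M) (v : 𝔼 d) :
    chartFrame x (extChartAt (𝓡 d) x x) v = (v : 𝔼 d) := by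
  rw [← mfderivWithin_range_eq_chartFrame, mfderivWithin_range_extChartAt_symm]; rfl

lemma bilinRep_self
    (B : ∀ x : M, TangentSpace (𝓡 d) x →L[ℝ] TangentSpace (𝓡 d) x →L[ℝ] ℝ) (x : M)
    (v w : 𝔼 d) : bilinRep B x (extChartAt (𝓡 d) x x) v w = B x v w := by
  rw [bilinRep_apply, chartFrame_self, chartFrame_self]
  exact bilin_congr_point B (extChartAt_to_inv x) v w

lemma formRep_self (σ : ∀ x : M, TangentSpace (𝓡 d) x →L[ℝ] ℝ) (x : M)
    (v : 𝔼 d) : formRep σ x (extChartAt (𝓡 d) x x) v = σ x v := by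
  rw [formRep_apply, chartFrame_self]
  exact form_congr_point σ (extChartAt_to_inv x) v

/-! ### Maps between manifolds in charts -/

variable {d' : ℕ} {N : Type u} [TopologicalSpace N] [ChartedSpace (𝔼 d') N]
  [IsManifold (𝓡 d') ∞ N]

/-- The expression of a map in the charts at `x₀` and `n₀`. -/
def mapRep (f : M → N) (x₀ : M) (n₀ : N) (y : 𝔼 d) : 𝔼 d' :=
  extChartAt (𝓡 d') n₀ (f ((extChartAt (𝓡 d) x₀).symm y))

lemma contDiffAt_mapRep {f : M → N} (hf : ContMDiff (𝓡 d) (𝓡 d') ∞ f) {x₀ : M} {n₀ : N}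
    {y : 𝔼 d} (hy : y ∈ (extChartAt (𝓡 d) x₀).target)
    (hn : f ((extChartAt (𝓡 d) x₀).symm y) ∈ (extChartAt (𝓡 d') n₀).source) :
    ContDiffAt ℝ ∞ (mapRep (d := d) (d' := d') f x₀ n₀) y := by
  rw [← contMDiffAt_iff_contDiffAt]
  have h1 : ContMDiffAt 𝓘(ℝ, 𝔼 d) (𝓡 d) ∞ (extChartAt (𝓡 d) x₀).symm y :=
    (contMDiffOn_extChartAt_symm x₀).contMDiffAt
      ((isOpen_extChartAt_target (I := 𝓡 d) x₀).mem_nhds hy)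
  exact (contMDiffAt_extChartAt' (by simpa using hn)).comp y (hf.contMDiffAt.comp y h1)

/-- Near `y` the map read in the source chart equals the inverse target chart composed with
`mapRep`. The two sides are the chain rule applied to these two expressions of one function. -/
lemma chartFrame_mapRep {f : M → N} (hf : ContMDiff (𝓡 d) (𝓡 d') ∞ f) {x₀ : M} {n₀ : N}
    {y : 𝔼 d} (hy : y ∈ (extChartAt (𝓡 d) x₀).target)
    (hn : f ((extChartAt (𝓡 d) x₀).symm y) ∈ (extChartAt (𝓡 d') n₀).source) (v : 𝔼 d) :
    (chartFrame n₀ (mapRep f x₀ n₀ y) (fderiv ℝ (mapRep f x₀ n₀) y v) : 𝔼 d') =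
      mfderiv (𝓡 d) (𝓡 d') f ((extChartAt (𝓡 d) x₀).symm y) (chartFrame x₀ y v) := by
  have hfd : MDifferentiableAt (𝓡 d) (𝓡 d') f ((extChartAt (𝓡 d) x₀).symm y) :=
    hf.mdifferentiableAt (by simp)
  have h1 : mfderiv 𝓘(ℝ, 𝔼 d) (𝓡 d') (f ∘ (extChartAt (𝓡 d) x₀).symm) y =
      (mfderiv (𝓡 d) (𝓡 d') f ((extChartAt (𝓡 d) x₀).symm y)).comp (chartFrame x₀ y) :=
    mfderiv_comp y hfd (mdifferentiableAt_extChartAt_symm hy)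
  have hdf : DifferentiableAt ℝ (mapRep (d := d) (d' := d') f x₀ n₀) y :=
    (contDiffAt_mapRep hf hy hn).differentiableAt (by simp)
  have ht : mapRep f x₀ n₀ y ∈ (extChartAt (𝓡 d') n₀).target :=
    (extChartAt (𝓡 d') n₀).map_source hn
  have h2 : mfderiv 𝓘(ℝ, 𝔼 d) (𝓡 d')
      ((extChartAt (𝓡 d') n₀).symm ∘ mapRep (d := d) (d' := d') f x₀ n₀) y v =
      chartFrame (d := d') n₀ (mapRep f x₀ n₀ y) (fderiv ℝ (mapRep f x₀ n₀) y v) := by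
    rw [mfderiv_comp y (mdifferentiableAt_extChartAt_symm ht) hdf.mdifferentiableAt,
      mfderiv_eq_fderiv]
    rfl
  have hc : ContinuousAt (fun y => f ((extChartAt (𝓡 d) x₀).symm y)) y :=
    hfd.continuousAt.comp (mdifferentiableAt_extChartAt_symm hy).continuousAt
  have h3 : (f ∘ (extChartAt (𝓡 d) x₀).symm) =ᶠ[𝓝 y]
      ((extChartAt (𝓡 d') n₀).symm ∘ mapRep f x₀ n₀) := by
    filter_upwards [hc.preimage_mem_nhds ((isOpen_extChartAt_source n₀).mem_nhds hn)] with z hz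
    exact ((extChartAt (𝓡 d') n₀).left_inv hz).symm
  have h4 := h3.mfderiv_eq (I := 𝓘(ℝ, 𝔼 d)) (I' := 𝓡 d')
  rw [h1] at h4
  exact h2.symm.trans (congrArg
    (fun L : TangentSpace 𝓘(ℝ, 𝔼 d) y →L[ℝ] TangentSpace (𝓡 d') _ => L v) h4.symm)

lemma bilinRep_mapRep {f : M → N} (hf : ContMDiff (𝓡 d) (𝓡 d') ∞ f)
    (B : ∀ x : N, TangentSpace (𝓡 d') x →L[ℝ] TangentSpace (𝓡 d') x →L[ℝ] ℝ) {x₀ : M} {n₀ : N}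
    {y : 𝔼 d} (hy : y ∈ (extChartAt (𝓡 d) x₀).target)
    (hn : f ((extChartAt (𝓡 d) x₀).symm y) ∈ (extChartAt (𝓡 d') n₀).source) (v w : 𝔼 d) :
    bilinRep B n₀ (mapRep f x₀ n₀ y) (fderiv ℝ (mapRep f x₀ n₀) y v)
        (fderiv ℝ (mapRep f x₀ n₀) y w) =
      B (f ((extChartAt (𝓡 d) x₀).symm y))
        (mfderiv (𝓡 d) (𝓡 d') f ((extChartAt (𝓡 d) x₀).symm y) (chartFrame x₀ y v))
        (mfderiv (𝓡 d) (𝓡 d') f ((extChartAt (𝓡 d) x₀).symm y) (chartFrame x₀ y w)) := by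
  rw [bilinRep_apply]
  have h1 := chartFrame_mapRep hf hy hn v
  have h2 := chartFrame_mapRep hf hy hn w
  have h3 := bilin_congr_point B ((extChartAt (𝓡 d') n₀).left_inv hn)
    (chartFrame n₀ (mapRep f x₀ n₀ y) (fderiv ℝ (mapRep f x₀ n₀) y v))
    (chartFrame n₀ (mapRep f x₀ n₀ y) (fderiv ℝ (mapRep f x₀ n₀) y w))
  refine h3.trans ?_
  exact congrArg₂ (fun a b : 𝔼 d' => B (f ((extChartAt (𝓡 d) x₀).symm y)) a b) h1 h2

lemma formRep_mapRep {f : M → N} (hf : ContMDiff (𝓡 d) (𝓡 d') ∞ f)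
    (σ : ∀ x : N, TangentSpace (𝓡 d') x →L[ℝ] ℝ) {x₀ : M} {n₀ : N}
    {y : 𝔼 d} (hy : y ∈ (extChartAt (𝓡 d) x₀).target)
    (hn : f ((extChartAt (𝓡 d) x₀).symm y) ∈ (extChartAt (𝓡 d') n₀).source) (v : 𝔼 d) :
    formRep σ n₀ (mapRep f x₀ n₀ y) (fderiv ℝ (mapRep f x₀ n₀) y v) =
      σ (f ((extChartAt (𝓡 d) x₀).symm y))
        (mfderiv (𝓡 d) (𝓡 d') f ((extChartAt (𝓡 d) x₀).symm y) (chartFrame x₀ y v)) := by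
  rw [formRep_apply]
  have h1 := chartFrame_mapRep hf hy hn v
  have h3 := form_congr_point σ ((extChartAt (𝓡 d') n₀).left_inv hn)
    (chartFrame n₀ (mapRep f x₀ n₀ y) (fderiv ℝ (mapRep f x₀ n₀) y v))
  refine h3.trans ?_
  exact congrArg (fun a : 𝔼 d' => σ (f ((extChartAt (𝓡 d) x₀).symm y)) a) h1

end Charts

/-! ## The Levi-Civita connection and its curvature -/

section LeviCivita

variable {E : Type*} [NormedAddCommGroup E] [NormedSpace ℝ E]

/-- `Γ` is the Christoffel form at `y` of the Levi-Civita connection of the metric `G`. -/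
structure IsLeviCivita (G : E → E →L[ℝ] E →L[ℝ] ℝ) (y : E) (Γ : E →L[ℝ] E →L[ℝ] E) : Prop where
  symm : ∀ X Y, Γ X Y = Γ Y X
  compat : ∀ X Y Z, fderiv ℝ G y X Y Z = G y (Γ X Y) Z + G y Y (Γ X Z)

/-- The curvature `R(X, Y) Z` of a connection with Christoffel form `Γ`, whose derivative
is `DΓ`. -/
def curvature (DΓ : E →L[ℝ] E →L[ℝ] E →L[ℝ] E) (Γ : E →L[ℝ] E →L[ℝ] E) (X : E) :
    E →L[ℝ] E →L[ℝ] E :=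
  DΓ X - DΓ.flip X + (ContinuousLinearMap.compL ℝ E E E (Γ X)).comp Γ
    - ((ContinuousLinearMap.compL ℝ E E E).flip (Γ X)).comp Γ

lemma curvature_apply (DΓ : E →L[ℝ] E →L[ℝ] E →L[ℝ] E) (Γ : E →L[ℝ] E →L[ℝ] E) (X Y Z : E) :
    curvature DΓ Γ X Y Z = DΓ X Y Z - DΓ Y X Z + Γ X (Γ Y Z) - Γ Y (Γ X Z) := by
  simp [curvature]

/-- The endomorphism `X ↦ R(X, Y) Z`, whose trace is the Ricci curvature. -/
def curvatureEnd (DΓ : E →L[ℝ] E →L[ℝ] E →L[ℝ] E) (Γ : E →L[ℝ] E →L[ℝ] E) (Y Z : E) :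
    E →ₗ[ℝ] E where
  toFun X := curvature DΓ Γ X Y Z
  map_add' X X' := by simp only [curvature_apply, map_add, _root_.add_apply]; abel
  map_smul' c X := by
    simp only [curvature_apply, map_smul, _root_.smul_apply, RingHom.id_apply,
      smul_add, smul_sub]

lemma curvatureEnd_apply (DΓ : E →L[ℝ] E →L[ℝ] E →L[ℝ] E) (Γ : E →L[ℝ] E →L[ℝ] E) (X Y Z : E) :
    curvatureEnd DΓ Γ Y Z X = DΓ X Y Z - DΓ Y X Z + Γ X (Γ Y Z) - Γ Y (Γ X Z) :=
  curvature_apply DΓ Γ X Y Z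

end LeviCivita

/-! ### Linear maps and traces in the standard basis -/

section Euclidean

variable {d : ℕ} {F : Type*} [NormedAddCommGroup F] [NormedSpace ℝ F]

lemma euclidean_sum_single (v : 𝔼 d) : v = ∑ i, v i • EuclideanSpace.single i (1 : ℝ) := by
  ext j
  simp [Finset.sum_apply, Pi.single_apply]

lemma clm_apply_eq_sum (T : 𝔼 d →L[ℝ] F) (v : 𝔼 d) :
    T v = ∑ i, v i • T (EuclideanSpace.single i 1) := by
  conv_lhs => rw [euclidean_sum_single v]
  simp

lemma clm_apply₂_eq_sum (T : 𝔼 d →L[ℝ] 𝔼 d →L[ℝ] F) (v w : 𝔼 d) :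
    T v w = ∑ i, ∑ j, (v i * w j) • T (EuclideanSpace.single i 1) (EuclideanSpace.single j 1) := by
  rw [clm_apply_eq_sum T v, _root_.sum_apply]
  refine Finset.sum_congr rfl fun i _ => ?_
  rw [_root_.smul_apply, clm_apply_eq_sum (T (EuclideanSpace.single i 1)) w,
    Finset.smul_sum]
  simp [mul_smul]

lemma clm_ext_single {T T' : 𝔼 d →L[ℝ] F}
    (h : ∀ i, T (EuclideanSpace.single i 1) = T' (EuclideanSpace.single i 1)) : T = T' := by
  ext v
  rw [clm_apply_eq_sum T, clm_apply_eq_sum T']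
  simp [h]

lemma trace_eq_sum_single (T : 𝔼 d →ₗ[ℝ] 𝔼 d) :
    LinearMap.trace ℝ (𝔼 d) T = ∑ i, T (EuclideanSpace.single i 1) i := by
  rw [LinearMap.trace_eq_matrix_trace ℝ (EuclideanSpace.basisFun (Fin d) ℝ).toBasis T,
    Matrix.trace]
  simp [LinearMap.toMatrix_apply]

end Euclidean

/-! ### Christoffel symbols and Ricci curvature without indices -/

section Christoffel

variable {d : ℕ} {M : Type u} [TopologicalSpace M] [ChartedSpace (𝔼 d) M]

/-- The Christoffel symbols of `g` in the chart at `x₀` as a vector-valued bilinear form. -/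
def christoffelForm (g : ∀ x : M, TangentSpace (𝓡 d) x →L[ℝ] TangentSpace (𝓡 d) x →L[ℝ] ℝ)
    (x₀ : M) (y : 𝔼 d) : 𝔼 d →L[ℝ] 𝔼 d →L[ℝ] 𝔼 d :=
  ∑ k, ∑ i, ∑ j, christoffel g x₀ k i j y •
    (EuclideanSpace.proj i : 𝔼 d →L[ℝ] ℝ).smulRight
      ((EuclideanSpace.proj j : 𝔼 d →L[ℝ] ℝ).smulRight (EuclideanSpace.single k (1 : ℝ)))

lemma christoffelForm_single
    (g : ∀ x : M, TangentSpace (𝓡 d) x →L[ℝ] TangentSpace (𝓡 d) x →L[ℝ] ℝ)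
    (x₀ : M) (y : 𝔼 d) (k i j : Fin d) :
    christoffelForm g x₀ y (EuclideanSpace.single i 1) (EuclideanSpace.single j 1) k =
      christoffel g x₀ k i j y := by
  simp [christoffelForm, Pi.single_apply]

lemma christoffelForm_single_single
    (g : ∀ x : M, TangentSpace (𝓡 d) x →L[ℝ] TangentSpace (𝓡 d) x →L[ℝ] ℝ)
    (x₀ : M) (y : 𝔼 d) (i j : Fin d) :
    christoffelForm g x₀ y (EuclideanSpace.single i 1) (EuclideanSpace.single j 1) =
      ∑ k, christoffel g x₀ k i j y • EuclideanSpace.single k (1 : ℝ) := by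
  rw [euclidean_sum_single (christoffelForm g x₀ y _ _)]
  simp only [christoffelForm_single]

variable {g : ∀ x : M, TangentSpace (𝓡 d) x →L[ℝ] TangentSpace (𝓡 d) x →L[ℝ] ℝ} {x₀ : M}
  {y : 𝔼 d}

lemma pd_coeff (hd : DifferentiableAt ℝ (bilinRep g x₀) y) (i j k : Fin d) :
    pd i (fun z => coeff g x₀ z j k) y = fderiv ℝ (bilinRep g x₀) y (EuclideanSpace.single i 1)
      (EuclideanSpace.single j 1) (EuclideanSpace.single k 1) := by
  have h := ((hd.hasFDerivAt.clm_apply (hasFDerivAt_const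
    (EuclideanSpace.single j (1 : ℝ)) y)).clm_apply
      (hasFDerivAt_const (EuclideanSpace.single k (1 : ℝ)) y))
  have h' : HasFDerivAt (fun z => coeff g x₀ z j k) _ y := h
  rw [pd, h'.fderiv]
  simp

/-- A kernel vector of the Gram matrix would be a null vector of a positive form. -/
lemma isUnit_det_coeff (hp : ∀ v, v ≠ 0 → 0 < bilinRep g x₀ y v v) :
    IsUnit (coeff g x₀ y).det := by
  rw [isUnit_iff_ne_zero]
  intro h0
  obtain ⟨w, hw, hw0⟩ := Matrix.exists_mulVec_eq_zero_iff.2 h0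
  have hne : (WithLp.toLp 2 w : 𝔼 d) ≠ 0 := by
    intro h
    exact hw (by simpa using h)
  have := hp _ hne
  rw [clm_apply₂_eq_sum] at this
  have h2 : ∑ i, ∑ j, (w i * w j) • bilinRep g x₀ y (EuclideanSpace.single i 1)
      (EuclideanSpace.single j 1) = ∑ i, w i * (Matrix.mulVec (coeff g x₀ y) w) i := by
    refine Finset.sum_congr rfl fun i _ => ?_
    rw [Matrix.mulVec, dotProduct, Finset.mul_sum]
    refine Finset.sum_congr rfl fun j _ => ?_
    rw [coeff_eq_bilinRep, smul_eq_mul]; ring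
  simp only [hw0] at h2
  simp at h2
  simp at this
  linarith

/-- Lowering the upper index cancels the inverse matrix in the definition of the Christoffel
symbols; what is left is the Koszul formula. -/
lemma koszul_single (hp : ∀ v, v ≠ 0 → 0 < bilinRep g x₀ y v v)
    (hs : ∀ v w, bilinRep g x₀ y v w = bilinRep g x₀ y w v)
    (hd : DifferentiableAt ℝ (bilinRep g x₀) y) (i j l : Fin d) :
    bilinRep g x₀ y (christoffelForm g x₀ y (EuclideanSpace.single i 1)
      (EuclideanSpace.single j 1)) (EuclideanSpace.single l 1) =
      1 / 2 * (fderiv ℝ (bilinRep g x₀) y (EuclideanSpace.single i 1)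
        (EuclideanSpace.single j 1) (EuclideanSpace.single l 1) +
      fderiv ℝ (bilinRep g x₀) y (EuclideanSpace.single j 1)
        (EuclideanSpace.single i 1) (EuclideanSpace.single l 1) -
      fderiv ℝ (bilinRep g x₀) y (EuclideanSpace.single l 1)
        (EuclideanSpace.single i 1) (EuclideanSpace.single j 1)) := by
  rw [christoffelForm_single_single, map_sum, _root_.sum_apply]
  simp only [map_smul, _root_.smul_apply, smul_eq_mul, ← pd_coeff hd]
  simp only [christoffel, ← coeff_eq_bilinRep]
  set K : Fin d → ℝ := fun l => pd i (fun z => coeff g x₀ z j l) y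
    + pd j (fun z => coeff g x₀ z i l) y - pd l (fun z => coeff g x₀ z i j) y with hK
  have hinv : (coeff g x₀ y) * (coeff g x₀ y)⁻¹ = 1 :=
    Matrix.mul_nonsing_inv _ (isUnit_det_coeff hp)
  have hsym : ∀ k, coeff g x₀ y k l = coeff g x₀ y l k := fun k => hs _ _
  calc ∑ k, 1 / 2 * (∑ r, (coeff g x₀ y)⁻¹ k r * K r) * coeff g x₀ y k l
      = 1 / 2 * ∑ r, (∑ k, coeff g x₀ y l k * (coeff g x₀ y)⁻¹ k r) * K r := by
        simp only [Finset.mul_sum, Finset.sum_mul]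
        rw [Finset.sum_comm]
        refine Finset.sum_congr rfl fun r _ => Finset.sum_congr rfl fun k _ => ?_
        rw [hsym]; ring
    _ = 1 / 2 * K l := by
        simp only [← Matrix.mul_apply, hinv, Matrix.one_apply]
        simp

/-- The Koszul formula extends from basis vectors by trilinearity. Adding two instances of it, with
the derivative of the metric symmetric in its last two slots, gives compatibility. -/
theorem isLeviCivita_christoffelForm (hp : ∀ v, v ≠ 0 → 0 < bilinRep g x₀ y v v)
    (hs : ∀ z v w, bilinRep g x₀ z v w = bilinRep g x₀ z w v)
    (hd : DifferentiableAt ℝ (bilinRep g x₀) y) :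
    IsLeviCivita (bilinRep g x₀) y (christoffelForm g x₀ y) := by
  set D := fderiv ℝ (bilinRep g x₀) y with hD
  have hDs : ∀ X Y Z, D X Y Z = D X Z Y := by
    intro X Y Z
    have h1 := ((hd.hasFDerivAt.clm_apply (hasFDerivAt_const Y y)).clm_apply
      (hasFDerivAt_const Z y))
    have h2 := ((hd.hasFDerivAt.clm_apply (hasFDerivAt_const Z y)).clm_apply
      (hasFDerivAt_const Y y))
    have h3 : (fun z => bilinRep g x₀ z Y Z) = fun z => bilinRep g x₀ z Z Y :=
      funext fun z => hs z Y Z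
    rw [h3] at h1
    have := congrArg (fun L => L X) (h1.unique h2)
    simpa using this
  have hK : ∀ X Y Z, bilinRep g x₀ y (christoffelForm g x₀ y X Y) Z =
      1 / 2 * (D X Y Z + D Y X Z - D Z X Y) := by
    have hT : (ContinuousLinearMap.compL ℝ (𝔼 d) (𝔼 d) (𝔼 d →L[ℝ] ℝ) (bilinRep g x₀ y)).comp
        (christoffelForm g x₀ y) = (1 / 2 : ℝ) • (D + D.flip -
        ((ContinuousLinearMap.flipₗᵢ ℝ (𝔼 d) (𝔼 d) ℝ).toContinuousLinearEquiv :
          (𝔼 d →L[ℝ] 𝔼 d →L[ℝ] ℝ) →L[ℝ] (𝔼 d →L[ℝ] 𝔼 d →L[ℝ] ℝ)).comp D.flip) := by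
      refine clm_ext_single fun i => clm_ext_single fun j => clm_ext_single fun l => ?_
      have := koszul_single hp (hs y) hd i j l
      simpa using this
    intro X Y Z
    have := congrArg (fun L => L X Y Z) hT
    simpa using this
  constructor
  · have hT : christoffelForm g x₀ y = (christoffelForm g x₀ y).flip := by
      refine clm_ext_single fun i => clm_ext_single fun j => ?_
      ext k
      rw [ContinuousLinearMap.flip_apply, christoffelForm_single, christoffelForm_single,
        christoffel, christoffel]
      congr 1
      refine Finset.sum_congr rfl fun l _ => ?_
      have : (fun z => coeff g x₀ z i j) = fun z => coeff g x₀ z j i := funext fun z => hs z _ _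
      rw [this]; ring
    intro X Y
    exact congrArg (fun L => L X Y) hT
  · intro X Y Z
    rw [hs y Y, hK, hK, hDs X Z Y, hDs Z X Y]
    have := hDs Y X Z
    linarith

lemma differentiableAt_matrix_det {n : ℕ} {A : 𝔼 d → Matrix (Fin n) (Fin n) ℝ}
    (hA : ∀ i j, DifferentiableAt ℝ (fun z => A z i j) y) :
    DifferentiableAt ℝ (fun z => (A z).det) y := by
  simp only [Matrix.det_apply]
  refine DifferentiableAt.fun_sum fun σ _ => DifferentiableAt.const_smul ?_ _
  exact (HasFDerivAt.finsetProd fun i _ => (hA (σ i) i).hasFDerivAt).differentiableAt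

lemma differentiableAt_matrix_inv {n : ℕ} {A : 𝔼 d → Matrix (Fin n) (Fin n) ℝ}
    (hA : ∀ i j, DifferentiableAt ℝ (fun z => A z i j) y) (hu : IsUnit (A y).det) (i j : Fin n) :
    DifferentiableAt ℝ (fun z => (A z)⁻¹ i j) y := by
  simp only [Matrix.inv_def, Matrix.smul_apply, Ring.inverse_eq_inv', smul_eq_mul,
    Matrix.adjugate_apply]
  refine ((differentiableAt_matrix_det hA).inv (isUnit_iff_ne_zero.1 hu)).mul
    (differentiableAt_matrix_det fun k l => ?_)
  by_cases hk : k = j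
  · subst hk; simp
  · simpa [Matrix.updateRow_ne hk] using hA k l

lemma differentiableAt_christoffelForm (hp : ∀ v, v ≠ 0 → 0 < bilinRep g x₀ y v v)
    (hd : ContDiffAt ℝ ∞ (bilinRep g x₀) y) :
    DifferentiableAt ℝ (christoffelForm g x₀) y := by
  have hd1 : ∀ᶠ z in 𝓝 y, DifferentiableAt ℝ (bilinRep g x₀) z := by
    have := (hd.of_le (m := 1) (by simp)).eventually (by simp)
    filter_upwards [this] with z hz using hz.differentiableAt (by simp)
  have hd2 : DifferentiableAt ℝ (fderiv ℝ (bilinRep g x₀)) y :=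
    (hd.fderiv_right (m := 1) (by norm_cast)).differentiableAt (by simp)
  have hc : ∀ i j, DifferentiableAt ℝ (fun z => coeff g x₀ z i j) y := fun i j =>
    (hd1.self_of_nhds.clm_apply (differentiableAt_const _)).clm_apply (differentiableAt_const _)
  have hpd : ∀ i j k, DifferentiableAt ℝ (fun z => pd i (fun z => coeff g x₀ z j k) z) y := by
    intro i j k
    have : (fun z => pd i (fun z => coeff g x₀ z j k) z) =ᶠ[𝓝 y] fun z =>
      fderiv ℝ (bilinRep g x₀) z (EuclideanSpace.single i 1)
      (EuclideanSpace.single j 1) (EuclideanSpace.single k 1) := by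
      filter_upwards [hd1] with z hz using pd_coeff hz i j k
    refine DifferentiableAt.congr_of_eventuallyEq ?_ this
    exact ((hd2.clm_apply (differentiableAt_const _)).clm_apply
      (differentiableAt_const _)).clm_apply (differentiableAt_const _)
  unfold christoffelForm
  refine DifferentiableAt.fun_sum fun k _ => DifferentiableAt.fun_sum fun i _ =>
    DifferentiableAt.fun_sum fun j _ => DifferentiableAt.smul_const ?_ _
  unfold christoffel
  refine DifferentiableAt.const_mul (DifferentiableAt.fun_sum fun l _ => ?_) _
  exact (differentiableAt_matrix_inv hc (isUnit_det_coeff hp) k l).mul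
    (((hpd i j l).add (hpd j i l)).sub (hpd l i j))

lemma pd_christoffel (hd : DifferentiableAt ℝ (christoffelForm g x₀) y) (l k i j : Fin d) :
    pd l (christoffel g x₀ k i j) y = fderiv ℝ (christoffelForm g x₀) y
      (EuclideanSpace.single l 1) (EuclideanSpace.single i 1) (EuclideanSpace.single j 1) k := by
  have h := ((EuclideanSpace.proj k : 𝔼 d →L[ℝ] ℝ).hasFDerivAt.comp y
    ((hd.hasFDerivAt.clm_apply (hasFDerivAt_const (EuclideanSpace.single i (1 : ℝ)) y)).clm_apply
      (hasFDerivAt_const (EuclideanSpace.single j (1 : ℝ)) y)))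
  have h' : (christoffel g x₀ k i j) = (EuclideanSpace.proj k : 𝔼 d →L[ℝ] ℝ) ∘ (fun z =>
      christoffelForm g x₀ z (EuclideanSpace.single i (1 : ℝ)) (EuclideanSpace.single j 1)) := by
    funext z
    exact (christoffelForm_single g x₀ z k i j).symm
  rw [pd, h', h.fderiv]
  simp

theorem ricciCoeff_eq (hd : DifferentiableAt ℝ (christoffelForm g x₀) y) (j k : Fin d) :
    ricciCoeff g x₀ j k y = ∑ i, curvature (fderiv ℝ (christoffelForm g x₀) y)
      (christoffelForm g x₀ y) (EuclideanSpace.single i 1) (EuclideanSpace.single j 1)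
      (EuclideanSpace.single k 1) i := by
  rw [ricciCoeff, ← Finset.sum_add_distrib]
  refine Finset.sum_congr rfl fun i _ => ?_
  rw [curvature_apply, pd_christoffel hd, pd_christoffel hd]
  have h1 : ∀ a b c : Fin d, (christoffelForm g x₀ y (EuclideanSpace.single a 1)
      (christoffelForm g x₀ y (EuclideanSpace.single b 1) (EuclideanSpace.single c 1))) i =
      ∑ l, christoffel g x₀ i a l y * christoffel g x₀ l b c y := by
    intro a b c
    rw [christoffelForm_single_single g x₀ y b c, map_sum]
    simp [Finset.sum_apply, christoffelForm_single, mul_comm]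
  simp only [PiLp.sub_apply, PiLp.add_apply, h1, Finset.sum_sub_distrib]
  ring

/-- Writing Ricci as a trace frees it from coordinates, so that it can be evaluated in the coframe
adapted to the bundle. -/
theorem ricci_eq_trace [IsManifold (𝓡 d) ∞ M] (x : M)
    (hd : DifferentiableAt ℝ (christoffelForm g x) (extChartAt (𝓡 d) x x)) (v w : 𝔼 d) :
    ricci g x v w = LinearMap.trace ℝ (𝔼 d) (curvatureEnd
      (fderiv ℝ (christoffelForm g x) (extChartAt (𝓡 d) x x))
      (christoffelForm g x (extChartAt (𝓡 d) x x)) v w) := by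
  have h0 : ricci g x v w = ∑ j, ∑ k, ricciCoeff g x j k (extChartAt (𝓡 d) x x) *
    comp (d := d) x v j * comp (d := d) x w k := rfl
  rw [trace_eq_sum_single, h0]
  simp only [comp_self, ricciCoeff_eq hd]
  set R := curvature (fderiv ℝ (christoffelForm g x) (extChartAt (𝓡 d) x x))
      (christoffelForm g x (extChartAt (𝓡 d) x x)) with hR
  have : ∀ i, (curvatureEnd (fderiv ℝ (christoffelForm g x) (extChartAt (𝓡 d) x x))
      (christoffelForm g x (extChartAt (𝓡 d) x x)) v w) (EuclideanSpace.single i 1) i =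
      ∑ j, ∑ k, R (EuclideanSpace.single i 1) (EuclideanSpace.single j 1)
      (EuclideanSpace.single k 1) i * v j * w k := by
    intro i
    have h1 : (curvatureEnd (fderiv ℝ (christoffelForm g x) (extChartAt (𝓡 d) x x))
      (christoffelForm g x (extChartAt (𝓡 d) x x)) v w) (EuclideanSpace.single i 1) =
      R (EuclideanSpace.single i 1) v w := rfl
    rw [h1, clm_apply₂_eq_sum]
    simp only [WithLp.ofLp_sum, Finset.sum_apply, PiLp.smul_apply, smul_eq_mul]
    refine Finset.sum_congr rfl fun j _ => Finset.sum_congr rfl fun k _ => by ring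
  simp only [this, Finset.sum_mul]
  conv_rhs => rw [Finset.sum_comm]
  exact Finset.sum_congr rfl fun j _ => Finset.sum_comm

end Christoffel

/-! ## The Levi-Civita connection of a connection-type metric -/

section Calculus

variable {E V : Type*} [NormedAddCommGroup E] [NormedSpace ℝ E] [NormedAddCommGroup V]
  [NormedSpace ℝ V]

lemma fderiv_clm_apply₂ {G : E → E →L[ℝ] E →L[ℝ] V} {y : E} (hG : DifferentiableAt ℝ G y)
    {L : E →L[ℝ] V} {Y Z : E} (h : HasFDerivAt (fun z => G z Y Z) L y) (X : E) :
    fderiv ℝ G y X Y Z = L X := by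
  have h' := (hG.hasFDerivAt.clm_apply (hasFDerivAt_const Y y)).clm_apply (hasFDerivAt_const Z y)
  have := congrArg (fun L => L X) (h'.unique h)
  simpa using this

/-- The derivative of a pulled back bilinear form. -/
lemma hasFDerivAt_pullback {H : V → V →L[ℝ] V →L[ℝ] ℝ} {f : E → V} {y : E}
    (hH : DifferentiableAt ℝ H (f y)) (hf : ContDiffAt ℝ ∞ f y) (Y Z : E) :
    ∃ L : E →L[ℝ] ℝ, HasFDerivAt (fun z => H (f z) (fderiv ℝ f z Y) (fderiv ℝ f z Z)) L y ∧
      ∀ X, L X = fderiv ℝ H (f y) (fderiv ℝ f y X) (fderiv ℝ f y Y) (fderiv ℝ f y Z) +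
        H (f y) (fderiv ℝ (fderiv ℝ f) y X Y) (fderiv ℝ f y Z) +
        H (f y) (fderiv ℝ f y Y) (fderiv ℝ (fderiv ℝ f) y X Z) := by
  have h1 : HasFDerivAt f (fderiv ℝ f y) y := (hf.differentiableAt (by simp)).hasFDerivAt
  have h2 : HasFDerivAt (fderiv ℝ f) (fderiv ℝ (fderiv ℝ f) y) y :=
    ((hf.fderiv_right (m := 1) (by norm_cast)).differentiableAt (by simp)).hasFDerivAt
  have h3 : HasFDerivAt (fun z => H (f z)) _ y := hH.hasFDerivAt.comp y h1
  refine ⟨_, (h3.clm_apply (h2.clm_apply (hasFDerivAt_const Y y))).clm_apply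
    (h2.clm_apply (hasFDerivAt_const Z y)), fun X => ?_⟩
  simp
  ring

lemma second_fderiv_symm {f : E → V} {y : E} (hf : ContDiffAt ℝ ∞ f y) (X Y : E) :
    fderiv ℝ (fderiv ℝ f) y X Y = fderiv ℝ (fderiv ℝ f) y Y X := by
  have h : ContDiffAt ℝ 2 f y := hf.of_le (by norm_cast)
  exact (h.isSymmSndFDerivAt (by simp)).eq X Y

end Calculus

section ConnectionMetric

variable {ι : Type*} [Fintype ι] {E : Type*} [NormedAddCommGroup E]
  [NormedSpace ℝ E] {V : ι → Type*} [∀ i, NormedAddCommGroup (V i)] [∀ i, NormedSpace ℝ (V i)]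

/-- The data at `y` of a metric `G = a s ⊗ s + ∑ bᵢ fᵢ^* Hᵢ`, where `ds = ∑ qᵢ fᵢ^* ωᵢ` with
`ωᵢ = Hᵢ(Jᵢ ·, ·)`. -/
structure IsConnectionMetric (a : ℝ) (b q : ι → ℝ) (s : E → E →L[ℝ] ℝ) (f : ∀ i, E → V i)
    (H : ∀ i, V i → V i →L[ℝ] V i →L[ℝ] ℝ) (J : ∀ i, V i → V i →L[ℝ] V i)
    (Γb : ∀ i, V i → V i →L[ℝ] V i →L[ℝ] V i) (G : E → E →L[ℝ] E →L[ℝ] ℝ)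
    (Γ : E → E →L[ℝ] E →L[ℝ] E) (y : E) : Prop where
  form_smooth : ContDiffAt ℝ ∞ s y
  map_smooth : ∀ i, ContDiffAt ℝ ∞ (f i) y
  base_diff : ∀ i, DifferentiableAt ℝ (H i) (f i y)
  metric_diff : DifferentiableAt ℝ G y
  metric : ∀ᶠ z in 𝓝 y, ∀ Y Z, G z Y Z = a * (s z Y * s z Z) +
    ∑ i, b i * H i (f i z) (fderiv ℝ (f i) z Y) (fderiv ℝ (f i) z Z)
  connection : IsLeviCivita G y (Γ y)
  base_connection : ∀ i, IsLeviCivita (H i) (f i y) (Γb i (f i y))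
  base_symm : ∀ i v w, H i (f i y) v w = H i (f i y) w v
  base_pos : ∀ i v, v ≠ 0 → 0 < H i (f i y) v v
  skew : ∀ i v w, H i (f i y) (J i (f i y) v) w = - H i (f i y) v (J i (f i y) w)
  curv : ∀ X Y, fderiv ℝ s y X Y - fderiv ℝ s y Y X =
    ∑ i, q i * H i (f i y) (J i (f i y) (fderiv ℝ (f i) y X)) (fderiv ℝ (f i) y Y)
  surj : ∀ (t : ℝ) (w : ∀ i, V i), ∃ X, s y X = t ∧ ∀ i, fderiv ℝ (f i) y X = w i

variable {a : ℝ} {b q : ι → ℝ} {s : E → E →L[ℝ] ℝ} {f : ∀ i, E → V i}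
    {H : ∀ i, V i → V i →L[ℝ] V i →L[ℝ] ℝ} {J : ∀ i, V i → V i →L[ℝ] V i}
    {Γb : ∀ i, V i → V i →L[ℝ] V i →L[ℝ] V i} {G : E → E →L[ℝ] E →L[ℝ] ℝ}
    {Γ : E → E →L[ℝ] E →L[ℝ] E} {y : E}

namespace IsConnectionMetric

/-- This is the product rule, with the derivative of `H i` absorbed by compatibility of `Γb i`. The
maps then enter only through their Hessian corrected by `Γb i`, the covariant Hessian from flat
coordinates. -/
lemma fderiv_metric (h : IsConnectionMetric a b q s f H J Γb G Γ y) (X Y Z : E) :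
    fderiv ℝ G y X Y Z = a * (fderiv ℝ s y X Y * s y Z + s y Y * fderiv ℝ s y X Z) +
      ∑ i, b i * (H i (f i y) (fderiv ℝ (fderiv ℝ (f i)) y X Y +
          Γb i (f i y) (fderiv ℝ (f i) y X) (fderiv ℝ (f i) y Y)) (fderiv ℝ (f i) y Z) +
        H i (f i y) (fderiv ℝ (f i) y Y) (fderiv ℝ (fderiv ℝ (f i)) y X Z +
          Γb i (f i y) (fderiv ℝ (f i) y X) (fderiv ℝ (f i) y Z))) := by
  have hs : HasFDerivAt s (fderiv ℝ s y) y :=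
    (h.form_smooth.differentiableAt (by simp)).hasFDerivAt
  choose L hL hL' using fun i => hasFDerivAt_pullback (h.base_diff i) (h.map_smooth i) Y Z
  have h1 := ((((hs.clm_apply (hasFDerivAt_const Y y)).mul
    (hs.clm_apply (hasFDerivAt_const Z y))).const_mul a).add
      (HasFDerivAt.fun_sum (u := Finset.univ) fun i _ => (hL i).const_mul (b i)))
  have h2 : HasFDerivAt (fun z => G z Y Z) _ y := h1.congr_of_eventuallyEq (by
    filter_upwards [h.metric] with z hz using hz Y Z)
  rw [fderiv_clm_apply₂ h.metric_diff h2 X]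
  simp only [_root_.add_apply, _root_.sum_apply, _root_.smul_apply, smul_eq_mul, hL',
    (h.base_connection _).compat, map_add]
  congr 1
  · simp [-mul_eq_mul_left_iff]; ring
  · refine Finset.sum_congr rfl fun i _ => ?_
    ring

/-- The second fundamental form of the map `fᵢ`. -/
def secondForm (a : ℝ) (b q : ι → ℝ) (s : E → E →L[ℝ] ℝ) (f : ∀ i, E → V i)
    (J : ∀ i, V i → V i →L[ℝ] V i) (i : ι) (z X Y : E) : V i :=
  (-(a * q i / (2 * b i))) • (s z X • J i (f i z) (fderiv ℝ (f i) z Y) +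
    s z Y • J i (f i z) (fderiv ℝ (f i) z X))

/-- This is uniqueness of the Levi-Civita connection: the candidate `K` on the right has its
symmetry and its compatibility, and two such objects agree. -/
lemma metric_christoffel (h : IsConnectionMetric a b q s f H J Γb G Γ y) (hb : ∀ i, b i ≠ 0)
    (X Y Z : E) :
    G y (Γ y X Y) Z = a * (1 / 2 * (fderiv ℝ s y X Y + fderiv ℝ s y Y X) * s y Z) +
      ∑ i, b i * H i (f i y) (fderiv ℝ (fderiv ℝ (f i)) y X Y +
          Γb i (f i y) (fderiv ℝ (f i) y X) (fderiv ℝ (f i) y Y) -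
          secondForm a b q s f J i y X Y) (fderiv ℝ (f i) y Z) := by
  set K : E → E → E → ℝ := fun X Y Z =>
    a * (1 / 2 * (fderiv ℝ s y X Y + fderiv ℝ s y Y X) * s y Z) +
      ∑ i, b i * H i (f i y) (fderiv ℝ (fderiv ℝ (f i)) y X Y +
          Γb i (f i y) (fderiv ℝ (f i) y X) (fderiv ℝ (f i) y Y) -
          secondForm a b q s f J i y X Y) (fderiv ℝ (f i) y Z) with hK
  have hKs : ∀ X Y Z, K X Y Z = K Y X Z := by
    intro X Y Z
    simp only [hK]
    congr 1
    · ring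
    · refine Finset.sum_congr rfl fun i _ => ?_
      rw [second_fderiv_symm (h.map_smooth i) X Y, (h.base_connection i).symm]
      simp only [secondForm]
      rw [add_comm (s y X • _)]
  have hGs : ∀ v w, G y v w = G y w v := by
    intro v w
    rw [h.metric.self_of_nhds, h.metric.self_of_nhds]
    congr 1
    · ring
    · exact Finset.sum_congr rfl fun i _ => by rw [h.base_symm]
  have hKa : ∀ X Y Z, K X Y Z + K X Z Y = fderiv ℝ G y X Y Z := by
    intro X Y Z
    rw [h.fderiv_metric]
    have e1 := h.curv X Y
    have e2 := h.curv X Z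
    -- The skew part of `fderiv ℝ s y` is the curvature. The factor `a * q i / (2 * b i)` in
    -- `secondForm` is exactly what cancels it, using that `J i` is skew.
    have key : ∑ i, (1 / 2 * a * (q i * H i (f i y) (J i (f i y) (fderiv ℝ (f i) y X))
          (fderiv ℝ (f i) y Y)) * s y Z + 1 / 2 * a * (q i * H i (f i y)
          (J i (f i y) (fderiv ℝ (f i) y X)) (fderiv ℝ (f i) y Z)) * s y Y +
        b i * (H i (f i y) (secondForm a b q s f J i y X Y) (fderiv ℝ (f i) y Z) +
          H i (f i y) (fderiv ℝ (f i) y Y) (secondForm a b q s f J i y X Z))) = 0 := by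
      refine Finset.sum_eq_zero fun i _ => ?_
      have hbi := hb i
      have e3 := h.skew i (fderiv ℝ (f i) y Y) (fderiv ℝ (f i) y Z)
      have e4 := h.base_symm i (fderiv ℝ (f i) y Y) (J i (f i y) (fderiv ℝ (f i) y X))
      simp only [secondForm, map_add, map_smul, _root_.add_apply, _root_.smul_apply, smul_eq_mul,
        e3, e4]
      field_simp
      ring
    simp only [Finset.sum_add_distrib, ← Finset.sum_mul, ← Finset.mul_sum] at key
    rw [← e1, ← e2] at key
    simp only [hK]
    have e5 : ∀ i, b i * H i (f i y) (fderiv ℝ (fderiv ℝ (f i)) y X Z +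
          Γb i (f i y) (fderiv ℝ (f i) y X) (fderiv ℝ (f i) y Z) -
          secondForm a b q s f J i y X Z) (fderiv ℝ (f i) y Y) =
          b i * H i (f i y) (fderiv ℝ (f i) y Y) (fderiv ℝ (fderiv ℝ (f i)) y X Z +
          Γb i (f i y) (fderiv ℝ (f i) y X) (fderiv ℝ (f i) y Z) -
          secondForm a b q s f J i y X Z) := fun i => by rw [h.base_symm]
    rw [Finset.sum_congr rfl fun i _ => e5 i]
    simp only [map_sub, _root_.sub_apply, mul_sub, mul_add, Finset.sum_sub_distrib,
      Finset.sum_add_distrib] at key ⊢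
    linarith
  have hsym : ∀ X Y Z, G y (Γ y X Y) Z - K X Y Z = G y (Γ y Y X) Z - K Y X Z := fun X Y Z => by
    rw [h.connection.symm, hKs]
  have hanti : ∀ X Y Z, G y (Γ y X Y) Z - K X Y Z = -(G y (Γ y X Z) Y - K X Z Y) :=
    fun X Y Z => by
    have e1 := h.connection.compat X Y Z
    rw [hGs Y] at e1
    have e2 := hKa X Y Z
    linarith
  -- A trilinear expression symmetric in its first two and skew in its last two slots vanishes, by
  -- going around the permutations.
  have e1 := hanti X Y Z
  have e2 := hanti Z X Y
  have e3 := hanti Y Z X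
  rw [hsym Z X] at e2
  rw [hsym Y Z] at e3
  rw [hsym Y X] at e3
  change G y (Γ y X Y) Z = K X Y Z
  linarith

/-- Testing `metric_christoffel` on the vertical unit vector isolates the component along `s`. -/
lemma form_christoffel (h : IsConnectionMetric a b q s f H J Γb G Γ y) (ha : a ≠ 0)
    (hb : ∀ i, b i ≠ 0) (X Y : E) :
    s y (Γ y X Y) = 1 / 2 * (fderiv ℝ s y X Y + fderiv ℝ s y Y X) := by
  obtain ⟨U, hU, hU'⟩ := h.surj 1 0
  have h1 := h.metric_christoffel hb X Y U
  rw [h.metric.self_of_nhds] at h1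
  simp only [hU, hU', Pi.zero_apply, map_zero, mul_zero, Finset.sum_const_zero, add_zero,
    mul_one] at h1
  exact mul_left_cancel₀ ha h1

/-- Testing `metric_christoffel` on the lift of the defect `W` itself gives `H i W W = 0`, so
positivity forces `W = 0`. -/
lemma map_christoffel (h : IsConnectionMetric a b q s f H J Γb G Γ y)
    (hb : ∀ i, b i ≠ 0) (i : ι) (X Y : E) :
    fderiv ℝ (f i) y (Γ y X Y) = fderiv ℝ (fderiv ℝ (f i)) y X Y +
      Γb i (f i y) (fderiv ℝ (f i) y X) (fderiv ℝ (f i) y Y) - secondForm a b q s f J i y X Y := by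
  classical
  set W : V i := fderiv ℝ (f i) y (Γ y X Y) - (fderiv ℝ (fderiv ℝ (f i)) y X Y +
      Γb i (f i y) (fderiv ℝ (f i) y X) (fderiv ℝ (f i) y Y) - secondForm a b q s f J i y X Y)
    with hW
  by_contra hne
  have hpos := h.base_pos i W (sub_ne_zero.2 hne)
  obtain ⟨U, hU, hU'⟩ := h.surj 0 (Pi.single i W)
  have h1 := h.metric_christoffel hb X Y U
  rw [h.metric.self_of_nhds] at h1
  rw [hU, Finset.sum_eq_single i, Finset.sum_eq_single i, hU' i] at h1
  · simp only [Pi.single_eq_same, mul_zero, zero_add] at h1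
    have h2 := mul_left_cancel₀ (hb i) h1
    rw [← sub_eq_zero, ← _root_.sub_apply, ← map_sub, ← hW] at h2
    exact hpos.ne' h2
  · intro j _ hj
    rw [hU' j, Pi.single_eq_of_ne hj]; simp
  · simp
  · intro j _ hj
    rw [hU' j, Pi.single_eq_of_ne hj]; simp
  · simp

end IsConnectionMetric

end ConnectionMetric

/-! ## The Ricci curvature of a connection-type metric -/

section ConnectionCurvature

variable {ι : Type*} [Fintype ι] {E : Type*} [NormedAddCommGroup E]
  [NormedSpace ℝ E] {V : ι → Type*} [∀ i, NormedAddCommGroup (V i)] [∀ i, NormedSpace ℝ (V i)]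
  {a : ℝ} {b q : ι → ℝ} {s : E → E →L[ℝ] ℝ} {f : ∀ i, E → V i}
  {H : ∀ i, V i → V i →L[ℝ] V i →L[ℝ] ℝ} {J : ∀ i, V i → V i →L[ℝ] V i}
  {Γb : ∀ i, V i → V i →L[ℝ] V i →L[ℝ] V i} {G : E → E →L[ℝ] E →L[ℝ] ℝ}
  {Γ : E → E →L[ℝ] E →L[ℝ] E} {y : E}

open IsConnectionMetric

lemma hasFDerivAt_eq_of_eventuallyEq {F : Type*} [NormedAddCommGroup F] [NormedSpace ℝ F]
    {g h : E → F} {L L' : E →L[ℝ] F} (hg : HasFDerivAt g L y) (hh : HasFDerivAt h L' y)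
    (e : ∀ᶠ z in 𝓝 y, g z = h z) (X : E) : L X = L' X := by
  rw [hg.unique (hh.congr_of_eventuallyEq e)]

/-- A connection-type metric near `y` over base metrics with parallel complex structures. -/
structure IsKahlerConnectionMetric (a : ℝ) (b q : ι → ℝ) (s : E → E →L[ℝ] ℝ) (f : ∀ i, E → V i)
    (H : ∀ i, V i → V i →L[ℝ] V i →L[ℝ] ℝ) (J : ∀ i, V i → V i →L[ℝ] V i)
    (Γb : ∀ i, V i → V i →L[ℝ] V i →L[ℝ] V i) (G : E → E →L[ℝ] E →L[ℝ] ℝ)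
    (Γ : E → E →L[ℝ] E →L[ℝ] E) (y : E) : Prop where
  eventually : ∀ᶠ z in 𝓝 y, IsConnectionMetric a b q s f H J Γb G Γ z
  fibre_ne : a ≠ 0
  base_ne : ∀ i, b i ≠ 0
  christoffel_diff : DifferentiableAt ℝ Γ y
  base_christoffel_diff : ∀ i, DifferentiableAt ℝ (Γb i) (f i y)
  complex_diff : ∀ i, DifferentiableAt ℝ (J i) (f i y)
  complex_sq : ∀ i v, J i (f i y) (J i (f i y) v) = -v
  parallel : ∀ i X Y, fderiv ℝ (J i) (f i y) X Y + Γb i (f i y) X (J i (f i y) Y) =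
    J i (f i y) (Γb i (f i y) X Y)
  inj : ∀ X, s y X = 0 → (∀ i, fderiv ℝ (f i) y X = 0) → X = 0

namespace IsKahlerConnectionMetric

lemma christoffel_hasFDerivAt (h : IsKahlerConnectionMetric a b q s f H J Γb G Γ y) (Y Z : E) :
    ∃ L : E →L[ℝ] E, HasFDerivAt (fun z => Γ z Y Z) L y ∧ ∀ X, L X = fderiv ℝ Γ y X Y Z := by
  refine ⟨_, (h.christoffel_diff.hasFDerivAt.clm_apply (hasFDerivAt_const Y y)).clm_apply
    (hasFDerivAt_const Z y), fun X => ?_⟩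
  simp

lemma fderiv_form_christoffel (h : IsKahlerConnectionMetric a b q s f H J Γb G Γ y)
    (X Y Z : E) :
    s y (fderiv ℝ Γ y X Y Z) = 1 / 2 * (fderiv ℝ (fderiv ℝ s) y X Y Z +
      fderiv ℝ (fderiv ℝ s) y X Z Y) - fderiv ℝ s y X (Γ y Y Z) := by
  have hs := h.eventually.self_of_nhds.form_smooth
  have h1 : HasFDerivAt s (fderiv ℝ s y) y := (hs.differentiableAt (by simp)).hasFDerivAt
  have h2 : HasFDerivAt (fderiv ℝ s) (fderiv ℝ (fderiv ℝ s) y) y :=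
    ((hs.fderiv_right (m := 1) (by norm_cast)).differentiableAt (by simp)).hasFDerivAt
  obtain ⟨L, hL, hL'⟩ := h.christoffel_hasFDerivAt Y Z
  have h3 := h1.clm_apply hL
  have h4 := (((h2.clm_apply (hasFDerivAt_const Y y)).clm_apply (hasFDerivAt_const Z y)).add
    ((h2.clm_apply (hasFDerivAt_const Z y)).clm_apply (hasFDerivAt_const Y y))).const_mul (1 / 2)
  have h5 := hasFDerivAt_eq_of_eventuallyEq h3 h4 (by
    filter_upwards [h.eventually] with z hz
    exact hz.form_christoffel h.fibre_ne h.base_ne Y Z) X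
  simp [hL', -one_div] at h5
  linarith

/-- Both the metric and the complex structure are parallel, hence so is `H (J ·, ·)`. -/
lemma fderiv_kahlerForm (h : IsKahlerConnectionMetric a b q s f H J Γb G Γ y) (i : ι)
    (A B C : V i) :
    fderiv ℝ (fun v => (H i v).comp (J i v)) (f i y) A B C =
      H i (f i y) (J i (f i y) (Γb i (f i y) A B)) C +
        H i (f i y) (J i (f i y) B) (Γb i (f i y) A C) := by
  have h1 := h.eventually.self_of_nhds
  have h2 := (h1.base_diff i).hasFDerivAt.clm_comp (h.complex_diff i).hasFDerivAt
  rw [h2.fderiv, ← h.parallel]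
  have h3 := (h1.base_connection i).compat A (J i (f i y) B) C
  simp
  rw [h3]
  ring

lemma fderiv_curv (h : IsKahlerConnectionMetric a b q s f H J Γb G Γ y) (Z X Y : E) :
    fderiv ℝ (fderiv ℝ s) y Z X Y - fderiv ℝ (fderiv ℝ s) y Z Y X =
      ∑ i, q i * (H i (f i y) (J i (f i y) (fderiv ℝ (fderiv ℝ (f i)) y Z X +
          Γb i (f i y) (fderiv ℝ (f i) y Z) (fderiv ℝ (f i) y X))) (fderiv ℝ (f i) y Y) +
        H i (f i y) (J i (f i y) (fderiv ℝ (f i) y X)) (fderiv ℝ (fderiv ℝ (f i)) y Z Y +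
          Γb i (f i y) (fderiv ℝ (f i) y Z) (fderiv ℝ (f i) y Y))) := by
  have h0 := h.eventually.self_of_nhds
  have hs := h0.form_smooth
  have h2 : HasFDerivAt (fderiv ℝ s) (fderiv ℝ (fderiv ℝ s) y) y :=
    ((hs.fderiv_right (m := 1) (by norm_cast)).differentiableAt (by simp)).hasFDerivAt
  choose L hL hL' using fun i => hasFDerivAt_pullback (H := fun v => (H i v).comp (J i v))
    (((h0.base_diff i).hasFDerivAt.clm_comp (h.complex_diff i).hasFDerivAt).differentiableAt)
    (h0.map_smooth i) X Y
  have h3 := ((h2.clm_apply (hasFDerivAt_const X y)).clm_apply (hasFDerivAt_const Y y)).sub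
    ((h2.clm_apply (hasFDerivAt_const Y y)).clm_apply (hasFDerivAt_const X y))
  have h4 := HasFDerivAt.fun_sum (u := Finset.univ) fun i _ => (hL i).const_mul (q i)
  have h5 := hasFDerivAt_eq_of_eventuallyEq h3 h4 (by
    filter_upwards [h.eventually] with z hz
    exact hz.curv X Y) Z
  simp only [_root_.sum_apply, _root_.smul_apply, smul_eq_mul, hL', h.fderiv_kahlerForm] at h5
  simp only [_root_.sub_apply, _root_.add_apply, ContinuousLinearMap.comp_apply,
    ContinuousLinearMap.flip_apply, _root_.zero_apply, map_zero, zero_add] at h5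
  rw [h5]
  refine Finset.sum_congr rfl fun i _ => ?_
  simp only [map_add, _root_.add_apply]
  ring

/-- Symmetry of second derivatives reduces the left side to half the covariant derivative of the
curvature form `ds`. As the base Kähler forms are parallel, only the second fundamental forms of the
maps survive. -/
lemma form_curvature (h : IsKahlerConnectionMetric a b q s f H J Γb G Γ y) (X Y Z : E) :
    s y (curvatureEnd (fderiv ℝ Γ y) (Γ y) Y Z X) =
      ∑ i, 1 / 2 * q i * (H i (f i y) (J i (f i y) (secondForm a b q s f J i y Z X))
          (fderiv ℝ (f i) y Y) + H i (f i y) (J i (f i y) (fderiv ℝ (f i) y X))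
          (secondForm a b q s f J i y Z Y)) := by
  have h0 := h.eventually.self_of_nhds
  have hs := h0.form_smooth
  have e1 := h.fderiv_curv Z X Y
  have e2 := h0.curv X (Γ y Y Z)
  have e3 := h0.curv Y (Γ y X Z)
  have e4 := h0.form_christoffel h.fibre_ne h.base_ne X (Γ y Y Z)
  have e5 := h0.form_christoffel h.fibre_ne h.base_ne Y (Γ y X Z)
  have e6 : ∑ i, q i * H i (f i y) (J i (f i y) (fderiv ℝ (f i) y Y))
      (fderiv ℝ (f i) y (Γ y X Z)) = ∑ i, - (q i * H i (f i y) (J i (f i y)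
        (fderiv ℝ (f i) y (Γ y X Z))) (fderiv ℝ (f i) y Y)) := by
    refine Finset.sum_congr rfl fun i _ => ?_
    rw [h0.skew, h0.base_symm]; ring
  have key : ∑ i, 1 / 2 * q i * (H i (f i y) (J i (f i y) (secondForm a b q s f J i y Z X))
          (fderiv ℝ (f i) y Y) + H i (f i y) (J i (f i y) (fderiv ℝ (f i) y X))
          (secondForm a b q s f J i y Z Y)) =
      1 / 2 * (∑ i, q i * (H i (f i y) (J i (f i y) (fderiv ℝ (fderiv ℝ (f i)) y Z X +
          Γb i (f i y) (fderiv ℝ (f i) y Z) (fderiv ℝ (f i) y X))) (fderiv ℝ (f i) y Y) +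
        H i (f i y) (J i (f i y) (fderiv ℝ (f i) y X)) (fderiv ℝ (fderiv ℝ (f i)) y Z Y +
          Γb i (f i y) (fderiv ℝ (f i) y Z) (fderiv ℝ (f i) y Y)))
        - ∑ i, q i * H i (f i y) (J i (f i y) (fderiv ℝ (f i) y X))
            (fderiv ℝ (f i) y (Γ y Y Z))
        + ∑ i, - (q i * H i (f i y) (J i (f i y)
        (fderiv ℝ (f i) y (Γ y X Z))) (fderiv ℝ (f i) y Y))) := by
    rw [← Finset.sum_sub_distrib, ← Finset.sum_add_distrib, Finset.mul_sum]
    refine Finset.sum_congr rfl fun i _ => ?_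
    rw [h0.connection.symm X Z, h0.connection.symm Y Z, h0.map_christoffel h.base_ne,
      h0.map_christoffel h.base_ne]
    simp only [map_sub, _root_.sub_apply]
    ring
  rw [key, ← e6, ← e3, ← e2, ← e1, curvatureEnd_apply, map_sub, map_add, map_sub,
    h.fderiv_form_christoffel, h.fderiv_form_christoffel, e4, e5]
  have s1 := congrArg (fun L => L Z) (second_fderiv_symm hs X Y)
  have s2 := congrArg (fun L => L Y) (second_fderiv_symm hs X Z)
  have s3 := congrArg (fun L => L X) (second_fderiv_symm hs Y Z)
  rw [s1, s2, s3]
  ring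

lemma hasFDerivAt_secondForm (h : IsKahlerConnectionMetric a b q s f H J Γb G Γ y) (i : ι)
    (Y Z : E) :
    ∃ L : E →L[ℝ] V i, HasFDerivAt (fun z => secondForm a b q s f J i z Y Z) L y ∧
      ∀ X, L X + Γb i (f i y) (fderiv ℝ (f i) y X) (secondForm a b q s f J i y Y Z) =
        (-(a * q i / (2 * b i))) • (fderiv ℝ s y X Y • J i (f i y) (fderiv ℝ (f i) y Z) +
        s y Y • J i (f i y) (fderiv ℝ (fderiv ℝ (f i)) y X Z +
          Γb i (f i y) (fderiv ℝ (f i) y X) (fderiv ℝ (f i) y Z)) +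
        (fderiv ℝ s y X Z • J i (f i y) (fderiv ℝ (f i) y Y) +
        s y Z • J i (f i y) (fderiv ℝ (fderiv ℝ (f i)) y X Y +
          Γb i (f i y) (fderiv ℝ (f i) y X) (fderiv ℝ (f i) y Y)))) := by
  have h0 := h.eventually.self_of_nhds
  have h1 : HasFDerivAt s (fderiv ℝ s y) y :=
    (h0.form_smooth.differentiableAt (by simp)).hasFDerivAt
  have h2 : HasFDerivAt (f i) (fderiv ℝ (f i) y) y :=
    ((h0.map_smooth i).differentiableAt (by simp)).hasFDerivAt
  have h3 : HasFDerivAt (fderiv ℝ (f i)) (fderiv ℝ (fderiv ℝ (f i)) y) y :=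
    (((h0.map_smooth i).fderiv_right (m := 1) (by norm_cast)).differentiableAt
      (by simp)).hasFDerivAt
  have h4 : HasFDerivAt (fun z => J i (f i z)) _ y := (h.complex_diff i).hasFDerivAt.comp y h2
  have hS : ∀ W : E, HasFDerivAt (fun z => s z W) _ y :=
    fun W => h1.clm_apply (hasFDerivAt_const W y)
  have hJ : ∀ W : E, HasFDerivAt (fun z => J i (f i z) (fderiv ℝ (f i) z W)) _ y :=
    fun W => h4.clm_apply (h3.clm_apply (hasFDerivAt_const W y))
  refine ⟨_, (((hS Y).smul (hJ Z)).add ((hS Z).smul (hJ Y))).const_smul _, fun X => ?_⟩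
  have p1 := h.parallel i (fderiv ℝ (f i) y X) (fderiv ℝ (f i) y Y)
  have p2 := h.parallel i (fderiv ℝ (f i) y X) (fderiv ℝ (f i) y Z)
  simp only [map_add, ← p1, ← p2, secondForm]
  simp
  module

/-- Beyond the base curvature there is the antisymmetrized covariant derivative of `secondForm`.
Parallelism of `J i` lets the derivative fall on `s` only, and `J² = -1` turns the quadratic terms
into the summand with `(a * q i / (2 * b i)) ^ 2`. -/
lemma map_curvature (h : IsKahlerConnectionMetric a b q s f H J Γb G Γ y) (i : ι) (X Y Z : E) :
    fderiv ℝ (f i) y (curvatureEnd (fderiv ℝ Γ y) (Γ y) Y Z X) =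
      curvatureEnd (fderiv ℝ (Γb i) (f i y)) (Γb i (f i y)) (fderiv ℝ (f i) y Y)
        (fderiv ℝ (f i) y Z) (fderiv ℝ (f i) y X) -
      (-(a * q i / (2 * b i))) • (
        (fderiv ℝ s y X Y - fderiv ℝ s y Y X) • J i (f i y) (fderiv ℝ (f i) y Z) +
        (1 / 2 * (fderiv ℝ s y X Z - fderiv ℝ s y Z X)) • J i (f i y) (fderiv ℝ (f i) y Y) -
        (1 / 2 * (fderiv ℝ s y Y Z - fderiv ℝ s y Z Y)) • J i (f i y) (fderiv ℝ (f i) y X)) +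
      (a * q i / (2 * b i)) ^ 2 • ((s y Y * s y Z) • fderiv ℝ (f i) y X -
        (s y X * s y Z) • fderiv ℝ (f i) y Y) := by
  have h0 := h.eventually.self_of_nhds
  have h2 : HasFDerivAt (f i) (fderiv ℝ (f i) y) y :=
    ((h0.map_smooth i).differentiableAt (by simp)).hasFDerivAt
  have hf1 : ContDiffAt ℝ ∞ (fderiv ℝ (f i)) y := (h0.map_smooth i).fderiv_right (by simp)
  have h3 : HasFDerivAt (fderiv ℝ (f i)) (fderiv ℝ (fderiv ℝ (f i)) y) y :=
    (hf1.differentiableAt (by simp)).hasFDerivAt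
  have h4 : HasFDerivAt (fderiv ℝ (fderiv ℝ (f i)))
      (fderiv ℝ (fderiv ℝ (fderiv ℝ (f i))) y) y :=
    ((hf1.fderiv_right (m := 1) (by norm_cast)).differentiableAt (by simp)).hasFDerivAt
  have h5 : HasFDerivAt (fun z => Γb i (f i z)) _ y :=
    (h.base_christoffel_diff i).hasFDerivAt.comp y h2
  -- This is the part of the curvature before antisymmetrization in `X` and `Y`. The third
  -- derivative of `f i` and the bracket pairing `Γb i` with Hessians are symmetric in `X` and `Y`,
  -- so they drop out of the difference.
  have main : ∀ X Y Z : E,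
      fderiv ℝ (f i) y (fderiv ℝ Γ y X Y Z) + fderiv ℝ (f i) y (Γ y X (Γ y Y Z)) =
      fderiv ℝ (fderiv ℝ (fderiv ℝ (f i))) y X Y Z +
      fderiv ℝ (Γb i) (f i y) (fderiv ℝ (f i) y X) (fderiv ℝ (f i) y Y) (fderiv ℝ (f i) y Z) +
      Γb i (f i y) (fderiv ℝ (f i) y X) (Γb i (f i y) (fderiv ℝ (f i) y Y) (fderiv ℝ (f i) y Z)) +
      (Γb i (f i y) (fderiv ℝ (f i) y Z) (fderiv ℝ (fderiv ℝ (f i)) y X Y) +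
        (Γb i (f i y) (fderiv ℝ (f i) y Y) (fderiv ℝ (fderiv ℝ (f i)) y X Z) +
        Γb i (f i y) (fderiv ℝ (f i) y X) (fderiv ℝ (fderiv ℝ (f i)) y Y Z))) -
      (-(a * q i / (2 * b i))) • (fderiv ℝ s y X Y • J i (f i y) (fderiv ℝ (f i) y Z) +
        s y Y • J i (f i y) (fderiv ℝ (f i) y (Γ y X Z) + secondForm a b q s f J i y X Z) +
        (fderiv ℝ s y X Z • J i (f i y) (fderiv ℝ (f i) y Y) +
        s y Z • J i (f i y) (fderiv ℝ (f i) y (Γ y X Y) + secondForm a b q s f J i y X Y)) +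
        (s y X • J i (f i y) (fderiv ℝ (f i) y (Γ y Y Z)) +
          s y (Γ y Y Z) • J i (f i y) (fderiv ℝ (f i) y X))) := by
    intro X Y Z
    obtain ⟨L, hL, hL'⟩ := h.christoffel_hasFDerivAt Y Z
    obtain ⟨L₂, hL₂, hL₂'⟩ := h.hasFDerivAt_secondForm i Y Z
    have e1 := h3.clm_apply hL
    have e2 := ((((h4.clm_apply (hasFDerivAt_const Y y)).clm_apply (hasFDerivAt_const Z y)).add
      ((h5.clm_apply (h3.clm_apply (hasFDerivAt_const Y y))).clm_apply
        (h3.clm_apply (hasFDerivAt_const Z y)))).sub hL₂)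
    have e3 := hasFDerivAt_eq_of_eventuallyEq e1 e2 (by
      filter_upwards [h.eventually] with z hz
      exact hz.map_christoffel h.base_ne i Y Z) X
    have e4 := hL₂' X
    have e5 := h0.map_christoffel h.base_ne i X (Γ y Y Z)
    have e6 : secondForm a b q s f J i y X (Γ y Y Z) = (-(a * q i / (2 * b i))) •
      (s y X • J i (f i y) (fderiv ℝ (f i) y (Γ y Y Z)) +
          s y (Γ y Y Z) • J i (f i y) (fderiv ℝ (f i) y X)) := rfl
    have e7 := h0.map_christoffel h.base_ne i Y Z
    have e8 : ∀ W, fderiv ℝ (f i) y (Γ y X W) + secondForm a b q s f J i y X W =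
      fderiv ℝ (fderiv ℝ (f i)) y X W +
        Γb i (f i y) (fderiv ℝ (f i) y X) (fderiv ℝ (f i) y W) := fun W => by
      rw [h0.map_christoffel h.base_ne i X W]; abel
    rw [e8, e8, smul_add, ← e4, ← e6, e5]
    have e9 : Γb i (f i y) (fderiv ℝ (f i) y X) (fderiv ℝ (f i) y (Γ y Y Z)) =
      Γb i (f i y) (fderiv ℝ (f i) y X) (fderiv ℝ (fderiv ℝ (f i)) y Y Z) +
      Γb i (f i y) (fderiv ℝ (f i) y X)
        (Γb i (f i y) (fderiv ℝ (f i) y Y) (fderiv ℝ (f i) y Z)) -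
      Γb i (f i y) (fderiv ℝ (f i) y X) (secondForm a b q s f J i y Y Z) := by
      rw [e7, map_sub, map_add]
    rw [e9]
    have e10 : fderiv ℝ (f i) y (fderiv ℝ Γ y X Y Z) +
        fderiv ℝ (fderiv ℝ (f i)) y X (Γ y Y Z) =
        fderiv ℝ (fderiv ℝ (fderiv ℝ (f i))) y X Y Z +
        (fderiv ℝ (Γb i) (f i y) (fderiv ℝ (f i) y X) (fderiv ℝ (f i) y Y)
          (fderiv ℝ (f i) y Z) +
        Γb i (f i y) (fderiv ℝ (fderiv ℝ (f i)) y X Y) (fderiv ℝ (f i) y Z) +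
        Γb i (f i y) (fderiv ℝ (f i) y Y) (fderiv ℝ (fderiv ℝ (f i)) y X Z)) - L₂ X := by
      simp only [hL', _root_.sub_apply, _root_.add_apply, ContinuousLinearMap.comp_apply,
        ContinuousLinearMap.flip_apply, _root_.zero_apply, map_zero, zero_add] at e3
      rw [e3]
      abel
    rw [(h0.base_connection i).symm (fderiv ℝ (fderiv ℝ (f i)) y X Y)] at e10
    have e11 := eq_sub_of_add_eq e10
    rw [e11]
    abel
  have t1 := main X Y Z
  have t2 := main Y X Z
  have s1 : fderiv ℝ (fderiv ℝ (fderiv ℝ (f i))) y X Y Z =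
      fderiv ℝ (fderiv ℝ (fderiv ℝ (f i))) y Y X Z :=
    congrArg (fun L => L Z) (second_fderiv_symm hf1 X Y)
  have s2 := second_fderiv_symm (h0.map_smooth i) X Y
  have c1 := h0.form_christoffel h.fibre_ne h.base_ne X Z
  have c2 := h0.form_christoffel h.fibre_ne h.base_ne Y Z
  have split : fderiv ℝ (f i) y (curvatureEnd (fderiv ℝ Γ y) (Γ y) Y Z X) =
      (fderiv ℝ (f i) y (fderiv ℝ Γ y X Y Z) + fderiv ℝ (f i) y (Γ y X (Γ y Y Z))) -
      (fderiv ℝ (f i) y (fderiv ℝ Γ y Y X Z) + fderiv ℝ (f i) y (Γ y Y (Γ y X Z))) := by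
    rw [curvatureEnd_apply, map_sub, map_add, map_sub]; abel
  have b1 : ∀ X Z, J i (f i y) (secondForm a b q s f J i y X Z) = (a * q i / (2 * b i)) •
      (s y X • fderiv ℝ (f i) y Z + s y Z • fderiv ℝ (f i) y X) := by
    intro X Z
    simp only [secondForm, map_smul, map_add, h.complex_sq]
    module
  have b2 : secondForm a b q s f J i y X Y = secondForm a b q s f J i y Y X := by
    simp only [secondForm]; rw [add_comm (s y X • _)]
  rw [split, t1, t2, s1, s2, h0.connection.symm X Y, b2, c1, c2, curvatureEnd_apply]
  simp only [map_add, b1]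
  module

end IsKahlerConnectionMetric

end ConnectionCurvature

/-! ### Skew endomorphisms are traceless -/

section Trace

/-- The form identifies `V` with its dual and conjugates `J` to minus its transpose, which has the
opposite trace. -/
lemma trace_eq_zero_of_skew {V : Type*} [NormedAddCommGroup V] [NormedSpace ℝ V]
    [FiniteDimensional ℝ V] (H : V →L[ℝ] V →L[ℝ] ℝ) (hp : ∀ v, v ≠ 0 → 0 < H v v)
    (J : V →L[ℝ] V) (hJ : ∀ v w, H (J v) w = - H v (J w)) :
    LinearMap.trace ℝ V (J : V →ₗ[ℝ] V) = 0 := by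
  set B : V →ₗ[ℝ] Module.Dual ℝ V := (ContinuousLinearMap.coeLM ℝ).comp (H : V →ₗ[ℝ] V →L[ℝ] ℝ)
    with hB
  have hBa : ∀ v w, B v w = H v w := fun v w => rfl
  have hinj : Function.Injective B := by
    rw [injective_iff_map_eq_zero]
    intro v hv
    by_contra hne
    have := hp v hne
    rw [← hBa, hv] at this
    simp at this
  set e : V ≃ₗ[ℝ] Module.Dual ℝ V := LinearEquiv.ofInjectiveOfFinrankEq B hinj
    (Subspace.dual_finrank_eq).symm with he
  have hconj : e.conj (J : V →ₗ[ℝ] V) = - Module.Dual.transpose (R := ℝ) (J : V →ₗ[ℝ] V) := by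
    ext φ w
    obtain ⟨v, rfl⟩ := e.surjective φ
    have : e.conj (J : V →ₗ[ℝ] V) (e v) = e (J v) := by simp [LinearEquiv.conj_apply]
    rw [this]
    exact hJ v w
  have h1 := LinearMap.trace_conj' (J : V →ₗ[ℝ] V) e
  rw [hconj, map_neg, LinearMap.trace_transpose'] at h1
  linarith

end Trace

/-! ### Tracing the curvature over the adapted coframe -/

section ConnectionRicci

variable {ι : Type*} [Fintype ι] {E : Type*} [NormedAddCommGroup E]
  [NormedSpace ℝ E] {V : ι → Type*} [∀ i, NormedAddCommGroup (V i)] [∀ i, NormedSpace ℝ (V i)]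
  {a : ℝ} {b q : ι → ℝ} {s : E → E →L[ℝ] ℝ} {f : ∀ i, E → V i}
  {H : ∀ i, V i → V i →L[ℝ] V i →L[ℝ] ℝ} {J : ∀ i, V i → V i →L[ℝ] V i}
  {Γb : ∀ i, V i → V i →L[ℝ] V i →L[ℝ] V i} {G : E → E →L[ℝ] E →L[ℝ] ℝ}
  {Γ : E → E →L[ℝ] E →L[ℝ] E} {y : E}

open IsConnectionMetric

/-- The trace of an endomorphism in terms of a coframe made of a form and maps. -/
lemma trace_eq_of_coframe [FiniteDimensional ℝ E] [∀ i, FiniteDimensional ℝ (V i)]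
    {σ : E →ₗ[ℝ] ℝ} {D : ∀ i, E →ₗ[ℝ] V i} {U : E}
    {ℓ : ∀ i, V i →ₗ[ℝ] E} (hid : ∀ X, X = σ X • U + ∑ i, ℓ i (D i X)) (T : E →ₗ[ℝ] E) :
    LinearMap.trace ℝ E T = σ (T U) + ∑ i, LinearMap.trace ℝ (V i) (D i ∘ₗ T ∘ₗ ℓ i) := by
  have h1 : T = σ.smulRight (T U) + ∑ i, (T ∘ₗ ℓ i) ∘ₗ D i := by
    ext X
    conv_lhs => rw [hid X]
    simp
  conv_lhs => rw [h1]
  rw [map_add, map_sum, LinearMap.trace_smulRight]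
  congr 1
  exact Finset.sum_congr rfl fun i _ => LinearMap.trace_comp_comm' _ _

namespace IsKahlerConnectionMetric

/-- The form `s y` and the differentials of the `f i` together give an isomorphism onto `ℝ × ∏ V i`;
the vertical vector and the horizontal lifts are the columns of its inverse. -/
lemma exists_frame [DecidableEq ι] (h : IsKahlerConnectionMetric a b q s f H J Γb G Γ y) :
    ∃ (U : E) (ℓ : ∀ i, V i →ₗ[ℝ] E), s y U = 1 ∧ (∀ i, fderiv ℝ (f i) y U = 0) ∧
      (∀ i w, s y (ℓ i w) = 0) ∧ (∀ i w, fderiv ℝ (f i) y (ℓ i w) = w) ∧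
      (∀ i j w, j ≠ i → fderiv ℝ (f j) y (ℓ i w) = 0) ∧
      ∀ X, X = s y X • U + ∑ i, ℓ i (fderiv ℝ (f i) y X) := by
  set L : E →ₗ[ℝ] ℝ × (∀ i, V i) := LinearMap.prod (s y : E →ₗ[ℝ] ℝ)
    (LinearMap.pi fun i => (fderiv ℝ (f i) y : E →ₗ[ℝ] V i)) with hL
  have hLa : ∀ X, L X = (s y X, fun i => fderiv ℝ (f i) y X) := fun X => rfl
  have hinj : Function.Injective L := by
    rw [injective_iff_map_eq_zero]
    intro X hX
    rw [hLa, Prod.mk_eq_zero] at hX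
    exact h.inj X hX.1 fun i => congrFun hX.2 i
  have hsurj : Function.Surjective L := by
    rintro ⟨t, w⟩
    obtain ⟨X, hX, hX'⟩ := h.eventually.self_of_nhds.surj t w
    exact ⟨X, by rw [hLa, hX]; exact congrArg _ (funext hX')⟩
  set e := LinearEquiv.ofBijective L ⟨hinj, hsurj⟩ with he
  have hes : ∀ p, L (e.symm p) = p := fun p => e.apply_symm_apply p
  have hs : ∀ p, s y (e.symm p) = p.1 := fun p => congrArg Prod.fst (hes p)
  have hf : ∀ p i, fderiv ℝ (f i) y (e.symm p) = p.2 i := fun p i =>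
    congrFun (congrArg Prod.snd (hes p)) i
  refine ⟨e.symm (1, 0),
    fun i => e.symm.toLinearMap ∘ₗ LinearMap.inr ℝ ℝ _ ∘ₗ LinearMap.single ℝ V i, ?_, ?_, ?_, ?_, ?_, ?_⟩
  · rw [hs]
  · intro i; rw [hf]; rfl
  · intro i w; exact hs _
  · intro i w; exact (hf _ i).trans (by simp)
  · intro i j w hj; exact (hf _ j).trans (by simp [hj])
  · intro X
    apply hinj
    rw [map_add, map_smul, map_sum, hes]
    have : ∀ i, L ((e.symm.toLinearMap ∘ₗ LinearMap.inr ℝ ℝ _ ∘ₗ LinearMap.single ℝ V i)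
        (fderiv ℝ (f i) y X)) = ((0 : ℝ), Pi.single i (fderiv ℝ (f i) y X)) := fun i => hes _
    simp only [this]
    rw [hLa]
    ext1
    · simp [Prod.fst_sum]
    · simp only [Prod.snd_add, Prod.smul_snd, smul_zero, zero_add, Prod.snd_sum]
      exact (Finset.univ_sum_single _).symm

/-- In units of `a * q i ^ 2 / (2 * b i)` the vertical direction contributes `1 / 2` and the
horizontal ones `-3 / 2`, in total `-1`. The coefficient of `s ⊗ s` comes from the multiples of the
identity, hence the dimensions. -/
theorem trace_curvatureEnd [FiniteDimensional ℝ E] [∀ i, FiniteDimensional ℝ (V i)]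
    (h : IsKahlerConnectionMetric a b q s f H J Γb G Γ y) (Y Z : E) :
    LinearMap.trace ℝ E (curvatureEnd (fderiv ℝ Γ y) (Γ y) Y Z) =
      (∑ i, Module.finrank ℝ (V i) * (a * q i / (2 * b i)) ^ 2) * (s y Y * s y Z) +
      ∑ i, (LinearMap.trace ℝ (V i) (curvatureEnd (fderiv ℝ (Γb i) (f i y)) (Γb i (f i y))
          (fderiv ℝ (f i) y Y) (fderiv ℝ (f i) y Z)) -
        a * q i ^ 2 / (2 * b i) * H i (f i y) (fderiv ℝ (f i) y Y) (fderiv ℝ (f i) y Z)) := by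
  classical
  obtain ⟨U, ℓ, hU, hU', hℓ, hℓ', hℓ'', hid⟩ := h.exists_frame
  have h0 := h.eventually.self_of_nhds
  rw [trace_eq_of_coframe (σ := (s y : E →ₗ[ℝ] ℝ)) (D := fun i => (fderiv ℝ (f i) y : E →ₗ[ℝ] V i))
    (U := U) (ℓ := ℓ) hid]
  have hvert : s y (curvatureEnd (fderiv ℝ Γ y) (Γ y) Y Z U) =
      ∑ i, 1 / 2 * (a * q i ^ 2 / (2 * b i)) *
        H i (f i y) (fderiv ℝ (f i) y Y) (fderiv ℝ (f i) y Z) := by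
    rw [h.form_curvature]
    refine Finset.sum_congr rfl fun i _ => ?_
    simp only [secondForm, hU, hU', map_zero, smul_zero, zero_add, one_smul, map_smul,
      h.complex_sq, map_neg, _root_.neg_apply, _root_.smul_apply, smul_eq_mul, _root_.zero_apply]
    rw [h0.base_symm i (fderiv ℝ (f i) y Z)]
    ring
  have hhor : ∀ i, LinearMap.trace ℝ (V i) ((fderiv ℝ (f i) y : E →ₗ[ℝ] V i) ∘ₗ
      curvatureEnd (fderiv ℝ Γ y) (Γ y) Y Z ∘ₗ ℓ i) =
      LinearMap.trace ℝ (V i) (curvatureEnd (fderiv ℝ (Γb i) (f i y)) (Γb i (f i y))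
          (fderiv ℝ (f i) y Y) (fderiv ℝ (f i) y Z)) -
      3 / 2 * (a * q i ^ 2 / (2 * b i)) *
        H i (f i y) (fderiv ℝ (f i) y Y) (fderiv ℝ (f i) y Z) +
      Module.finrank ℝ (V i) * (a * q i / (2 * b i)) ^ 2 * (s y Y * s y Z) := by
    intro i
    have hF : ∀ w W, fderiv ℝ s y (ℓ i w) W - fderiv ℝ s y W (ℓ i w) =
        q i * H i (f i y) (J i (f i y) w) (fderiv ℝ (f i) y W) := by
      intro w W
      rw [h0.curv, Finset.sum_eq_single i]
      · rw [hℓ']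
      · intro j _ hj
        rw [hℓ'' i j w hj]; simp
      · simp
    set c := a * q i / (2 * b i) with hc
    -- On the lift of `V i` the curvature is that of the base plus two rank-one maps, a multiple of
    -- `J i` and a multiple of the identity, all with evident traces.
    have hmap : (fderiv ℝ (f i) y : E →ₗ[ℝ] V i) ∘ₗ
      curvatureEnd (fderiv ℝ Γ y) (Γ y) Y Z ∘ₗ ℓ i =
      curvatureEnd (fderiv ℝ (Γb i) (f i y)) (Γb i (f i y))
          (fderiv ℝ (f i) y Y) (fderiv ℝ (f i) y Z) +
      (c * q i) • LinearMap.smulRight ((((H i (f i y)).comp (J i (f i y))).flip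
        (fderiv ℝ (f i) y Y) : V i →L[ℝ] ℝ) : V i →ₗ[ℝ] ℝ) (J i (f i y) (fderiv ℝ (f i) y Z)) +
      (c * (1 / 2 * q i)) • LinearMap.smulRight ((((H i (f i y)).comp (J i (f i y))).flip
        (fderiv ℝ (f i) y Z) : V i →L[ℝ] ℝ) : V i →ₗ[ℝ] ℝ) (J i (f i y) (fderiv ℝ (f i) y Y)) -
      (c * (1 / 2 * (fderiv ℝ s y Y Z - fderiv ℝ s y Z Y))) •
        (J i (f i y) : V i →ₗ[ℝ] V i) +
      (c ^ 2 * (s y Y * s y Z)) • LinearMap.id := by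
      ext w
      have := h.map_curvature i (ℓ i w) Y Z
      rw [hF, hF, hℓ, hℓ'] at this
      simp only [LinearMap.comp_apply, ContinuousLinearMap.coe_coe, this, LinearMap.add_apply,
        LinearMap.sub_apply, LinearMap.smul_apply, LinearMap.smulRight_apply,
        ContinuousLinearMap.flip_apply, ContinuousLinearMap.comp_apply, LinearMap.id_apply]
      rw [← hc]
      module
    rw [hmap]
    simp only [map_add, map_sub, map_smul, LinearMap.trace_smulRight, LinearMap.trace_id,
      trace_eq_zero_of_skew _ (h0.base_pos i) _ (h0.skew i), ContinuousLinearMap.coe_coe,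
      ContinuousLinearMap.flip_apply, ContinuousLinearMap.comp_apply, h.complex_sq, smul_eq_mul,
      map_neg, _root_.neg_apply]
    rw [h0.base_symm i (fderiv ℝ (f i) y Z), hc]
    ring
  rw [ContinuousLinearMap.coe_coe, hvert]
  simp only [hhor, Finset.sum_add_distrib, Finset.sum_sub_distrib, Finset.sum_mul]
  have e1 : ∑ i, 3 / 2 * (a * q i ^ 2 / (2 * b i)) *
        H i (f i y) (fderiv ℝ (f i) y Y) (fderiv ℝ (f i) y Z) =
      ∑ i, 1 / 2 * (a * q i ^ 2 / (2 * b i)) *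
        H i (f i y) (fderiv ℝ (f i) y Y) (fderiv ℝ (f i) y Z) +
      ∑ i, (a * q i ^ 2 / (2 * b i)) *
        H i (f i y) (fderiv ℝ (f i) y Y) (fderiv ℝ (f i) y Z) := by
    rw [← Finset.sum_add_distrib]
    exact Finset.sum_congr rfl fun i _ => by ring
  rw [e1]
  ring

end IsKahlerConnectionMetric

end ConnectionRicci

/-! ## Change of charts -/

section ChartChange

variable {E V : Type*} [NormedAddCommGroup E] [NormedSpace ℝ E] [NormedAddCommGroup V]
  [NormedSpace ℝ V]

/-- The transformation rule of Christoffel symbols. -/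
lemma IsLeviCivita.pullback {G : E → E →L[ℝ] E →L[ℝ] ℝ} {H : V → V →L[ℝ] V →L[ℝ] ℝ} {f : E → V}
    {y : E} {Γ : E →L[ℝ] E →L[ℝ] E} {Γ' : V →L[ℝ] V →L[ℝ] V}
    (hG : DifferentiableAt ℝ G y) (hH : DifferentiableAt ℝ H (f y)) (hf : ContDiffAt ℝ ∞ f y)
    (he : ∀ᶠ z in 𝓝 y, ∀ Y Z, G z Y Z = H (f z) (fderiv ℝ f z Y) (fderiv ℝ f z Z))
    (hs : ∀ v w, H (f y) v w = H (f y) w v) (hp : ∀ v, v ≠ 0 → 0 < H (f y) v v)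
    (hsurj : Function.Surjective (fderiv ℝ f y))
    (hΓ : IsLeviCivita G y Γ) (hΓ' : IsLeviCivita H (f y) Γ') (X Y : E) :
    fderiv ℝ f y (Γ X Y) =
      fderiv ℝ (fderiv ℝ f) y X Y + Γ' (fderiv ℝ f y X) (fderiv ℝ f y Y) := by
  set W : E → E → V := fun X Y => fderiv ℝ f y (Γ X Y) -
    (fderiv ℝ (fderiv ℝ f) y X Y + Γ' (fderiv ℝ f y X) (fderiv ℝ f y Y)) with hW
  have hsym : ∀ X Y, W X Y = W Y X := fun X Y => by
    simp only [hW]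
    rw [hΓ.symm, hΓ'.symm, second_fderiv_symm hf]
  have hanti : ∀ X Y Z, H (f y) (W X Y) (fderiv ℝ f y Z) = - H (f y) (W X Z) (fderiv ℝ f y Y) := by
    intro X Y Z
    obtain ⟨L, hL, hL'⟩ := hasFDerivAt_pullback hH hf Y Z
    have h1 : HasFDerivAt (fun z => G z Y Z) L y := hL.congr_of_eventuallyEq (by
      filter_upwards [he] with z hz using hz Y Z)
    have h2 := fderiv_clm_apply₂ hG h1 X
    rw [hΓ.compat, hL', hΓ'.compat, he.self_of_nhds, he.self_of_nhds] at h2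
    simp only [hW, map_sub, map_add, _root_.sub_apply, _root_.add_apply]
    rw [hs _ (fderiv ℝ f y Y), hs _ (fderiv ℝ f y Y), hs _ (fderiv ℝ f y Y)]
    linarith
  by_contra hne
  obtain ⟨Z, hZ⟩ := hsurj (W X Y)
  have hpos := hp (W X Y) (sub_ne_zero.2 hne)
  have e1 := hanti X Y Z
  have e2 := hanti Z X Y
  have e3 := hanti Y Z X
  rw [hsym Z X] at e2
  rw [hsym Y Z] at e3
  rw [hsym Y X] at e3
  rw [hZ] at e1 e3
  linarith

/-- Parallel bilinear forms pull back to parallel bilinear forms. -/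
lemma parallel_pullback {B : E → E →L[ℝ] E →L[ℝ] ℝ} {B' : V → V →L[ℝ] V →L[ℝ] ℝ} {f : E → V}
    {y : E} {Γ : E →L[ℝ] E →L[ℝ] E} {Γ' : V →L[ℝ] V →L[ℝ] V}
    (hB : DifferentiableAt ℝ B y) (hB' : DifferentiableAt ℝ B' (f y)) (hf : ContDiffAt ℝ ∞ f y)
    (he : ∀ᶠ z in 𝓝 y, ∀ Y Z, B z Y Z = B' (f z) (fderiv ℝ f z Y) (fderiv ℝ f z Z))
    (hΓ : ∀ X Y, fderiv ℝ f y (Γ X Y) =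
      fderiv ℝ (fderiv ℝ f) y X Y + Γ' (fderiv ℝ f y X) (fderiv ℝ f y Y))
    (hpar : ∀ X Y Z, fderiv ℝ B' (f y) X Y Z = B' (f y) (Γ' X Y) Z + B' (f y) Y (Γ' X Z))
    (X Y Z : E) : fderiv ℝ B y X Y Z = B y (Γ X Y) Z + B y Y (Γ X Z) := by
  obtain ⟨L, hL, hL'⟩ := hasFDerivAt_pullback hB' hf Y Z
  have h1 : HasFDerivAt (fun z => B z Y Z) L y := hL.congr_of_eventuallyEq (by
    filter_upwards [he] with z hz using hz Y Z)
  rw [fderiv_clm_apply₂ hB h1 X, hL', hpar, he.self_of_nhds, he.self_of_nhds, hΓ, hΓ]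
  simp only [map_add, _root_.add_apply]
  ring

lemma exterior_pullback {s : E → E →L[ℝ] ℝ} {s' : V → V →L[ℝ] ℝ} {f : E → V} {y : E}
    (hs : DifferentiableAt ℝ s y) (hs' : DifferentiableAt ℝ s' (f y)) (hf : ContDiffAt ℝ ∞ f y)
    (he : ∀ᶠ z in 𝓝 y, ∀ Y, s z Y = s' (f z) (fderiv ℝ f z Y)) (X Y : E) :
    fderiv ℝ s y X Y - fderiv ℝ s y Y X =
      fderiv ℝ s' (f y) (fderiv ℝ f y X) (fderiv ℝ f y Y) -
        fderiv ℝ s' (f y) (fderiv ℝ f y Y) (fderiv ℝ f y X) := by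
  have h1 : HasFDerivAt f (fderiv ℝ f y) y := (hf.differentiableAt (by simp)).hasFDerivAt
  have h2 : HasFDerivAt (fderiv ℝ f) (fderiv ℝ (fderiv ℝ f) y) y :=
    ((hf.fderiv_right (m := 1) (by norm_cast)).differentiableAt (by simp)).hasFDerivAt
  have h3 : HasFDerivAt (fun z => s' (f z)) _ y := hs'.hasFDerivAt.comp y h1
  have key : ∀ X Y, fderiv ℝ s y X Y = fderiv ℝ s' (f y) (fderiv ℝ f y X) (fderiv ℝ f y Y) +
      s' (f y) (fderiv ℝ (fderiv ℝ f) y X Y) := by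
    intro X Y
    have h4 := h3.clm_apply (h2.clm_apply (hasFDerivAt_const Y y))
    have h5 := hs.hasFDerivAt.clm_apply (hasFDerivAt_const Y y)
    have h6 := hasFDerivAt_eq_of_eventuallyEq h5 h4 (by
      filter_upwards [he] with z hz using hz Y) X
    simp at h6
    rw [h6]; ring
  rw [key, key, second_fderiv_symm hf X Y]
  ring

end ChartChange

section Transition

variable {d : ℕ} {M : Type u} [TopologicalSpace M] [ChartedSpace (𝔼 d) M]

/-- The transition map from the chart at `x₀` to the chart at the point with coordinates `y`. -/
def transition (x₀ : M) (y : 𝔼 d) : 𝔼 d → 𝔼 d :=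
  mapRep (d := d) (d' := d) (fun x : M => x) x₀ ((extChartAt (𝓡 d) x₀).symm y)

lemma fderiv_bilinRep_of_covDeriv_eq_zero {x₀ : M} {y : 𝔼 d}
    {g B : ∀ x : M, TangentSpace (𝓡 d) x →L[ℝ] TangentSpace (𝓡 d) x →L[ℝ] ℝ}
    (hB : DifferentiableAt ℝ (bilinRep B x₀) y) (h0 : ∀ i j k, covDeriv g B x₀ i j k y = 0)
    (X Y Z : 𝔼 d) : fderiv ℝ (bilinRep B x₀) y X Y Z =
      bilinRep B x₀ y (christoffelForm g x₀ y X Y) Z +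
        bilinRep B x₀ y Y (christoffelForm g x₀ y X Z) := by
  have hT : fderiv ℝ (bilinRep B x₀) y =
      (ContinuousLinearMap.compL ℝ (𝔼 d) (𝔼 d) (𝔼 d →L[ℝ] ℝ) (bilinRep B x₀ y)).comp
        (christoffelForm g x₀ y) +
      ((ContinuousLinearMap.flipₗᵢ ℝ (𝔼 d) (𝔼 d) ℝ).toContinuousLinearEquiv :
          (𝔼 d →L[ℝ] 𝔼 d →L[ℝ] ℝ) →L[ℝ] (𝔼 d →L[ℝ] 𝔼 d →L[ℝ] ℝ)).comp
      ((ContinuousLinearMap.compL ℝ (𝔼 d) (𝔼 d) (𝔼 d →L[ℝ] ℝ) (bilinRep B x₀ y).flip).comp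
        (christoffelForm g x₀ y)) := by
    refine clm_ext_single fun i => clm_ext_single fun j => clm_ext_single fun k => ?_
    have h := h0 i j k
    rw [covDeriv, pd_coeff hB, sub_eq_zero] at h
    rw [h]
    simp only [_root_.add_apply, ContinuousLinearMap.comp_apply, ContinuousLinearMap.compL_apply,
      ContinuousLinearEquiv.coe_coe, LinearIsometryEquiv.coe_toContinuousLinearEquiv,
      ContinuousLinearMap.coe_flipₗᵢ, ContinuousLinearMap.flip_apply,
      christoffelForm_single_single, map_sum, map_smul, _root_.sum_apply, _root_.smul_apply,
      Finset.sum_add_distrib, coeff_eq_bilinRep, smul_eq_mul]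
  have := congrArg (fun L => L X Y Z) hT
  simpa using this

variable [IsManifold (𝓡 d) ∞ M] {x₀ : M} {y : 𝔼 d}

lemma contDiffAt_transition (hy : y ∈ (extChartAt (𝓡 d) x₀).target) :
    ContDiffAt ℝ ∞ (transition x₀ y) y :=
  contDiffAt_mapRep contMDiff_id hy (mem_extChartAt_source _)

lemma eventually_mem_source_of_mem_target (hy : y ∈ (extChartAt (𝓡 d) x₀).target) :
    ∀ᶠ z in 𝓝 y, z ∈ (extChartAt (𝓡 d) x₀).target ∧ (extChartAt (𝓡 d) x₀).symm z ∈
      (extChartAt (𝓡 d) ((extChartAt (𝓡 d) x₀).symm y)).source := by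
  have hc : ContinuousAt (extChartAt (𝓡 d) x₀).symm y :=
    (mdifferentiableAt_extChartAt_symm hy).continuousAt
  exact Filter.inter_mem ((isOpen_extChartAt_target (I := 𝓡 d) x₀).mem_nhds hy)
    (hc.preimage_mem_nhds (extChartAt_source_mem_nhds _))

lemma eventually_bilinRep_transition (hy : y ∈ (extChartAt (𝓡 d) x₀).target)
    (B : ∀ x : M, TangentSpace (𝓡 d) x →L[ℝ] TangentSpace (𝓡 d) x →L[ℝ] ℝ) :
    ∀ᶠ z in 𝓝 y, ∀ Y Z, bilinRep B x₀ z Y Z =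
      bilinRep B ((extChartAt (𝓡 d) x₀).symm y) (transition x₀ y z)
        (fderiv ℝ (transition x₀ y) z Y) (fderiv ℝ (transition x₀ y) z Z) := by
  filter_upwards [eventually_mem_source_of_mem_target hy] with z hz Y Z
  have h := bilinRep_mapRep (f := fun x : M => x) contMDiff_id B hz.1 hz.2 Y Z
  refine Eq.trans ?_ h.symm
  have hid : mfderiv (𝓡 d) (𝓡 d) (fun x : M => x) ((extChartAt (𝓡 d) x₀).symm z) =
    ContinuousLinearMap.id ℝ _ := mfderiv_id
  rw [hid]
  rfl

lemma eventually_formRep_transition (hy : y ∈ (extChartAt (𝓡 d) x₀).target)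
    (σ : ∀ x : M, TangentSpace (𝓡 d) x →L[ℝ] ℝ) :
    ∀ᶠ z in 𝓝 y, ∀ Y, formRep σ x₀ z Y =
      formRep σ ((extChartAt (𝓡 d) x₀).symm y) (transition x₀ y z)
        (fderiv ℝ (transition x₀ y) z Y) := by
  filter_upwards [eventually_mem_source_of_mem_target hy] with z hz Y
  have h := formRep_mapRep (f := fun x : M => x) contMDiff_id σ hz.1 hz.2 Y
  refine Eq.trans ?_ h.symm
  have hid : mfderiv (𝓡 d) (𝓡 d) (fun x : M => x) ((extChartAt (𝓡 d) x₀).symm z) =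
    ContinuousLinearMap.id ℝ _ := mfderiv_id
  rw [hid]
  rfl

/-- Tangent vectors at the point with coordinates `y` are read in the preferred chart there, so
pushing forward by the inverse chart is the same as differentiating the transition map. -/
lemma fderiv_transition (hy : y ∈ (extChartAt (𝓡 d) x₀).target) (v : 𝔼 d) :
    fderiv ℝ (transition x₀ y) y v = chartFrame x₀ y v := by
  have h := chartFrame_mapRep (f := fun x : M => x) (n₀ := (extChartAt (𝓡 d) x₀).symm y)
    contMDiff_id hy (mem_extChartAt_source _) v
  have hid : mfderiv (𝓡 d) (𝓡 d) (fun x : M => x) ((extChartAt (𝓡 d) x₀).symm y) =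
    ContinuousLinearMap.id ℝ _ := mfderiv_id
  rw [hid] at h
  exact (chartFrame_self ((extChartAt (𝓡 d) x₀).symm y) _).symm.trans h

lemma surjective_fderiv_transition (hy : y ∈ (extChartAt (𝓡 d) x₀).target) :
    Function.Surjective (fderiv ℝ (transition x₀ y) y) := by
  intro w
  refine ⟨mfderiv (𝓡 d) 𝓘(ℝ, 𝔼 d) (extChartAt (𝓡 d) x₀) ((extChartAt (𝓡 d) x₀).symm y) w, ?_⟩
  exact (fderiv_transition hy _).trans (chartFrame_mfderiv_extChartAt hy w)

lemma extD_eq {σ : ∀ x : M, TangentSpace (𝓡 d) x →L[ℝ] ℝ} {x : M}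
    (hσ : DifferentiableAt ℝ (formRep σ x) (extChartAt (𝓡 d) x x)) (v w : 𝔼 d) :
    extD σ x v w = fderiv ℝ (formRep σ x) (extChartAt (𝓡 d) x x) v w -
      fderiv ℝ (formRep σ x) (extChartAt (𝓡 d) x x) w v := by
  have h0 : extD σ x v w = ∑ i, ∑ j, (pd i (formCoeff σ x j) (extChartAt (𝓡 d) x x)
    - pd j (formCoeff σ x i) (extChartAt (𝓡 d) x x)) * comp (d := d) x v i *
      comp (d := d) x w j := rfl
  have hpd : ∀ i j, pd i (formCoeff σ x j) (extChartAt (𝓡 d) x x) =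
      fderiv ℝ (formRep σ x) (extChartAt (𝓡 d) x x) (EuclideanSpace.single i 1)
        (EuclideanSpace.single j 1) := by
    intro i j
    have h : HasFDerivAt (formCoeff σ x j) _ (extChartAt (𝓡 d) x x) := hσ.hasFDerivAt.clm_apply
      (hasFDerivAt_const (EuclideanSpace.single j (1 : ℝ)) _)
    rw [pd, h.fderiv]
    simp
  rw [h0]
  simp only [comp_self, hpd]
  set D := fderiv ℝ (formRep σ x) (extChartAt (𝓡 d) x x)
  rw [clm_apply₂_eq_sum D v w, clm_apply₂_eq_sum D w v]
  conv_rhs => rw [Finset.sum_comm (γ := Fin d) (f := fun i j => (w i * v j) • _)]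
  rw [← Finset.sum_sub_distrib]
  refine Finset.sum_congr rfl fun i _ => ?_
  rw [← Finset.sum_sub_distrib]
  refine Finset.sum_congr rfl fun j _ => ?_
  simp only [smul_eq_mul]
  ring

/-- The definition of `extD` uses only the chart centred at the point. Naturality under the
transition map makes it available at every point of one fixed chart, as needed for differentiating
the curvature equation. -/
lemma extD_chartFrame {σ : ∀ x : M, TangentSpace (𝓡 d) x →L[ℝ] ℝ}
    (hy : y ∈ (extChartAt (𝓡 d) x₀).target)
    (hσ : DifferentiableAt ℝ (formRep σ x₀) y)
    (hσ' : DifferentiableAt ℝ (formRep σ ((extChartAt (𝓡 d) x₀).symm y))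
      (extChartAt (𝓡 d) ((extChartAt (𝓡 d) x₀).symm y) ((extChartAt (𝓡 d) x₀).symm y)))
    (X Y : 𝔼 d) :
    fderiv ℝ (formRep σ x₀) y X Y - fderiv ℝ (formRep σ x₀) y Y X =
      extD σ ((extChartAt (𝓡 d) x₀).symm y) (chartFrame x₀ y X) (chartFrame x₀ y Y) := by
  rw [exterior_pullback hσ (s' := formRep σ ((extChartAt (𝓡 d) x₀).symm y))
    (f := transition x₀ y) hσ' (contDiffAt_transition hy) (eventually_formRep_transition hy σ)]
  refine (extD_eq hσ' (fderiv ℝ (transition x₀ y) y X) (fderiv ℝ (transition x₀ y) y Y)).symm.trans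
    ?_
  exact congrArg₂ (fun a b : 𝔼 d => extD σ ((extChartAt (𝓡 d) x₀).symm y) a b)
    (fderiv_transition hy X) (fderiv_transition hy Y)

end Transition

/-! ## Kähler-Einstein manifolds in charts -/

section KahlerEinstein

lemma ContDiffAt.eventually_differentiableAt {E F : Type*} [NormedAddCommGroup E]
    [NormedSpace ℝ E] [NormedAddCommGroup F] [NormedSpace ℝ F] {f : E → F} {y : E}
    (h : ContDiffAt ℝ ∞ f y) : ∀ᶠ z in 𝓝 y, DifferentiableAt ℝ f z := by
  have := (h.of_le (m := 1) (by simp)).eventually (by simp)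
  filter_upwards [this] with z hz using hz.differentiableAt (by simp)

namespace KEManifold

variable {n : ℕ} {p : ℤ} (M : KEManifold.{u} n p)

lemma contDiffAt_bilinRep_metric (x : M.carrier) :
    ContDiffAt ℝ ∞ (bilinRep M.metric.inner x) (extChartAt (𝓡 (2 * n)) x x) :=
  contMDiffAt_bilin_iff.1 (M.metric.contMDiff x)

lemma contDiffAt_endRep_J (x : M.carrier) :
    ContDiffAt ℝ ∞ (endRep M.J x) (extChartAt (𝓡 (2 * n)) x x) :=
  contDiffAt_endRep (M.J_smooth x)

lemma bilinRep_metric_symm (x₀ : M.carrier) (y v w : 𝔼 (2 * n)) :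
    bilinRep M.metric.inner x₀ y v w = bilinRep M.metric.inner x₀ y w v :=
  M.metric.symm _ _ _

variable {M} {x₀ : M.carrier} {y : 𝔼 (2 * n)}

lemma bilinRep_metric_pos (hy : y ∈ (extChartAt (𝓡 (2 * n)) x₀).target) (v : 𝔼 (2 * n))
    (hv : v ≠ 0) : 0 < bilinRep M.metric.inner x₀ y v v :=
  M.metric.pos _ _ fun h => hv (chartFrame_injective hy (h.trans (map_zero _).symm))

lemma endRep_J_sq (hy : y ∈ (extChartAt (𝓡 (2 * n)) x₀).target) (v : 𝔼 (2 * n)) :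
    endRep M.J x₀ y (endRep M.J x₀ y v) = -v := by
  apply chartFrame_injective hy
  rw [chartFrame_endRep _ hy, chartFrame_endRep _ hy, M.J_sq, map_neg]

lemma bilinRep_kahlerForm (hy : y ∈ (extChartAt (𝓡 (2 * n)) x₀).target) :
    bilinRep M.kahlerForm x₀ y = (bilinRep M.metric.inner x₀ y).comp (endRep M.J x₀ y) := by
  ext v w
  rw [ContinuousLinearMap.comp_apply, bilinRep_apply, bilinRep_apply, chartFrame_endRep _ hy]
  rfl

lemma endRep_J_skew (hy : y ∈ (extChartAt (𝓡 (2 * n)) x₀).target) (v w : 𝔼 (2 * n)) :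
    bilinRep M.metric.inner x₀ y (endRep M.J x₀ y v) w =
      - bilinRep M.metric.inner x₀ y v (endRep M.J x₀ y w) := by
  rw [bilinRep_apply, bilinRep_apply, chartFrame_endRep _ hy, chartFrame_endRep _ hy,
    ← M.J_orthogonal, M.J_sq, map_neg]
  rfl

lemma isLeviCivita_metric (hy : y ∈ (extChartAt (𝓡 (2 * n)) x₀).target)
    (hd : DifferentiableAt ℝ (bilinRep M.metric.inner x₀) y) :
    IsLeviCivita (bilinRep M.metric.inner x₀) y (christoffelForm M.metric.inner x₀ y) :=
  isLeviCivita_christoffelForm (bilinRep_metric_pos hy) (M.bilinRep_metric_symm x₀) hd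

lemma differentiableAt_kahlerForm (hy : y ∈ (extChartAt (𝓡 (2 * n)) x₀).target)
    (hd : DifferentiableAt ℝ (bilinRep M.metric.inner x₀) y)
    (hJ : DifferentiableAt ℝ (endRep M.J x₀) y) :
    DifferentiableAt ℝ (bilinRep M.kahlerForm x₀) y := by
  refine (hd.clm_comp hJ).congr_of_eventuallyEq ?_
  filter_upwards [(isOpen_extChartAt_target (I := 𝓡 (2 * n)) x₀).mem_nhds hy] with z hz
  exact bilinRep_kahlerForm hz

/-- The Kähler condition is stated at chart centres and is carried to other points by transition
maps. Since the Kähler form and the metric are parallel, the defect of `J` pairs to zero with every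
vector, in particular with itself. -/
lemma parallel_endRep_J (hy : y ∈ (extChartAt (𝓡 (2 * n)) x₀).target)
    (hd : DifferentiableAt ℝ (bilinRep M.metric.inner x₀) y)
    (hJ : DifferentiableAt ℝ (endRep M.J x₀) y) (X Y : 𝔼 (2 * n)) :
    fderiv ℝ (endRep M.J x₀) y X Y +
        christoffelForm M.metric.inner x₀ y X (endRep M.J x₀ y Y) =
      endRep M.J x₀ y (christoffelForm M.metric.inner x₀ y X Y) := by
  set x' := (extChartAt (𝓡 (2 * n)) x₀).symm y with hx'
  have hd' : DifferentiableAt ℝ (bilinRep M.metric.inner x') (transition x₀ y y) :=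
    (M.contDiffAt_bilinRep_metric x').differentiableAt (by simp)
  have hJ' : DifferentiableAt ℝ (endRep M.J x') (transition x₀ y y) :=
    (M.contDiffAt_endRep_J x').differentiableAt (by simp)
  have hy' : transition x₀ y y ∈ (extChartAt (𝓡 (2 * n)) x').target := mem_extChartAt_target x'
  have hΓ := IsLeviCivita.pullback hd hd' (contDiffAt_transition hy)
    (eventually_bilinRep_transition hy M.metric.inner) (M.bilinRep_metric_symm x' _)
    (bilinRep_metric_pos hy') (surjective_fderiv_transition hy)
    (isLeviCivita_metric hy hd) (isLeviCivita_metric hy' hd')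
  have hpar := parallel_pullback (differentiableAt_kahlerForm hy hd hJ)
    (differentiableAt_kahlerForm hy' hd' hJ') (contDiffAt_transition hy)
    (eventually_bilinRep_transition hy M.kahlerForm) hΓ
    (fderiv_bilinRep_of_covDeriv_eq_zero (differentiableAt_kahlerForm hy' hd' hJ')
      (M.kahler x')) X Y
  rw [← sub_eq_zero]
  by_contra hne
  have hpos := bilinRep_metric_pos hy _ hne
  set W := fderiv ℝ (endRep M.J x₀) y X Y +
        christoffelForm M.metric.inner x₀ y X (endRep M.J x₀ y Y) -
      endRep M.J x₀ y (christoffelForm M.metric.inner x₀ y X Y) with hW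
  have h1 := hpar W
  have h2 : fderiv ℝ (bilinRep M.kahlerForm x₀) y = _ :=
    ((hd.hasFDerivAt.clm_comp hJ.hasFDerivAt).congr_of_eventuallyEq (by
      filter_upwards [(isOpen_extChartAt_target (I := 𝓡 (2 * n)) x₀).mem_nhds hy] with z hz
      exact bilinRep_kahlerForm hz)).fderiv
  have h3 := (isLeviCivita_metric hy hd).compat X (endRep M.J x₀ y Y) W
  rw [h2, bilinRep_kahlerForm hy] at h1
  simp at h1
  rw [h3] at h1
  have h4 : bilinRep M.metric.inner x₀ y W W = 0 := by
    conv_lhs => enter [1]; rw [hW]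
    simp only [map_sub, map_add, _root_.sub_apply, _root_.add_apply]
    linarith
  linarith

lemma trace_curvatureEnd_metric (x : M.carrier) (v w : 𝔼 (2 * n)) :
    LinearMap.trace ℝ (𝔼 (2 * n)) (curvatureEnd
      (fderiv ℝ (christoffelForm M.metric.inner x) (extChartAt (𝓡 (2 * n)) x x))
      (christoffelForm M.metric.inner x (extChartAt (𝓡 (2 * n)) x x)) v w) =
      p * bilinRep M.metric.inner x (extChartAt (𝓡 (2 * n)) x x) v w := by
  rw [← ricci_eq_trace x (differentiableAt_christoffelForm
    (bilinRep_metric_pos (mem_extChartAt_target x)) (M.contDiffAt_bilinRep_metric x)),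
    bilinRep_self]
  exact M.einstein x v w

end KEManifold

end KahlerEinstein

/-! ## Connection-type metrics on circle bundles -/

section Bundle

lemma contDiffAt_formRep_of_mem_target {d : ℕ} {M : Type u} [TopologicalSpace M]
    [ChartedSpace (𝔼 d) M] [IsManifold (𝓡 d) ∞ M] {σ : ∀ x : M, TangentSpace (𝓡 d) x →L[ℝ] ℝ}
    (hσ : ContMDiff (𝓡 d) ((𝓡 d).prod 𝓘(ℝ, 𝔼 d →L[ℝ] ℝ)) ∞
      (fun x : M => (TotalSpace.mk' (𝔼 d →L[ℝ] ℝ) x (σ x) :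
        TotalSpace _ (fun x : M => TangentSpace (𝓡 d) x →L[ℝ] ℝ))))
    {x₀ : M} {y : 𝔼 d} (hy : y ∈ (extChartAt (𝓡 d) x₀).target) :
    ContDiffAt ℝ ∞ (formRep σ x₀) y := by
  have hτ := contDiffAt_transition hy
  have he := eventually_formRep_transition hy σ
  have h0 : ContDiffAt ℝ ∞ (formRep σ ((extChartAt (𝓡 d) x₀).symm y)) (transition x₀ y y) :=
    contDiffAt_formRep (hσ ((extChartAt (𝓡 d) x₀).symm y))
  generalize formRep σ ((extChartAt (𝓡 d) x₀).symm y) = s at he h0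
  refine ((ContDiffAt.comp y h0 hτ).clm_comp
    (hτ.fderiv_right (m := ∞) (by norm_cast))).congr_of_eventuallyEq ?_
  filter_upwards [he] with z hz
  exact ContinuousLinearMap.ext hz

lemma contDiffAt_clm_of_apply {E F G : Type*} [NormedAddCommGroup E] [NormedSpace ℝ E]
    [NormedAddCommGroup F] [NormedSpace ℝ F] [FiniteDimensional ℝ F] [NormedAddCommGroup G]
    [NormedSpace ℝ G] {f : E → F →L[ℝ] G} {x : E}
    (h : ∀ v, ContDiffAt ℝ ∞ (fun z => f z v) x) : ContDiffAt ℝ ∞ f x := by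
  let d := Module.finrank ℝ F
  have hd : d = Module.finrank ℝ (Fin d → ℝ) := (Module.finrank_fin_fun ℝ).symm
  let e₁ := ContinuousLinearEquiv.ofFinrankEq hd
  let e₂ := (e₁.arrowCongr (1 : G ≃L[ℝ] G)).trans (ContinuousLinearEquiv.piRing (Fin d))
  rw [← Function.id_comp f, ← e₂.symm_comp_self]
  exact e₂.symm.contDiff.contDiffAt.comp x (contDiffAt_pi.mpr fun i => h _)

lemma mapRep_self {d d' : ℕ} {M N : Type u} [TopologicalSpace M] [ChartedSpace (𝔼 d) M]
    [TopologicalSpace N] [ChartedSpace (𝔼 d') N] [IsManifold (𝓡 d') ∞ N] (f : M → N) (x : M) :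
    mapRep f x (f x) (extChartAt (𝓡 d) x x) = extChartAt (𝓡 d') (f x) (f x) := by
  rw [mapRep, extChartAt_to_inv]

namespace KECircleBundle

variable {m : ℕ} {n : Fin m → ℕ} {p q : Fin m → ℤ} (P : KECircleBundle.{u} n p q)

/-- The pullback of the metric of the `i`-th factor. -/
def baseMetric (i : Fin m) (x : P.total) :
    TangentSpace (𝓡 (totalDim n)) x →L[ℝ] TangentSpace (𝓡 (totalDim n)) x →L[ℝ] ℝ :=
  (ContinuousLinearMap.precomp ℝ (mfderiv (𝓡 (totalDim n)) (𝓡 (2 * n i)) (P.proj i) x)).comp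
    (((P.base i).metric.inner (P.proj i x)).comp
      (mfderiv (𝓡 (totalDim n)) (𝓡 (2 * n i)) (P.proj i) x))

/-- The square of the connection form. -/
def fibreMetric (x : P.total) :
    TangentSpace (𝓡 (totalDim n)) x →L[ℝ] TangentSpace (𝓡 (totalDim n)) x →L[ℝ] ℝ :=
  (P.σ x).smulRight (P.σ x)

lemma connMetric_eq (a : ℝ) (b : Fin m → ℝ) (x : P.total) :
    P.connMetric a b x = a • P.fibreMetric x + ∑ i, b i • P.baseMetric i x := rfl

lemma baseMetric_apply (i : Fin m) (x : P.total) (v w : TangentSpace (𝓡 (totalDim n)) x) :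
    P.baseMetric i x v w = (P.base i).metric.inner (P.proj i x)
      (mfderiv (𝓡 (totalDim n)) (𝓡 (2 * n i)) (P.proj i) x v)
      (mfderiv (𝓡 (totalDim n)) (𝓡 (2 * n i)) (P.proj i) x w) := rfl

lemma fibreMetric_apply (x : P.total) (v w : TangentSpace (𝓡 (totalDim n)) x) :
    P.fibreMetric x v w = P.σ x v * P.σ x w := rfl

lemma connMetric_apply (a : ℝ) (b : Fin m → ℝ) (x : P.total)
    (v w : TangentSpace (𝓡 (totalDim n)) x) :
    P.connMetric a b x v w = a * (P.σ x v * P.σ x w) + ∑ i, b i * P.baseMetric i x v w := by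
  rw [connMetric_eq]
  simp only [_root_.add_apply, _root_.sum_apply, _root_.smul_apply, smul_eq_mul,
    fibreMetric_apply]

lemma proj_smul (z : Circle) (x : P.total) (i : Fin m) : P.proj i (z • x) = P.proj i x :=
  ((P.proj_fibre x (z • x)).2 ⟨z, rfl⟩ i).symm

/-- The vector is the velocity of the circle orbit, along which all projections are constant. -/
lemma exists_vertical (x : P.total) : ∃ v : TangentSpace (𝓡 (totalDim n)) x,
    P.σ x v = 1 ∧ ∀ i, mfderiv (𝓡 (totalDim n)) (𝓡 (2 * n i)) (P.proj i) x v = 0 := by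
  have key : ∃ v : TangentSpace (𝓡 (totalDim n)) (Circle.exp 0 • x),
      P.σ (Circle.exp 0 • x) v = 1 ∧
      ∀ i, mfderiv (𝓡 (totalDim n)) (𝓡 (2 * n i)) (P.proj i) (Circle.exp 0 • x) v = 0 := by
    have h1 := P.σ_vertical x
    -- If the orbit were not differentiable, its `mfderiv` would take the default value `0`,
    -- contradicting the normalization `σ = 1`.
    have hd : MDifferentiableAt 𝓘(ℝ, ℝ) (𝓡 (totalDim n)) (fun s : ℝ => Circle.exp s • x) 0 := by
      by_contra hd
      rw [mfderiv_zero_of_not_mdifferentiableAt hd] at h1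
      exact zero_ne_one ((map_zero (P.σ (Circle.exp 0 • x))).symm.trans h1)
    refine ⟨_, h1, fun i => ?_⟩
    have h2 := mfderiv_comp (0 : ℝ) (g := P.proj i) (f := fun s : ℝ => Circle.exp s • x)
      ((P.proj_smooth i).mdifferentiableAt (by simp)) hd
    have h3 : P.proj i ∘ (fun s : ℝ => Circle.exp s • x) = fun _ => P.proj i x :=
      funext fun s => P.proj_smul _ x i
    have h4 : mfderiv 𝓘(ℝ, ℝ) (𝓡 (2 * n i))
        (P.proj i ∘ (fun s : ℝ => Circle.exp s • x)) (0 : ℝ) = 0 := by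
      rw [h3]; exact mfderiv_const
    rw [h4] at h2
    exact (congrArg (fun L => L (1 : ℝ)) h2).symm
  have hx : Circle.exp 0 • x = x := by simp
  rwa [hx] at key

lemma exists_lift (x : P.total) (t : ℝ) (w : ∀ i, TangentSpace (𝓡 (2 * n i)) (P.proj i x)) :
    ∃ v : TangentSpace (𝓡 (totalDim n)) x, P.σ x v = t ∧
      ∀ i, mfderiv (𝓡 (totalDim n)) (𝓡 (2 * n i)) (P.proj i) x v = w i := by
  obtain ⟨V, hV, hV'⟩ := P.exists_vertical x
  obtain ⟨v, hv⟩ := P.proj_submersion x w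
  refine ⟨v + (t - P.σ x v) • V, ?_, fun i => ?_⟩
  · rw [map_add, map_smul, hV]; simp
  · rw [map_add, map_smul, hV', hv]; simp

/-- The connection form and the differentials of the projections are jointly surjective, and the
dimension `1 + ∑ 2 nᵢ` makes them jointly injective. -/
lemma eq_zero_of_proj (x : P.total) (v : TangentSpace (𝓡 (totalDim n)) x) (h : P.σ x v = 0)
    (h' : ∀ i, mfderiv (𝓡 (totalDim n)) (𝓡 (2 * n i)) (P.proj i) x v = 0) : v = 0 := by
  let D : ∀ i, 𝔼 (totalDim n) →L[ℝ] 𝔼 (2 * n i) := fun i =>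
    mfderiv (𝓡 (totalDim n)) (𝓡 (2 * n i)) (P.proj i) x
  let s : 𝔼 (totalDim n) →L[ℝ] ℝ := P.σ x
  let L : 𝔼 (totalDim n) →ₗ[ℝ] ℝ × ∀ i, 𝔼 (2 * n i) :=
    (s : 𝔼 (totalDim n) →ₗ[ℝ] ℝ).prod (LinearMap.pi fun i => (D i : _ →ₗ[ℝ] 𝔼 (2 * n i)))
  have hL : Function.Surjective L := by
    rintro ⟨t, w⟩
    obtain ⟨v, hv, hv'⟩ := P.exists_lift x t w
    exact ⟨v, Prod.ext hv (funext hv')⟩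
  have hdim : Module.finrank ℝ (𝔼 (totalDim n)) = Module.finrank ℝ (ℝ × ∀ i, 𝔼 (2 * n i)) := by
    rw [finrank_euclideanSpace_fin, Module.finrank_prod, Module.finrank_pi_fintype,
      Module.finrank_self]
    simp only [finrank_euclideanSpace_fin]
    rfl
  have hinj := (LinearMap.injective_iff_surjective_of_finrank_eq_finrank hdim).2 hL
  have : L v = L (0 : 𝔼 (totalDim n)) := by
    rw [map_zero]
    exact Prod.ext h (funext h')
  exact hinj this

lemma connMetric_symm (a : ℝ) (b : Fin m → ℝ) (x : P.total)
    (v w : TangentSpace (𝓡 (totalDim n)) x) :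
    P.connMetric a b x v w = P.connMetric a b x w v := by
  rw [connMetric_apply, connMetric_apply, mul_comm (P.σ x v)]
  congr 1
  refine Finset.sum_congr rfl fun i _ => ?_
  rw [baseMetric_apply, (P.base i).metric.symm, baseMetric_apply]

lemma baseMetric_nonneg (i : Fin m) (x : P.total) (v : TangentSpace (𝓡 (totalDim n)) x) :
    0 ≤ P.baseMetric i x v v := by
  rw [baseMetric_apply]
  by_cases h : mfderiv (𝓡 (totalDim n)) (𝓡 (2 * n i)) (P.proj i) x v = 0
  · rw [h]; simp
  · exact ((P.base i).metric.pos _ _ h).le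

lemma connMetric_pos {a : ℝ} (ha : 0 < a) {b : Fin m → ℝ} (hb : ∀ i, 0 < b i) (x : P.total)
    (v : TangentSpace (𝓡 (totalDim n)) x) (hv : v ≠ 0) : 0 < P.connMetric a b x v v := by
  rw [connMetric_apply]
  have h1 : 0 ≤ a * (P.σ x v * P.σ x v) := mul_nonneg ha.le (mul_self_nonneg _)
  have h2 : ∀ i ∈ Finset.univ, 0 ≤ b i * P.baseMetric i x v v := fun i _ =>
    mul_nonneg (hb i).le (P.baseMetric_nonneg i x v)
  refine (add_nonneg h1 (Finset.sum_nonneg h2)).lt_of_ne' fun h0 => hv ?_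
  have h3 := (add_eq_zero_iff_of_nonneg h1 (Finset.sum_nonneg h2)).1 h0
  refine P.eq_zero_of_proj x v (by simpa [ha.ne'] using h3.1) fun i => ?_
  by_contra hi
  have h4 := (Finset.sum_eq_zero_iff_of_nonneg h2).1 h3.2 i (Finset.mem_univ i)
  have h5 : 0 < P.baseMetric i x v v := (P.base i).metric.pos _ _ hi
  exact (mul_pos (hb i) h5).ne' h4

end KECircleBundle

end Bundle

/-! ### The Ricci tensor of a connection-type metric on a circle bundle -/

section BundleRicci

namespace KECircleBundle

variable {m : ℕ} {n : Fin m → ℕ} {p q : Fin m → ℤ} (P : KECircleBundle.{u} n p q)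

/-- The projection to the `i`-th factor in the charts at `x₀` and its image. -/
def projRep (x₀ : P.total) (i : Fin m) : 𝔼 (totalDim n) → 𝔼 (2 * n i) :=
  mapRep (P.proj i) x₀ (P.proj i x₀)

variable {P} {x₀ : P.total} {y : 𝔼 (totalDim n)}

lemma projRep_self (i : Fin m) : P.projRep x₀ i (extChartAt (𝓡 (totalDim n)) x₀ x₀) =
    extChartAt (𝓡 (2 * n i)) (P.proj i x₀) (P.proj i x₀) :=
  mapRep_self (P.proj i) x₀

lemma eventually_mem_chart (x₀ : P.total) :
    ∀ᶠ z in 𝓝 (extChartAt (𝓡 (totalDim n)) x₀ x₀),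
      z ∈ (extChartAt (𝓡 (totalDim n)) x₀).target ∧
      ∀ i, P.proj i ((extChartAt (𝓡 (totalDim n)) x₀).symm z) ∈
        (extChartAt (𝓡 (2 * n i)) (P.proj i x₀)).source := by
  refine Filter.Eventually.and (extChartAt_target_mem_nhds x₀) (eventually_all.2 fun i => ?_)
  have hc : ContinuousAt (fun z => P.proj i ((extChartAt (𝓡 (totalDim n)) x₀).symm z))
      (extChartAt (𝓡 (totalDim n)) x₀ x₀) :=
    (P.proj_smooth i).continuous.continuousAt.comp
      (mdifferentiableAt_extChartAt_symm (mem_extChartAt_target x₀)).continuousAt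
  refine hc.preimage_mem_nhds ?_
  rw [extChartAt_to_inv]
  exact extChartAt_source_mem_nhds _

lemma bilinRep_baseMetric (hy : y ∈ (extChartAt (𝓡 (totalDim n)) x₀).target) {i : Fin m}
    (hi : P.proj i ((extChartAt (𝓡 (totalDim n)) x₀).symm y) ∈
      (extChartAt (𝓡 (2 * n i)) (P.proj i x₀)).source) (v w : 𝔼 (totalDim n)) :
    bilinRep (P.baseMetric i) x₀ y v w =
      bilinRep (P.base i).metric.inner (P.proj i x₀) (P.projRep x₀ i y)
        (fderiv ℝ (P.projRep x₀ i) y v) (fderiv ℝ (P.projRep x₀ i) y w) :=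
  (bilinRep_mapRep (P.proj_smooth i) (P.base i).metric.inner hy hi v w).symm

lemma bilinRep_connMetric (a : ℝ) (b : Fin m → ℝ) (x₀ : P.total) (y : 𝔼 (totalDim n)) :
    bilinRep (P.connMetric a b) x₀ y =
      a • bilinRep P.fibreMetric x₀ y + ∑ i, b i • bilinRep (P.baseMetric i) x₀ y := by
  ext v w
  simp only [_root_.add_apply, _root_.sum_apply, _root_.smul_apply, smul_eq_mul, bilinRep_apply,
    connMetric_apply, fibreMetric_apply]

lemma contDiffAt_bilinRep_fibreMetric (x₀ : P.total) :
    ContDiffAt ℝ ∞ (bilinRep P.fibreMetric x₀) (extChartAt (𝓡 (totalDim n)) x₀ x₀) := by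
  have h : ContDiffAt ℝ ∞ (formRep P.σ x₀) (extChartAt (𝓡 (totalDim n)) x₀ x₀) :=
    contDiffAt_formRep (P.σ_smooth x₀)
  refine contDiffAt_clm_of_apply fun v => contDiffAt_clm_of_apply fun w => ?_
  exact (h.clm_apply contDiffAt_const).mul (h.clm_apply contDiffAt_const)

lemma contDiffAt_projRep (hy : y ∈ (extChartAt (𝓡 (totalDim n)) x₀).target) {i : Fin m}
    (hi : P.proj i ((extChartAt (𝓡 (totalDim n)) x₀).symm y) ∈
      (extChartAt (𝓡 (2 * n i)) (P.proj i x₀)).source) :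
    ContDiffAt ℝ ∞ (P.projRep x₀ i) y :=
  contDiffAt_mapRep (P.proj_smooth i) hy hi

lemma contDiffAt_bilinRep_baseMetric (x₀ : P.total) (i : Fin m) :
    ContDiffAt ℝ ∞ (bilinRep (P.baseMetric i) x₀) (extChartAt (𝓡 (totalDim n)) x₀ x₀) := by
  have h0 := (eventually_mem_chart x₀).self_of_nhds
  have hf := contDiffAt_projRep h0.1 (h0.2 i)
  have hf' := hf.fderiv_right (m := ∞) (by norm_cast)
  have hH : ContDiffAt ℝ ∞ (bilinRep (P.base i).metric.inner (P.proj i x₀))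
      (P.projRep x₀ i (extChartAt (𝓡 (totalDim n)) x₀ x₀)) := by
    rw [projRep_self]
    exact (P.base i).contDiffAt_bilinRep_metric _
  have h1 := ContDiffAt.comp (extChartAt (𝓡 (totalDim n)) x₀ x₀) hH hf
  refine contDiffAt_clm_of_apply fun v => contDiffAt_clm_of_apply fun w => ?_
  refine ((h1.clm_apply (hf'.clm_apply (contDiffAt_const (c := v)))).clm_apply
    (hf'.clm_apply (contDiffAt_const (c := w)))).congr_of_eventuallyEq ?_
  filter_upwards [eventually_mem_chart x₀] with z hz
  exact bilinRep_baseMetric hz.1 (hz.2 i) v w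

lemma contDiffAt_bilinRep_connMetric (a : ℝ) (b : Fin m → ℝ) (x₀ : P.total) :
    ContDiffAt ℝ ∞ (bilinRep (P.connMetric a b) x₀) (extChartAt (𝓡 (totalDim n)) x₀ x₀) := by
  rw [show bilinRep (P.connMetric a b) x₀ = _ from funext (bilinRep_connMetric a b x₀)]
  exact ((contDiffAt_bilinRep_fibreMetric x₀).const_smul a).add
    (ContDiffAt.sum fun i _ => (contDiffAt_bilinRep_baseMetric x₀ i).const_smul (b i))

lemma bilinRep_connMetric_pos {a : ℝ} (ha : 0 < a) {b : Fin m → ℝ} (hb : ∀ i, 0 < b i)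
    (hy : y ∈ (extChartAt (𝓡 (totalDim n)) x₀).target) (v : 𝔼 (totalDim n)) (hv : v ≠ 0) :
    0 < bilinRep (P.connMetric a b) x₀ y v v := by
  rw [bilinRep_apply]
  exact P.connMetric_pos ha hb _ _ fun h => hv (chartFrame_injective hy (h.trans (map_zero _).symm))

lemma bilinRep_connMetric_symm (a : ℝ) (b : Fin m → ℝ) (x₀ : P.total) (y v w : 𝔼 (totalDim n)) :
    bilinRep (P.connMetric a b) x₀ y v w = bilinRep (P.connMetric a b) x₀ y w v := by
  rw [bilinRep_apply, bilinRep_apply]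
  exact P.connMetric_symm a b _ _ _

lemma isConnectionMetric {a : ℝ} (ha : 0 < a) {b : Fin m → ℝ} (hb : ∀ i, 0 < b i) (x₀ : P.total) :
    ∀ᶠ z in 𝓝 (extChartAt (𝓡 (totalDim n)) x₀ x₀),
      IsConnectionMetric a b (fun i => (q i : ℝ)) (formRep P.σ x₀) (P.projRep x₀)
        (fun i => bilinRep (P.base i).metric.inner (P.proj i x₀))
        (fun i => endRep (P.base i).J (P.proj i x₀))
        (fun i => christoffelForm (P.base i).metric.inner (P.proj i x₀))
        (bilinRep (P.connMetric a b) x₀) (christoffelForm (P.connMetric a b) x₀) z := by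
  have h0 := (eventually_mem_chart x₀).self_of_nhds
  have hbase : ∀ᶠ z in 𝓝 (extChartAt (𝓡 (totalDim n)) x₀ x₀), ∀ i,
      DifferentiableAt ℝ (bilinRep (P.base i).metric.inner (P.proj i x₀)) (P.projRep x₀ i z) := by
    refine eventually_all.2 fun i => ?_
    have hc : ContinuousAt (P.projRep x₀ i) (extChartAt (𝓡 (totalDim n)) x₀ x₀) :=
      (contDiffAt_projRep h0.1 (h0.2 i)).continuousAt
    refine hc.eventually ?_
    rw [projRep_self]
    exact ContDiffAt.eventually_differentiableAt ((P.base i).contDiffAt_bilinRep_metric _)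
  filter_upwards [eventually_mem_chart x₀, (eventually_mem_chart x₀).eventually_nhds, hbase,
    ContDiffAt.eventually_differentiableAt (contDiffAt_bilinRep_connMetric a b x₀)]
    with z hz hz' hzb hzd
  have ht : ∀ i, P.projRep x₀ i z ∈ (extChartAt (𝓡 (2 * n i)) (P.proj i x₀)).target := fun i =>
    (extChartAt (𝓡 (2 * n i)) (P.proj i x₀)).map_source (hz.2 i)
  exact
  { form_smooth := contDiffAt_formRep_of_mem_target P.σ_smooth hz.1
    map_smooth := fun i => contDiffAt_projRep hz.1 (hz.2 i)
    base_diff := hzb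
    metric_diff := hzd
    metric := by
      filter_upwards [hz'] with z' hz' Y Z
      rw [bilinRep_connMetric]
      simp only [_root_.add_apply, _root_.sum_apply, _root_.smul_apply, smul_eq_mul]
      congr 1
      exact Finset.sum_congr rfl fun i _ => by rw [bilinRep_baseMetric hz'.1 (hz'.2 i)]
    connection := isLeviCivita_christoffelForm (bilinRep_connMetric_pos ha hb hz.1)
      (bilinRep_connMetric_symm a b x₀) hzd
    base_connection := fun i => KEManifold.isLeviCivita_metric (ht i) (hzb i)
    base_symm := fun i => (P.base i).bilinRep_metric_symm _ _
    base_pos := fun i => KEManifold.bilinRep_metric_pos (ht i)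
    skew := fun i => KEManifold.endRep_J_skew (ht i)
    curv := fun X Y => by
      rw [extD_chartFrame hz.1
        ((contDiffAt_formRep_of_mem_target P.σ_smooth hz.1).differentiableAt (by simp))
        ((contDiffAt_formRep (P.σ_smooth _)).differentiableAt (by simp)), P.σ_curvature]
      refine Finset.sum_congr rfl fun i _ => ?_
      congr 1
      refine (bilinRep_mapRep (P.proj_smooth i) (P.base i).kahlerForm hz.1 (hz.2 i) X Y).symm.trans
        ?_
      exact congrArg (fun B : 𝔼 (2 * n i) →L[ℝ] 𝔼 (2 * n i) →L[ℝ] ℝ =>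
        B (fderiv ℝ (P.projRep x₀ i) z X) (fderiv ℝ (P.projRep x₀ i) z Y))
        (KEManifold.bilinRep_kahlerForm (ht i))
    surj := fun t w => by
      obtain ⟨v, hv, hv'⟩ := P.exists_lift ((extChartAt (𝓡 (totalDim n)) x₀).symm z) t
        fun i => (chartFrame (P.proj i x₀) (P.projRep x₀ i z) (w i) : 𝔼 (2 * n i))
      obtain ⟨X, rfl⟩ : ∃ X : 𝔼 (totalDim n), chartFrame x₀ z X = v :=
        ⟨_, chartFrame_mfderiv_extChartAt hz.1 v⟩
      refine ⟨X, hv, fun i => ?_⟩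
      apply chartFrame_injective (ht i)
      exact (chartFrame_mapRep (P.proj_smooth i) hz.1 (hz.2 i) X).trans (hv' i) }

lemma isKahlerConnectionMetric {a : ℝ} (ha : 0 < a) {b : Fin m → ℝ} (hb : ∀ i, 0 < b i)
    (x₀ : P.total) :
    IsKahlerConnectionMetric a b (fun i => (q i : ℝ)) (formRep P.σ x₀) (P.projRep x₀)
      (fun i => bilinRep (P.base i).metric.inner (P.proj i x₀))
      (fun i => endRep (P.base i).J (P.proj i x₀))
      (fun i => christoffelForm (P.base i).metric.inner (P.proj i x₀))
      (bilinRep (P.connMetric a b) x₀) (christoffelForm (P.connMetric a b) x₀)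
      (extChartAt (𝓡 (totalDim n)) x₀ x₀) where
  eventually := isConnectionMetric ha hb x₀
  fibre_ne := ha.ne'
  base_ne := fun i => (hb i).ne'
  christoffel_diff := differentiableAt_christoffelForm
    (bilinRep_connMetric_pos ha hb (mem_extChartAt_target x₀))
    (contDiffAt_bilinRep_connMetric a b x₀)
  base_christoffel_diff := fun i => by
    rw [projRep_self]
    exact differentiableAt_christoffelForm
      (KEManifold.bilinRep_metric_pos (mem_extChartAt_target _))
      ((P.base i).contDiffAt_bilinRep_metric _)
  complex_diff := fun i => by
    rw [projRep_self]
    exact ((P.base i).contDiffAt_endRep_J _).differentiableAt (by simp)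
  complex_sq := fun i => by
    rw [projRep_self]
    exact KEManifold.endRep_J_sq (mem_extChartAt_target _)
  parallel := fun i => by
    rw [projRep_self]
    exact KEManifold.parallel_endRep_J (mem_extChartAt_target _)
      (((P.base i).contDiffAt_bilinRep_metric _).differentiableAt (by simp))
      (((P.base i).contDiffAt_endRep_J _).differentiableAt (by simp))
  inj := fun X h h' => by
    have h0 := (eventually_mem_chart x₀).self_of_nhds
    apply chartFrame_injective h0.1
    rw [map_zero]
    refine P.eq_zero_of_proj _ _ h fun i => ?_
    refine (chartFrame_mapRep (P.proj_smooth i) h0.1 (h0.2 i) X).symm.trans ?_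
    exact (congrArg (fun v : 𝔼 (2 * n i) => (chartFrame (P.proj i x₀) (mapRep (P.proj i) x₀
      (P.proj i x₀) (extChartAt (𝓡 (totalDim n)) x₀ x₀)) v : 𝔼 (2 * n i))) (h' i)).trans
      (map_zero _)

/-- The Ricci tensor of a connection-type metric. -/
theorem ricci_connMetric {a : ℝ} (ha : 0 < a) {b : Fin m → ℝ} (hb : ∀ i, 0 < b i) (x : P.total)
    (v w : TangentSpace (𝓡 (totalDim n)) x) :
    ricci (P.connMetric a b) x v w =
      (∑ i, n i * (q i : ℝ) ^ 2 * a ^ 2 / (2 * b i ^ 2)) * (P.σ x v * P.σ x w) +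
      ∑ i, (p i - a * (q i : ℝ) ^ 2 / (2 * b i)) * P.baseMetric i x v w := by
  have hK := isKahlerConnectionMetric ha hb x
  have h0 := (eventually_mem_chart x).self_of_nhds
  refine (ricci_eq_trace x hK.christoffel_diff v w).trans ?_
  refine (hK.trace_curvatureEnd v w).trans ?_
  have hσ : ∀ v : 𝔼 (totalDim n), formRep P.σ x (extChartAt (𝓡 (totalDim n)) x x) v = P.σ x v :=
    formRep_self P.σ x
  have hB : ∀ i, bilinRep (P.base i).metric.inner (P.proj i x)
      (P.projRep x i (extChartAt (𝓡 (totalDim n)) x x))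
        (fderiv ℝ (P.projRep x i) (extChartAt (𝓡 (totalDim n)) x x) v)
        (fderiv ℝ (P.projRep x i) (extChartAt (𝓡 (totalDim n)) x x) w) =
      P.baseMetric i x v w := fun i =>
    (bilinRep_baseMetric h0.1 (h0.2 i) v w).symm.trans (bilinRep_self (P.baseMetric i) x v w)
  congr 1
  · congr 1
    -- The real dimension `2 * n i` of the factor turns `(a q / (2 b))²` into `n q² a² / (2 b²)`.
    · refine Finset.sum_congr rfl fun i _ => ?_
      have := (hb i).ne'
      rw [finrank_euclideanSpace_fin]
      push_cast
      field_simp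
    · exact congrArg₂ (· * ·) (hσ v) (hσ w)
  · refine Finset.sum_congr rfl fun i _ => ?_
    have h1 := KEManifold.trace_curvatureEnd_metric (P.proj i x)
      (fderiv ℝ (P.projRep x i) (extChartAt (𝓡 (totalDim n)) x x) v)
        (fderiv ℝ (P.projRep x i) (extChartAt (𝓡 (totalDim n)) x x) w)
    rw [← projRep_self] at h1
    rw [h1, hB]
    ring

end KECircleBundle

end BundleRicci

/-! ### From the reduced equations to the Ricci flow -/

section Ancient

namespace KECircleBundle

variable {m : ℕ} {n : Fin m → ℕ} {p q : Fin m → ℤ} (P : KECircleBundle.{u} n p q)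

/-- The metric is a combination of fixed smooth tensor fields with time-dependent scalars, so joint
smoothness is smoothness of the scalars. -/
lemma contMDiffOn_connMetric {S : Set ℝ} {a : ℝ → ℝ} {b : ℝ → Fin m → ℝ}
    (ha : ContDiffOn ℝ ∞ a S) (hb : ∀ i, ContDiffOn ℝ ∞ (fun t => b t i) S) :
    ContMDiffOn (𝓘(ℝ, ℝ).prod (𝓡 (totalDim n))) ((𝓡 (totalDim n)).prod
      𝓘(ℝ, 𝔼 (totalDim n) →L[ℝ] 𝔼 (totalDim n) →L[ℝ] ℝ)) ∞
      (fun tx : ℝ × P.total => (TotalSpace.mk' (𝔼 (totalDim n) →L[ℝ] 𝔼 (totalDim n) →L[ℝ] ℝ) tx.2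
        (P.connMetric (a tx.1) (b tx.1) tx.2) : TotalSpace _ (fun x : P.total =>
          TangentSpace (𝓡 (totalDim n)) x →L[ℝ] TangentSpace (𝓡 (totalDim n)) x →L[ℝ] ℝ)))
      (S ×ˢ univ) := by
  rintro ⟨t₀, x₀⟩ ⟨ht₀, -⟩
  rw [contMDiffWithinAt_hom_bundle]
  refine ⟨contMDiffWithinAt_snd, ?_⟩
  have hF := ((contMDiffAt_hom_bundle _).1
    (contMDiffAt_bilin_iff.2 (contDiffAt_bilinRep_fibreMetric (P := P) x₀))).2
  have hB := fun i => ((contMDiffAt_hom_bundle _).1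
    (contMDiffAt_bilin_iff.2 (contDiffAt_bilinRep_baseMetric (P := P) x₀ i))).2
  have hsc : ∀ {c : ℝ → ℝ}, ContDiffOn ℝ ∞ c S →
      ContMDiffWithinAt (𝓘(ℝ, ℝ).prod (𝓡 (totalDim n))) 𝓘(ℝ, ℝ) ∞
        (fun tx : ℝ × P.total => c tx.1) (S ×ˢ univ) (t₀, x₀) := fun hc =>
    ContMDiffWithinAt.comp (t₀, x₀) (hc t₀ ht₀).contMDiffWithinAt contMDiffWithinAt_fst
      fun _ h => h.1
  have hsnd : ∀ {f : P.total → 𝔼 (totalDim n) →L[ℝ] 𝔼 (totalDim n) →L[ℝ] ℝ},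
      ContMDiffAt (𝓡 (totalDim n)) 𝓘(ℝ, 𝔼 (totalDim n) →L[ℝ] 𝔼 (totalDim n) →L[ℝ] ℝ) ∞ f x₀ →
      ContMDiffWithinAt (𝓘(ℝ, ℝ).prod (𝓡 (totalDim n)))
        𝓘(ℝ, 𝔼 (totalDim n) →L[ℝ] 𝔼 (totalDim n) →L[ℝ] ℝ) ∞
        (fun tx : ℝ × P.total => f tx.2) (S ×ˢ univ) (t₀, x₀) := fun hf =>
    ContMDiffAt.comp_contMDiffWithinAt (t₀, x₀) hf contMDiffWithinAt_snd
  have key : ∀ tx : ℝ × P.total, ContinuousLinearMap.inCoordinates (𝔼 (totalDim n))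
      (fun x : P.total => TangentSpace (𝓡 (totalDim n)) x) (𝔼 (totalDim n) →L[ℝ] ℝ)
      (fun x : P.total => TangentSpace (𝓡 (totalDim n)) x →L[ℝ] ℝ) x₀ tx.2 x₀ tx.2
      (P.connMetric (a tx.1) (b tx.1) tx.2) =
      a tx.1 • ContinuousLinearMap.inCoordinates (𝔼 (totalDim n))
      (fun x : P.total => TangentSpace (𝓡 (totalDim n)) x) (𝔼 (totalDim n) →L[ℝ] ℝ)
      (fun x : P.total => TangentSpace (𝓡 (totalDim n)) x →L[ℝ] ℝ) x₀ tx.2 x₀ tx.2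
      (P.fibreMetric tx.2) + ∑ i, b tx.1 i • ContinuousLinearMap.inCoordinates (𝔼 (totalDim n))
      (fun x : P.total => TangentSpace (𝓡 (totalDim n)) x) (𝔼 (totalDim n) →L[ℝ] ℝ)
      (fun x : P.total => TangentSpace (𝓡 (totalDim n)) x →L[ℝ] ℝ) x₀ tx.2 x₀ tx.2
      (P.baseMetric i tx.2) := by
    intro tx
    ext1 v
    rw [connMetric_eq]
    simp only [ContinuousLinearMap.inCoordinates, ContinuousLinearMap.comp_apply,
      _root_.add_apply, _root_.sum_apply, _root_.smul_apply, map_add, map_sum, map_smul]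
  refine (((hsc ha).smul (hsnd hF)).add
    (ContMDiffWithinAt.sum (t := Finset.univ) fun i _ => (hsc (hb i)).smul (hsnd (hB i)))).congr
    (fun tx _ => ?_) ?_
  · exact key tx
  · exact key (t₀, x₀)

/-- The prescribed derivatives are twice the coefficients of the Ricci tensor, and the substitution
`t = -τ` supplies the minus sign of the flow. -/
theorem isAncient {a : ℝ → ℝ} {b : ℝ → Fin m → ℝ}
    (ha : ContDiffOn ℝ ∞ a (Ici 0)) (hb : ∀ i, ContDiffOn ℝ ∞ (fun t => b t i) (Ici 0))
    (ha₀ : ∀ τ, 0 ≤ τ → 0 < a τ) (hb₀ : ∀ τ, 0 ≤ τ → ∀ i, 0 < b τ i)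
    (ha' : ∀ τ, 0 ≤ τ → HasDerivWithinAt a
      (∑ i, n i * (q i : ℝ) ^ 2 * (a τ ^ 2 / b τ i ^ 2)) (Ici 0) τ)
    (hb' : ∀ τ, 0 ≤ τ → ∀ i, HasDerivWithinAt (fun s => b s i)
      (2 * p i - (q i : ℝ) ^ 2 * (a τ / b τ i)) (Ici 0) τ) : P.IsAncient a b := by
  have hneg : MapsTo (fun t : ℝ => -t) (Iic 0) (Ici 0) := fun t ht =>
    mem_Ici.2 (neg_nonneg.2 (mem_Iic.1 ht))
  have hnd : ContDiffOn ℝ ∞ (fun t : ℝ => -t) (Iic 0) := contDiff_neg.contDiffOn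
  refine ⟨P.contMDiffOn_connMetric (a := fun t => a (-t)) (b := fun t => b (-t))
    (ha.comp hnd hneg) fun i => (hb i).comp hnd hneg, fun t _ x v w => P.connMetric_symm _ _ x v w,
    fun t ht x v hv => P.connMetric_pos (ha₀ _ (hneg ht)) (hb₀ _ (hneg ht)) x v hv,
    fun t ht x v w => ?_⟩
  rw [ricci_connMetric (ha₀ _ (hneg ht)) (hb₀ _ (hneg ht))]
  have hd : HasDerivWithinAt (fun t : ℝ => -t) (-1) (Iic 0) t := (hasDerivAt_neg t).hasDerivWithinAt
  have h1 := (ha' (-t) (hneg ht)).comp t hd hneg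
  have h2 := fun i => (hb' (-t) (hneg ht) i).comp t hd hneg
  have h3 := (h1.mul_const (P.σ x v * P.σ x w)).add
    (HasDerivWithinAt.fun_sum (u := Finset.univ) fun i _ => (h2 i).mul_const (P.baseMetric i x v w))
  simp only [connMetric_apply]
  refine h3.congr_deriv ?_
  rw [mul_add, ← mul_assoc (-2 : ℝ), Finset.mul_sum, Finset.mul_sum, Finset.sum_mul]
  congr 1
  · congr 1
    refine Finset.sum_congr rfl fun i _ => ?_
    have := (hb₀ _ (hneg ht) i).ne'
    field_simp
  · refine Finset.sum_congr rfl fun i _ => ?_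
    have := (hb₀ _ (hneg ht) i).ne'
    field_simp

end KECircleBundle

end Ancient

/-! ## From solutions of the system to metric coefficients -/

section Correspondence

/-- A trajectory of a smooth vector field is smooth. -/
lemma contDiffOn_of_hasDerivWithinAt {E : Type*} [NormedAddCommGroup E] [NormedSpace ℝ E]
    {f : ℝ → E} {V : E → E} {Ω : Set E} (hV : ContDiffOn ℝ ∞ V Ω)
    (hΩ : MapsTo f (Ici 0) Ω)
    (h : ∀ τ, 0 ≤ τ → HasDerivWithinAt f (V (f τ)) (Ici 0) τ) : ContDiffOn ℝ ∞ f (Ici 0) := by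
  rw [contDiffOn_infty]
  intro k
  -- Bootstrapping: the derivative is `V ∘ f`, which is as regular as `f`.
  induction k with
  | zero => exact contDiffOn_zero.2 fun τ hτ => (h τ hτ).continuousWithinAt
  | succ k ih =>
    have hu : UniqueDiffOn ℝ (Ici (0 : ℝ)) := uniqueDiffOn_Ici 0
    rw [Nat.cast_succ, contDiffOn_succ_iff_derivWithin hu]
    refine ⟨fun τ hτ => (h τ hτ).differentiableWithinAt, by simp, ?_⟩
    refine ((hV.of_le (by exact_mod_cast le_top)).comp ih hΩ).congr fun τ hτ => ?_
    exact (h τ hτ).derivWithin (hu τ hτ)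

variable {m : ℕ} {n : Fin m → ℕ} {p q : Fin m → ℤ}

lemma energy_nonneg (Y : Fin m → ℝ) : 0 ≤ energy n q Y :=
  Finset.sum_nonneg fun i _ => by positivity

lemma continuous_energy : Continuous (energy n q) := by
  unfold energy; fun_prop

lemma IsSolution.continuousOn {Y : ℝ → Fin m → ℝ} (hY : IsSolution n p q Y) :
    ContinuousOn Y (Ici 0) :=
  fun u hu => continuousWithinAt_pi.2 fun i => (hY u hu i).continuousWithinAt

/-- The change of time variable: a continuous function bounded below by a positive constant is
the derivative of a homeomorphism of the line. -/
lemma exists_inverse_primitive {A : ℝ → ℝ} (hA : Continuous A) {c : ℝ} (hc : 0 < c)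
    (hcA : ∀ u, c ≤ A u) :
    ∃ U : ℝ → ℝ, U 0 = 0 ∧ Monotone U ∧ ∀ τ, HasDerivAt U (1 / A (U τ)) τ := by
  set T : ℝ → ℝ := fun u => ∫ ζ in (0 : ℝ)..u, A ζ with hT
  have hd : ∀ u, HasDerivAt T (A u) u := fun u =>
    intervalIntegral.integral_hasDerivAt_right (hA.intervalIntegrable _ _)
      (hA.stronglyMeasurableAtFilter _ _) hA.continuousAt
  have hpos : ∀ u, 0 < A u := fun u => hc.trans_le (hcA u)
  have hcont : Continuous T := continuous_iff_continuousAt.2 fun u => (hd u).continuousAt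
  have hmono : StrictMono T := strictMono_of_deriv_pos fun u => by rw [(hd u).deriv]; exact hpos u
  have hT0 : T 0 = 0 := intervalIntegral.integral_same
  -- The uniform lower bound makes the primitive tend to infinity at both ends, so that its inverse
  -- is defined on the whole line.
  have hge : ∀ u v, u ≤ v → c * (v - u) ≤ T v - T u := fun u v huv => by
    have h1 := intervalIntegral.integral_mono_on (μ := MeasureTheory.volume) (f := fun _ => c)
      huv intervalIntegrable_const (hA.intervalIntegrable u v) fun x _ => hcA x
    rw [intervalIntegral.integral_const, smul_eq_mul] at h1
    have h2 : T v - T u = ∫ ζ in u..v, A ζ :=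
      intervalIntegral.integral_interval_sub_left (hA.intervalIntegrable _ _)
        (hA.intervalIntegrable _ _)
    linarith
  have htop : Tendsto T atTop atTop := by
    refine tendsto_atTop_mono' _ ?_ (tendsto_id.const_mul_atTop hc)
    filter_upwards [eventually_ge_atTop 0] with u hu
    have := hge 0 u hu
    simp only [hT0, sub_zero] at this
    exact this
  have hbot : Tendsto T atBot atBot := by
    refine tendsto_atBot_mono' _ ?_ (tendsto_id.const_mul_atBot hc)
    filter_upwards [eventually_le_atBot 0] with u hu
    have := hge u 0 hu
    simp only [hT0, zero_sub] at this
    simp only [id]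
    linarith
  have hsurj : Function.Surjective T := hcont.surjective htop hbot
  set e := StrictMono.orderIsoOfSurjective T hmono hsurj with he
  have heT : ∀ u, e u = T u := fun u => rfl
  refine ⟨e.symm, ?_, e.symm.monotone, fun τ => ?_⟩
  · rw [OrderIso.symm_apply_eq, heT, hT0]
  · rw [one_div]
    refine HasDerivAt.of_local_left_inverse e.symm.continuous.continuousAt (hd _)
      (hpos _).ne' (Eventually.of_forall fun τ => ?_)
    exact e.apply_symm_apply τ

/-- A positive solution of the system determines metric coefficients with the prescribed initial
fibre scale, which solve the reduced Ricci flow. -/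
theorem exists_corresponds {Y : ℝ → Fin m → ℝ} (hY : IsSolution n p q Y)
    (hpos : ∀ u, 0 ≤ u → ∀ i, 0 < Y u i) {a₀ : ℝ} (ha₀ : 0 < a₀) :
    ∃ (a : ℝ → ℝ) (b : ℝ → Fin m → ℝ), a 0 = a₀ ∧ Corresponds n q Y a b ∧
      ContDiffOn ℝ ∞ a (Ici 0) ∧ (∀ i, ContDiffOn ℝ ∞ (fun τ => b τ i) (Ici 0)) ∧
      (∀ τ, 0 ≤ τ → HasDerivWithinAt a
        (∑ i, n i * (q i : ℝ) ^ 2 * (a τ ^ 2 / b τ i ^ 2)) (Ici 0) τ) ∧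
      (∀ τ, 0 ≤ τ → ∀ i, HasDerivWithinAt (fun s => b s i)
        (2 * p i - (q i : ℝ) ^ 2 * (a τ / b τ i)) (Ici 0) τ) := by
  -- The solution is controlled only for `u ≥ 0`; clamping the time at `0` gives continuous
  -- functions on the line without changing anything on `[0, ∞)`.
  have hmax : Continuous fun u : ℝ => max u 0 := continuous_id.max continuous_const
  set e : ℝ → ℝ := fun u => energy n q (Y (max u 0)) with he
  have hec : Continuous e := continuous_energy.comp
    (hY.continuousOn.comp_continuous hmax fun u => mem_Ici.2 (le_max_right _ _))
  set A : ℝ → ℝ := fun u => a₀ * Real.exp (∫ ζ in (0 : ℝ)..u, e ζ) with hA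
  have hAd : ∀ u, HasDerivAt A (A u * e u) u := fun u => by
    have h1 : HasDerivAt (fun u => ∫ ζ in (0 : ℝ)..u, e ζ) (e u) u :=
      intervalIntegral.integral_hasDerivAt_right (hec.intervalIntegrable _ _)
        (hec.stronglyMeasurableAtFilter _ _) hec.continuousAt
    exact (h1.exp.const_mul a₀).congr_deriv (by rw [hA]; ring)
  have hAc : Continuous A := continuous_iff_continuousAt.2 fun u => (hAd u).continuousAt
  have hApos : ∀ u, 0 < A u := fun u => mul_pos ha₀ (Real.exp_pos _)
  -- The energy is nonnegative, so the fibre scale never falls below `a₀`. This bound is what makes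
  -- the flow exist for all `τ ≥ 0`.
  have hAge : ∀ u, a₀ ≤ A (max u 0) := fun u => by
    have : 0 ≤ ∫ ζ in (0 : ℝ)..(max u 0), e ζ :=
      intervalIntegral.integral_nonneg (le_max_right _ _) fun ζ _ => energy_nonneg _
    exact le_mul_of_one_le_right ha₀.le (Real.one_le_exp this)
  obtain ⟨U, hU0, hUm, hUd⟩ := exists_inverse_primitive (hAc.comp hmax) ha₀ hAge
  have hUc : Continuous U := continuous_iff_continuousAt.2 fun τ => (hUd τ).continuousAt
  have hUn : ∀ τ, 0 ≤ τ → 0 ≤ U τ := fun τ hτ => hU0 ▸ hUm hτ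
  have hac : Continuous fun τ => A (max (U τ) 0) := hAc.comp (hmax.comp hUc)
  have hint : ∀ τ, (∫ ζ in (0 : ℝ)..τ, 1 / A (max (U ζ) 0)) = U τ := fun τ => by
    rw [intervalIntegral.integral_eq_sub_of_hasDerivAt (f := U)
      (f' := fun ζ => 1 / A (max (U ζ) 0)) (fun t _ => hUd t), hU0, sub_zero]
    exact (continuous_const.div hac fun t => (hApos _).ne').intervalIntegrable _ _
  have hmaxU : ∀ τ, 0 ≤ τ → max (U τ) 0 = U τ := fun τ hτ => max_eq_left (hUn τ hτ)
  set a : ℝ → ℝ := fun τ => A (max (U τ) 0) with ha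
  set b : ℝ → Fin m → ℝ := fun τ i => a τ / Y (U τ) i with hb
  have hapos : ∀ τ, 0 < a τ := fun τ => hApos _
  have hratio : ∀ τ, 0 ≤ τ → ∀ i, Y (U τ) i = a τ / b τ i := fun τ hτ i => by
    have h1 := (hpos _ (hUn τ hτ) i).ne'
    have h2 := (hapos τ).ne'
    simp only [hb]
    field_simp
  have hbpos : ∀ τ, 0 ≤ τ → ∀ i, 0 < b τ i := fun τ hτ i =>
    div_pos (hapos τ) (hpos _ (hUn τ hτ) i)
  have hUd' : ∀ τ, 0 ≤ τ → HasDerivWithinAt U (1 / a τ) (Ici 0) τ := fun τ _ =>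
    (hUd τ).hasDerivWithinAt
  have had₁ : ∀ τ, 0 ≤ τ → HasDerivWithinAt a (energy n q (Y (U τ))) (Ici 0) τ := fun τ hτ => by
    have h1 : HasDerivWithinAt (A ∘ U) (A (U τ) * e (U τ) * (1 / a τ)) (Ici 0) τ :=
      (hAd (U τ)).comp_hasDerivWithinAt τ (hUd' τ hτ)
    refine (h1.congr (fun s hs => ?_) ?_).congr_deriv ?_
    · simp only [ha, hmaxU s hs, Function.comp]
    · simp only [ha, hmaxU τ hτ, Function.comp]
    · have := (hApos (U τ)).ne'
      simp only [ha, he, hmaxU τ hτ]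
      field_simp
  have had : ∀ τ, 0 ≤ τ → HasDerivWithinAt a
      (∑ i, n i * (q i : ℝ) ^ 2 * (a τ ^ 2 / b τ i ^ 2)) (Ici 0) τ := fun τ hτ => by
    refine (had₁ τ hτ).congr_deriv ?_
    rw [energy]
    exact Finset.sum_congr rfl fun i _ => by rw [hratio τ hτ i, div_pow]
  have hbd : ∀ τ, 0 ≤ τ → ∀ i, HasDerivWithinAt (fun s => b s i)
      (2 * p i - (q i : ℝ) ^ 2 * (a τ / b τ i)) (Ici 0) τ := fun τ hτ i => by
    have hYi := (hpos _ (hUn τ hτ) i).ne'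
    have h1 : HasDerivWithinAt (fun s => Y (U s) i)
        (-(Y (U τ) i * rate n p q i (Y (U τ))) * (1 / a τ)) (Ici 0) τ :=
      (hY (U τ) (hUn τ hτ) i).comp τ (hUd' τ hτ) fun s hs => hUn s hs
    refine ((had₁ τ hτ).div h1 hYi).congr_deriv ?_
    rw [← hratio τ hτ i, rate]
    have h2 := (hapos τ).ne'
    field_simp
    ring
  -- The pair solves an autonomous equation whose right side is smooth wherever no `b i` vanishes,
  -- so it is smooth up to `τ = 0`.
  have hsm : ContDiffOn ℝ ∞ (fun τ => (a τ, b τ)) (Ici 0) := by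
    refine contDiffOn_of_hasDerivWithinAt (Ω := {x : ℝ × (Fin m → ℝ) | ∀ i, x.2 i ≠ 0})
      (V := fun x => (∑ i, n i * (q i : ℝ) ^ 2 * (x.1 ^ 2 / x.2 i ^ 2),
        fun i => 2 * p i - (q i : ℝ) ^ 2 * (x.1 / x.2 i))) ?_
      (fun τ hτ i => (hbpos τ hτ i).ne')
      (fun τ hτ => (had τ hτ).prodMk (hasDerivWithinAt_pi.2 fun i => hbd τ hτ i))
    have h2 : ∀ i, ContDiffOn ℝ ∞ (fun x : ℝ × (Fin m → ℝ) => x.2 i)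
        {x : ℝ × (Fin m → ℝ) | ∀ i, x.2 i ≠ 0} := fun i => by fun_prop
    have h1 : ContDiffOn ℝ ∞ (fun x : ℝ × (Fin m → ℝ) => x.1)
        {x : ℝ × (Fin m → ℝ) | ∀ i, x.2 i ≠ 0} := by fun_prop
    refine ContDiffOn.prodMk (ContDiffOn.sum fun i _ => contDiffOn_const.mul
      ((h1.pow 2).div ((h2 i).pow 2) fun x hx => pow_ne_zero _ (hx i))) (contDiffOn_pi.2 fun i =>
        contDiffOn_const.sub (contDiffOn_const.mul (h1.div (h2 i) fun x hx => hx i)))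
  refine ⟨a, b, ?_, ⟨fun τ _ => hapos τ, hbpos, hac.continuousOn, fun τ hτ i => ?_, fun τ hτ => ?_⟩,
    contDiff_fst.comp_contDiffOn hsm,
    fun i => (contDiff_apply ℝ ℝ i).comp_contDiffOn (contDiff_snd.comp_contDiffOn hsm), had, hbd⟩
  · simp [ha, hA, hU0]
  · rw [hint τ]; exact hratio τ hτ i
  · rw [hint τ]
    have h0 : a 0 = a₀ := by simp [ha, hA, hU0]
    rw [h0]
    simp only [ha, hA, hmaxU τ hτ]
    congr 2
    refine intervalIntegral.integral_congr fun ζ hζ => ?_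
    rw [uIcc_of_le (hUn τ hτ)] at hζ
    simp only [he, max_eq_left hζ.1]

end Correspondence

/-! ## The flow of a Lipschitz vector field -/

section Flow

open Metric NNReal

variable {E : Type*} [NormedAddCommGroup E] [NormedSpace ℝ E]

lemma hasDerivWithinAt_of_notMem {f : ℝ → E} {f' : E} {s : Set ℝ} {t : ℝ} (hs : IsClosed s)
    (ht : t ∉ s) : HasDerivWithinAt f f' s t :=
  HasFDerivWithinAt.of_notMem_closure (by rwa [hs.closure_eq])

/-- Two curves with the same velocity at their common point can be joined. -/
lemma hasDerivWithinAt_glue {f g : ℝ → E} {v : E → E} {s s' : Set ℝ} {c : ℝ}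
    (hs : IsClosed s) (hs' : IsClosed s') (hsc : s ⊆ Iic c) (hsc' : s' ⊆ Ici c) (hfg : f c = g c)
    (hf : ∀ t ∈ s, HasDerivWithinAt f (v (f t)) s t)
    (hg : ∀ t ∈ s', HasDerivWithinAt g (v (g t)) s' t) :
    ∀ t ∈ s ∪ s', HasDerivWithinAt (fun t => if t ≤ c then f t else g t)
      (v (if t ≤ c then f t else g t)) (s ∪ s') t := by
  have e1 : ∀ t ∈ s, (if t ≤ c then f t else g t) = f t := fun t ht => if_pos (hsc ht)
  have e2 : ∀ t ∈ s', (if t ≤ c then f t else g t) = g t := fun t ht => by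
    split_ifs with h
    · rw [le_antisymm h (hsc' ht), hfg]
    · rfl
  intro t _
  refine HasDerivWithinAt.union ?_ ?_
  · by_cases ht : t ∈ s
    · rw [e1 t ht]; exact (hf t ht).congr e1 (e1 t ht)
    · exact hasDerivWithinAt_of_notMem hs ht
  · by_cases ht : t ∈ s'
    · rw [e2 t ht]; exact (hg t ht).congr e2 (e2 t ht)
    · exact hasDerivWithinAt_of_notMem hs' ht

variable {V : E → E} {K : ℝ≥0}

lemma eqOn_of_trajectory (hV : LipschitzWith K V) {f g : ℝ → E} {b : ℝ}
    (hf : ∀ t ∈ Icc 0 b, HasDerivWithinAt f (V (f t)) (Icc 0 b) t)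
    (hg : ∀ t ∈ Icc 0 b, HasDerivWithinAt g (V (g t)) (Icc 0 b) t) (h : f 0 = g 0) :
    EqOn f g (Icc 0 b) := by
  have key : ∀ {f : ℝ → E}, (∀ t ∈ Icc 0 b, HasDerivWithinAt f (V (f t)) (Icc 0 b) t) →
      ∀ t ∈ Ico 0 b, HasDerivWithinAt f (V (f t)) (Ici t) t := fun hf t ht =>
    (hf t ⟨ht.1, ht.2.le⟩).mono_of_mem_nhdsWithin
      (mem_of_superset (Icc_mem_nhdsGE ht.2) (Icc_subset_Icc_left ht.1))
  exact ODE_solution_unique (v := fun _ => V) (fun _ => hV)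
    (fun t ht => (hf t ht).continuousWithinAt) (key hf)
    (fun t ht => (hg t ht).continuousWithinAt) (key hg) h

variable [CompleteSpace E]

/-- The length `1 / (K + 1)` does not depend on `x`, so such pieces can be concatenated
indefinitely. -/
lemma exists_short_trajectory (hV : LipschitzWith K V) (x : E) :
    ∃ γ : ℝ → E, γ 0 = x ∧ ∀ t ∈ Icc (0 : ℝ) (1 / (K + 1)),
      HasDerivWithinAt γ (V (γ t)) (Icc (0 : ℝ) (1 / (K + 1))) t := by
  have hT : (0 : ℝ) ≤ 1 / (K + 1) := by positivity
  -- On the ball of radius `‖V x‖ + 1` the field is at most `‖V x‖ + K (‖V x‖ + 1)`; divided by `K +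
  -- 1` this is at most the radius.
  have h : IsPicardLindelof (fun _ => V) (tmin := 0) (tmax := 1 / (K + 1)) ⟨0, left_mem_Icc.2 hT⟩
      x (‖V x‖₊ + 1) 0 (‖V x‖₊ + K * (‖V x‖₊ + 1)) K := by
    refine ⟨fun t _ => hV.lipschitzOnWith, fun y _ => continuousOn_const, fun t _ y hy => ?_, ?_⟩
    · have h1 : ‖V y - V x‖ ≤ K * (‖V x‖ + 1) := by
        rw [← dist_eq_norm]
        refine (hV.dist_le_mul y x).trans (mul_le_mul_of_nonneg_left ?_ K.2)
        simpa using hy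
      have h2 : ‖V y‖ ≤ ‖V x‖ + ‖V y - V x‖ := by
        simpa using norm_add_le (V x) (V y - V x)
      push_cast
      exact h2.trans (by gcongr)
    · have hK : (0 : ℝ) < K + 1 := by positivity
      push_cast
      rw [sub_zero, sub_zero, sub_zero, max_eq_left hT, mul_one_div, div_le_iff₀ hK]
      nlinarith [norm_nonneg (V x)]
  exact h.exists_eq_forall_mem_Icc_hasDerivWithinAt₀

lemma exists_trajectory_Icc (hV : LipschitzWith K V) (x : E) (k : ℕ) :
    ∃ γ : ℝ → E, γ 0 = x ∧ ∀ t ∈ Icc (0 : ℝ) (k * (1 / (K + 1))),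
      HasDerivWithinAt γ (V (γ t)) (Icc (0 : ℝ) (k * (1 / (K + 1)))) t := by
  have hT : (0 : ℝ) ≤ 1 / (K + 1) := by positivity
  set T : ℝ := 1 / (K + 1)
  induction k with
  | zero =>
    obtain ⟨γ, h0, hγ⟩ := exists_short_trajectory hV x
    have hsub : Icc (0 : ℝ) ((0 : ℕ) * T) ⊆ Icc 0 T := Icc_subset_Icc_right (by simpa using hT)
    exact ⟨γ, h0, fun t ht => (hγ t (hsub ht)).mono hsub⟩
  | succ k ih =>
    obtain ⟨γ, h0, hγ⟩ := ih
    obtain ⟨δ, h0', hδ⟩ := exists_short_trajectory hV (γ (k * T))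
    have hk : (0 : ℝ) ≤ k * T := by positivity
    have hunion : Icc (0 : ℝ) ((k + 1 : ℕ) * T) = Icc 0 (k * T) ∪ Icc (k * T) (k * T + T) := by
      rw [Icc_union_Icc_eq_Icc hk (by linarith)]
      congr 1
      push_cast
      ring
    refine ⟨fun t => if t ≤ k * T then γ t else δ (t - k * T), by simp [hk, h0], ?_⟩
    rw [hunion]
    refine hasDerivWithinAt_glue (v := V) isClosed_Icc isClosed_Icc (fun t ht => ht.2)
      (fun t ht => ht.1) (by simp [h0']) hγ fun t ht => ?_
    have h1 : HasDerivWithinAt (fun t => t - k * T) 1 (Icc (k * T) (k * T + T)) t :=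
      (hasDerivWithinAt_id t _).sub_const _
    have hm : MapsTo (fun t => t - k * T) (Icc (k * T) (k * T + T)) (Icc 0 T) := fun s hs =>
      ⟨by simpa using hs.1, by linarith [hs.2]⟩
    simpa [Function.comp_def] using (hδ (t - k * T) (hm ht)).scomp t h1 hm

lemma exists_trajectory_Ici (hV : LipschitzWith K V) (x : E) :
    ∃ γ : ℝ → E, γ 0 = x ∧ ∀ t ∈ Ici (0 : ℝ), HasDerivWithinAt γ (V (γ t)) (Ici 0) t := by
  choose γ h0 hγ using exists_trajectory_Icc hV x
  set T : ℝ := 1 / (K + 1) with hTdef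
  have hT : (0 : ℝ) < T := by positivity
  have hagree : ∀ k l : ℕ, k ≤ l → EqOn (γ k) (γ l) (Icc 0 (k * T)) := fun k l hkl =>
    eqOn_of_trajectory hV (hγ k)
      (fun t ht => by
        have hsub : Icc (0 : ℝ) (k * T) ⊆ Icc 0 (l * T) :=
          Icc_subset_Icc_right (by gcongr)
        exact (hγ l t (hsub ht)).mono hsub) (by rw [h0, h0])
  set N : ℝ → ℕ := fun t => ⌈t / T⌉₊ with hN
  have hNt : ∀ t, t ≤ N t * T := fun t => by
    rw [← div_le_iff₀ hT]; exact Nat.le_ceil _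
  have hX : ∀ k : ℕ, EqOn (fun t => γ (N t) t) (γ k) (Icc 0 (k * T)) := fun k t ht => by
    rcases le_total (N t) k with h | h
    · exact hagree _ _ h ⟨ht.1, hNt t⟩
    · exact (hagree _ _ h ht).symm
  refine ⟨fun t => γ (N t) t, h0 _, fun t ht => ?_⟩
  -- The time `t` may be the right endpoint of the interval with index `N t`, so the derivative is
  -- taken on the next longer one.
  have ht' : t < (N t + 1 : ℕ) * T := by
    push_cast
    linarith [hNt t]
  have hmem : t ∈ Icc (0 : ℝ) ((N t + 1 : ℕ) * T) := ⟨ht, ht'.le⟩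
  have h1 := ((hγ (N t + 1) t hmem).congr (hX _) (hX _ hmem))
  rw [← hX _ hmem] at h1
  refine h1.mono_of_mem_nhdsWithin ?_
  have : Icc (0 : ℝ) ((N t + 1 : ℕ) * T) = Ici 0 ∩ Iic ((N t + 1 : ℕ) * T) := rfl
  rw [this]
  exact inter_mem self_mem_nhdsWithin (mem_nhdsWithin_of_mem_nhds (Iic_mem_nhds ht'))

/-- A Lipschitz vector field has a global flow. -/
theorem exists_flow (hV : LipschitzWith K V) : ∃ Φ : ℝ → E → E,
    (∀ x, Φ 0 x = x) ∧ (∀ t x, HasDerivAt (fun s => Φ s x) (V (Φ t x)) t) ∧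
    (∀ s t x, Φ (s + t) x = Φ s (Φ t x)) ∧
    ∀ t, 0 ≤ t → ∀ x y, dist (Φ t x) (Φ t y) ≤ dist x y * Real.exp (K * t) := by
  -- Negative times are obtained by running `-V` forward and gluing at `0`.
  have hV' : LipschitzWith K (fun x => -V x) := hV.neg
  have hex : ∀ x, ∃ γ : ℝ → E, γ 0 = x ∧ ∀ t, HasDerivAt γ (V (γ t)) t := fun x => by
    obtain ⟨f, hf0, hf⟩ := exists_trajectory_Ici hV' x
    obtain ⟨g, hg0, hg⟩ := exists_trajectory_Ici hV x
    refine ⟨fun t => if t ≤ 0 then f (-t) else g t, by simp [hf0], fun t => ?_⟩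
    have h := hasDerivWithinAt_glue (v := V) (f := fun t => f (-t)) (g := g)
      (s := Iic (0 : ℝ)) (s' := Ici 0) isClosed_Iic isClosed_Ici subset_rfl subset_rfl
      (by simp [hf0, hg0]) (fun t ht => ?_) hg t (by rw [Iic_union_Ici]; trivial)
    · rwa [Iic_union_Ici, hasDerivWithinAt_univ] at h
    · have hm : MapsTo (fun t : ℝ => -t) (Iic 0) (Ici 0) := fun s hs =>
        mem_Ici.2 (neg_nonneg.2 (mem_Iic.1 hs))
      have h1 : HasDerivWithinAt (fun t : ℝ => -t) (-1) (Iic 0) t :=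
        (hasDerivAt_neg t).hasDerivWithinAt
      simpa [Function.comp_def] using (hf (-t) (hm ht)).scomp t h1 hm
  choose γ h0 hγ using hex
  refine ⟨fun t x => γ x t, h0, fun t x => hγ x t, fun s t x => ?_, fun t ht x y => ?_⟩
  · have h1 : (fun s => γ x (s + t)) = γ (γ x t) := by
      refine ODE_solution_unique_univ (v := fun _ => V) (s := fun _ => univ) (t₀ := 0)
        (fun _ => hV.lipschitzOnWith) (fun s => ⟨?_, trivial⟩) (fun s => ⟨hγ _ s, trivial⟩)
        (by simp [h0])
      exact (hγ x (s + t)).comp_add_const s t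
    exact congrFun h1 s
  · have := dist_le_of_trajectories_ODE (v := fun _ => V) (a := 0) (b := t) (f := γ x) (g := γ y)
      (fun _ => hV) (fun s _ => (hγ x s).continuousAt.continuousWithinAt)
      (fun s _ => (hγ x s).hasDerivWithinAt)
      (fun s _ => (hγ y s).continuousAt.continuousWithinAt)
      (fun s _ => (hγ y s).hasDerivWithinAt) (δ := dist x y) (by rw [h0, h0]) t ⟨ht, le_rfl⟩
    simpa using this

end Flow

/-! ## Solutions near the origin -/

section NearOrigin

/-- A function that is nonpositive initially and does not increase where it is positive stays
nonpositive. -/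
lemma nonpos_of_deriv_nonpos_of_pos {f f' : ℝ → ℝ}
    (hf : ∀ t, 0 ≤ t → HasDerivWithinAt f (f' t) (Ici 0) t)
    (h0 : f 0 ≤ 0) (h : ∀ t, 0 ≤ t → 0 < f t → f' t ≤ 0) {t : ℝ} (ht : 0 ≤ t) : f t ≤ 0 := by
  -- The barrier `ε (1 + x) / (1 + t)` is positive and strictly increasing. Where `f` touches it,
  -- `f` is positive, so its slope is at most zero and it cannot cross.
  refine le_of_forall_pos_le_add fun ε hε => ?_
  have hε' : 0 < ε / (1 + t) := by positivity
  have hB : ∀ x : ℝ, HasDerivAt (fun x => ε / (1 + t) * (1 + x)) (ε / (1 + t)) x := fun x => by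
    simpa using ((hasDerivAt_id x).const_add 1).const_mul (ε / (1 + t))
  have := image_le_of_deriv_right_lt_deriv_boundary (a := 0) (b := t) (f := f) (f' := f')
    (fun x hx => (hf x hx.1).continuousWithinAt.mono fun y hy => hy.1)
    (fun x hx => (hf x hx.1).mono (Ici_subset_Ici.2 hx.1))
    (B := fun x => ε / (1 + t) * (1 + x)) (B' := fun _ => ε / (1 + t)) (by simp; linarith) hB
    (fun x hx hfx => (h x hx.1 (by
      rw [hfx]; have := hx.1; positivity)).trans_lt hε') (right_mem_Icc.2 ht)
  refine this.trans_eq ?_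
  field_simp
  simp

variable {m : ℕ} {n : Fin m → ℕ} {p q : Fin m → ℤ}

/-- The vector field of the system. -/
def field (n : Fin m → ℕ) (p q : Fin m → ℤ) (y : Fin m → ℝ) (i : Fin m) : ℝ :=
  -(y i * rate n p q i y)

lemma contDiff_field : ContDiff ℝ ∞ (field n p q) := by
  refine contDiff_pi.2 fun i => ?_
  unfold field rate energy
  fun_prop

/-- Since `p i ≥ 1`, the quadratic terms give at most `-2 ∑ yᵢ²`. The cubic terms are at most `C S ∑
yᵢ²` with `S = ∑ yᵢ`, and smallness makes `C S ≤ 1`. -/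
lemma sum_field_le (hp : ∀ i, 0 < p i) {y : Fin m → ℝ} (hy : ∀ i, 0 ≤ y i)
    (hs : (∑ i, ((n i : ℝ) + 1) * (q i : ℝ) ^ 2) * ∑ i, y i ≤ 1) :
    ∑ i, field n p q y i ≤ -∑ i, y i ^ 2 := by
  set C := ∑ i, ((n i : ℝ) + 1) * (q i : ℝ) ^ 2 with hC
  set S := ∑ i, y i with hS
  have hyS : ∀ i, y i ≤ S := fun i =>
    Finset.single_le_sum (f := y) (fun j _ => hy j) (Finset.mem_univ i)
  have hS0 : 0 ≤ S := Finset.sum_nonneg fun i _ => hy i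
  have h1 : ∀ i, field n p q y i ≤ -2 * y i ^ 2 + S * ((q i : ℝ) ^ 2 * y i ^ 2) +
      y i * energy n q y := fun i => by
    have hpi : (1 : ℝ) ≤ p i := by exact_mod_cast hp i
    rw [field, rate]
    have h2 : y i * ((q i : ℝ) ^ 2 * y i ^ 2) ≤ S * ((q i : ℝ) ^ 2 * y i ^ 2) :=
      mul_le_mul_of_nonneg_right (hyS i) (by positivity)
    have h3 : y i ^ 2 ≤ p i * y i ^ 2 := le_mul_of_one_le_left (sq_nonneg _) hpi
    linarith
  have h4 : ∀ i, ((n i : ℝ) + 1) * (q i : ℝ) ^ 2 * y i ^ 2 ≤ C * y i ^ 2 := fun i =>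
    mul_le_mul_of_nonneg_right (Finset.single_le_sum
      (f := fun i => ((n i : ℝ) + 1) * (q i : ℝ) ^ 2) (fun j _ => by positivity)
      (Finset.mem_univ i)) (sq_nonneg _)
  have h5 : 0 ≤ ∑ i, y i ^ 2 := Finset.sum_nonneg fun i _ => sq_nonneg _
  calc ∑ i, field n p q y i
      ≤ ∑ i, (-2 * y i ^ 2 + S * ((q i : ℝ) ^ 2 * y i ^ 2) + y i * energy n q y) :=
        Finset.sum_le_sum fun i _ => h1 i
    _ = -2 * ∑ i, y i ^ 2 + S * ∑ i, ((n i : ℝ) + 1) * (q i : ℝ) ^ 2 * y i ^ 2 := by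
        rw [Finset.sum_add_distrib, Finset.sum_add_distrib, ← Finset.mul_sum, ← Finset.mul_sum,
          ← Finset.sum_mul, add_assoc, energy, ← mul_add, ← Finset.sum_add_distrib]
        congr 2
        exact Finset.sum_congr rfl fun i _ => by ring
    _ ≤ -2 * ∑ i, y i ^ 2 + S * ∑ i, C * y i ^ 2 := by
        refine add_le_add_right (mul_le_mul_of_nonneg_left ?_ hS0) _
        exact Finset.sum_le_sum fun i _ => h4 i
    _ = -2 * ∑ i, y i ^ 2 + (C * S) * ∑ i, y i ^ 2 := by rw [← Finset.mul_sum]; ring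
    _ ≤ -2 * ∑ i, y i ^ 2 + 1 * ∑ i, y i ^ 2 := by gcongr
    _ = -∑ i, y i ^ 2 := by ring

lemma isSolution_iff {Y : ℝ → Fin m → ℝ} : IsSolution n p q Y ↔
    ∀ u, 0 ≤ u → HasDerivWithinAt Y (field n p q (Y u)) (Ici 0) u := by
  simp only [IsSolution, hasDerivWithinAt_pi]
  rfl

/-- Small nonnegative initial values have nonnegative solutions for all times. -/
theorem exists_solution_near_zero (hp : ∀ i, 0 < p i) {c₀ : ℝ} (hc₀ : 0 < c₀)
    (hc : (∑ i, ((n i : ℝ) + 1) * (q i : ℝ) ^ 2) * (m * c₀) ≤ 1) {y : Fin m → ℝ}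
    (hy : ∀ i, 0 ≤ y i) (hys : ∑ i, y i ≤ c₀) :
    ∃ Y : ℝ → Fin m → ℝ, IsSolution n p q Y ∧ Y 0 = y ∧ ∀ u, 0 ≤ u → ∀ i, 0 ≤ Y u i := by
  -- Clamping to the box `[0, c₀]^m` makes the field globally Lipschitz. The trajectory of the
  -- clamped field stays where `κ` is the identity, so it solves the original system.
  set κ : (Fin m → ℝ) → Fin m → ℝ := fun y i => max 0 (min (y i) c₀) with hκ
  have hκ0 : ∀ y i, 0 ≤ κ y i := fun y i => le_max_left _ _
  have hκc : ∀ y i, κ y i ≤ c₀ := fun y i => max_le hc₀.le (min_le_right _ _)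
  have hκL : LipschitzWith 1 κ := LipschitzWith.of_dist_le_mul fun y z => by
    rw [NNReal.coe_one, one_mul]
    refine (dist_pi_le_iff dist_nonneg).2 fun i => ?_
    refine le_trans ?_ (dist_le_pi_dist y z i)
    simp only [hκ, Real.dist_eq, max_comm (0 : ℝ)]
    refine (abs_max_sub_max_le_abs _ _ _).trans ((abs_min_sub_min_le_max _ _ _ _).trans ?_)
    simp
  obtain ⟨K, hK⟩ := (contDiff_field (n := n) (p := p) (q := q)).contDiffOn.exists_lipschitzOnWith
    (by simp) (convex_Icc (0 : Fin m → ℝ) fun _ => c₀) isCompact_Icc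
  have hV : LipschitzWith (K * 1) (field n p q ∘ κ) := lipschitzOnWith_univ.1
    (hK.comp hκL.lipschitzOnWith fun y _ => ⟨fun i => hκ0 y i, fun i => hκc y i⟩)
  obtain ⟨Φ, hΦ0, hΦ, -⟩ := exists_flow hV
  have hd : ∀ u i, HasDerivAt (fun s => Φ s y i) (field n p q (κ (Φ u y)) i) u := fun u i =>
    hasDerivAt_pi.1 (hΦ u y) i
  have hnn : ∀ u, 0 ≤ u → ∀ i, 0 ≤ Φ u y i := fun u hu i => by
    have := nonpos_of_deriv_nonpos_of_pos (f := fun s => -Φ s y i)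
      (fun t _ => (hd t i).neg.hasDerivWithinAt) (by simp [hΦ0, hy i])
      (fun t _ hpos => ?_) hu
    · simpa using this
    -- A negative coordinate is clamped to zero, where its own component of the field vanishes, so
    -- it cannot decrease further.
    · have h0 : κ (Φ t y) i = 0 := by
        simp only [hκ]
        exact max_eq_left ((min_le_left _ _).trans (neg_pos.1 hpos).le)
      simp [field, h0]
  have hsum : ∀ u, 0 ≤ u → ∑ i, Φ u y i ≤ c₀ := fun u hu => by
    have := nonpos_of_deriv_nonpos_of_pos (f := fun s => (∑ i, Φ s y i) - c₀)
      (fun t _ => ((HasDerivAt.fun_sum fun i _ => hd t i).sub_const c₀).hasDerivWithinAt)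
      (by simpa [hΦ0] using hys) (fun t _ _ => ?_) hu
    · linarith
    -- Only `m * c₀` is known to bound the sum of the clamped coordinates, whence the factor `m` in
    -- the hypothesis.
    · refine (sum_field_le hp (hκ0 _) ?_).trans
        (neg_nonpos.2 (Finset.sum_nonneg fun i _ => sq_nonneg _))
      refine le_trans (mul_le_mul_of_nonneg_left ?_
        (Finset.sum_nonneg fun i _ => by positivity)) hc
      simpa using Finset.sum_le_sum fun i (_ : i ∈ Finset.univ) => hκc (Φ t y) i
  refine ⟨fun u => Φ u y, isSolution_iff.2 fun u hu => ?_, hΦ0 y, hnn⟩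
  have hfix : κ (Φ u y) = Φ u y := funext fun i => by
    have h1 : Φ u y i ≤ c₀ := le_trans (Finset.single_le_sum (f := fun i => Φ u y i)
      (fun j _ => hnn u hu j) (Finset.mem_univ i)) (hsum u hu)
    simp only [hκ]
    rw [min_eq_left h1, max_eq_right (hnn u hu i)]
  have := (hΦ u y).hasDerivWithinAt (s := Ici 0)
  rwa [Function.comp_apply, hfix] at this

/-- Small nonnegative solutions tend to the origin. -/
theorem tendsto_zero_of_small (hp : ∀ i, 0 < p i) {c₀ : ℝ} (hc₀ : 0 < c₀)
    (hc : (∑ i, ((n i : ℝ) + 1) * (q i : ℝ) ^ 2) * c₀ ≤ 1) {Y : ℝ → Fin m → ℝ}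
    (hY : IsSolution n p q Y) (hnn : ∀ u, 0 ≤ u → ∀ i, 0 ≤ Y u i) (hs : ∑ i, Y 0 i ≤ c₀) :
    Tendsto Y atTop (𝓝 0) := by
  set C := ∑ i, ((n i : ℝ) + 1) * (q i : ℝ) ^ 2 with hC
  have hC0 : 0 ≤ C := Finset.sum_nonneg fun i _ => by positivity
  set S : ℝ → ℝ := fun u => ∑ i, Y u i with hS
  have hd : ∀ u, 0 ≤ u → HasDerivWithinAt S (∑ i, field n p q (Y u) i) (Ici 0) u := fun u hu =>
    HasDerivWithinAt.fun_sum fun i _ => hY u hu i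
  have hcont : ContinuousOn S (Ici 0) := fun u hu => (hd u hu).continuousWithinAt
  -- At the level `S = c₀` the derivative is strictly negative, because not all coordinates vanish
  -- there.
  have hle : ∀ u, 0 ≤ u → S u ≤ c₀ := fun u hu => by
    refine image_le_of_deriv_right_lt_deriv_boundary (a := 0) (b := u)
      (hcont.mono fun y hy => hy.1) (fun x hx => (hd x hx.1).mono (Ici_subset_Ici.2 hx.1))
      (B := fun _ => c₀) (B' := fun _ => 0) hs (fun x => hasDerivAt_const x c₀)
      (fun x hx hSx => ?_) (right_mem_Icc.2 hu)
    refine (sum_field_le hp (hnn x hx.1) ?_).trans_lt (neg_lt_zero.2 ?_)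
    · have : ∑ i, Y x i = c₀ := hSx
      rw [this]; exact hc
    · refine (Finset.sum_nonneg fun i _ => sq_nonneg _).lt_of_ne' fun h0 => ?_
      have h1 : ∀ i, Y x i = 0 := fun i => by
        simpa using (Finset.sum_eq_zero_iff_of_nonneg fun i _ => sq_nonneg (Y x i)).1 h0 i
          (Finset.mem_univ i)
      have h2 : S x = 0 := Finset.sum_eq_zero fun i _ => h1 i
      linarith
  have hder : ∀ u, 0 ≤ u → ∑ i, field n p q (Y u) i ≤ -∑ i, Y u i ^ 2 := fun u hu =>
    sum_field_le hp (hnn u hu) ((mul_le_mul_of_nonneg_left (hle u hu) hC0).trans hc)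
  have hint : ∀ {f : ℝ → ℝ} {f' u}, HasDerivWithinAt f f' (Ici 0) u →
      HasDerivWithinAt f f' (interior (Ici (0 : ℝ))) u := fun h => h.mono interior_subset
  have hmem : ∀ {u : ℝ}, u ∈ interior (Ici (0 : ℝ)) → 0 ≤ u := fun h => interior_subset h
  have hanti : AntitoneOn S (Ici 0) := antitoneOn_of_hasDerivWithinAt_nonpos (convex_Ici 0) hcont
    (fun u hu => hint (hd u (hmem hu))) fun u hu => (hder u (hmem hu)).trans
      (neg_nonpos.2 (Finset.sum_nonneg fun i _ => sq_nonneg _))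
  have hS0 : ∀ u, 0 ≤ u → 0 ≤ S u := fun u hu => Finset.sum_nonneg fun i _ => hnn u hu i
  -- If `S ≥ δ` throughout, Cauchy-Schwarz gives `∑ Yᵢ² ≥ δ² / m`, so `S` decreases at least
  -- linearly and falls below `δ` by time `S 0 / (δ² / m)`.
  have hsmall : ∀ δ > 0, ∃ u, 0 ≤ u ∧ S u < δ := by
    intro δ hδ
    by_contra! hcon
    have hm : 0 < (m : ℝ) := by
      have h1 := hcon 0 le_rfl
      rcases Nat.eq_zero_or_pos m with rfl | h
      · simp [hS] at h1; linarith
      · exact_mod_cast h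
    have hsq : ∀ u, 0 ≤ u → δ ^ 2 / m ≤ ∑ i, Y u i ^ 2 := fun u hu => by
      have h1 := sq_sum_le_card_mul_sum_sq (s := Finset.univ) (f := Y u)
      rw [Finset.card_univ, Fintype.card_fin] at h1
      rw [div_le_iff₀ hm, mul_comm]
      exact le_trans (pow_le_pow_left₀ hδ.le (hcon u hu) 2) h1
    have hlin : ∀ u, HasDerivAt (fun u : ℝ => δ ^ 2 / m * u) (δ ^ 2 / m) u := fun u => by
      simpa using (hasDerivAt_id u).const_mul (δ ^ 2 / m)
    have h2 : AntitoneOn (fun u => S u + δ ^ 2 / m * u) (Ici 0) :=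
      antitoneOn_of_hasDerivWithinAt_nonpos (convex_Ici 0)
        (hcont.add (by fun_prop))
        (fun u hu => hint ((hd u (hmem hu)).add (hlin u).hasDerivWithinAt)) fun u hu => by
          linarith [hder u (hmem hu), hsq u (hmem hu)]
    have hpos : 0 < δ ^ 2 / m := by positivity
    have hu : 0 ≤ S 0 / (δ ^ 2 / m) := div_nonneg (hS0 0 le_rfl) hpos.le
    have h3 := h2 (mem_Ici.2 le_rfl) (mem_Ici.2 hu) hu
    simp only [mul_zero, add_zero, mul_div_cancel₀ _ hpos.ne'] at h3
    linarith [hcon _ hu]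
  have hST : Tendsto S atTop (𝓝 0) := by
    refine tendsto_order.2 ⟨fun a ha => ?_, fun a ha => ?_⟩
    · filter_upwards [eventually_ge_atTop 0] with u hu using ha.trans_le (hS0 u hu)
    · obtain ⟨u₀, hu₀, h⟩ := hsmall a ha
      filter_upwards [eventually_ge_atTop u₀] with u hu
      exact (hanti hu₀ (hu₀.trans hu : (0 : ℝ) ≤ u) hu).trans_lt h
  refine tendsto_pi_nhds.2 fun i => squeeze_zero' ?_ ?_ hST
  · filter_upwards [eventually_ge_atTop 0] with u hu using hnn u hu i
  · filter_upwards [eventually_ge_atTop 0] with u hu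
    exact Finset.single_le_sum (f := fun i => Y u i) (fun j _ => hnn u hu j) (Finset.mem_univ i)

end NearOrigin

/-! ## The stable set of a saddle point -/

section Saddle

open scoped RealInnerProductSpace NNReal

variable {E : Type*} [NormedAddCommGroup E] [InnerProductSpace ℝ E]

/-- The linear vector field `A` expands the direction of the unit vector `e` and contracts the
complementary directions, at rates at least `c`. -/
structure IsSaddle (A : E →L[ℝ] E) (e : E) (c : ℝ) : Prop where
  unit : ‖e‖ = 1
  pos : 0 < c
  expand : ∀ x, 2 * c * ‖x‖ ^ 2 ≤ 4 * ⟪e, x⟫ * ⟪e, A x⟫ - 2 * ⟪x, A x⟫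
  contract : ∀ x, 2 * ⟪x, A x⟫ - 2 * ⟪e, x⟫ * ⟪e, A x⟫ ≤ -2 * c * (‖x‖ ^ 2 - ⟪e, x⟫ ^ 2)

variable {A : E →L[ℝ] E} {e : E} {c : ℝ}

namespace IsSaddle

lemma abs_inner_le (h : IsSaddle A e c) (x : E) : |⟪e, x⟫| ≤ ‖x‖ := by
  simpa [h.unit] using abs_real_inner_le_norm e x

/-- The right side is the rate of change of `2⟪e, x⟫² - ‖x‖²` at velocity `v`. The error costs at
most `(4 + 2) * c / 8` of the available `2 * c`, leaving more than `c`. -/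
lemma expand_of_norm_sub_le (h : IsSaddle A e c) {x v : E} (hv : ‖v - A x‖ ≤ c / 8 * ‖x‖) :
    c * ‖x‖ ^ 2 ≤ 4 * ⟪e, x⟫ * ⟪e, v⟫ - 2 * ⟪x, v⟫ := by
  obtain ⟨w, rfl⟩ : ∃ w, v = A x + w := ⟨v - A x, by abel⟩
  rw [add_sub_cancel_left] at hv
  have h1 := h.expand x
  have h2 : |⟪e, x⟫ * ⟪e, w⟫| ≤ ‖x‖ * (c / 8 * ‖x‖) := by
    rw [abs_mul]
    exact mul_le_mul (h.abs_inner_le x) ((h.abs_inner_le w).trans hv) (abs_nonneg _)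
      (norm_nonneg _)
  have h3 : |⟪x, w⟫| ≤ ‖x‖ * (c / 8 * ‖x‖) :=
    (abs_real_inner_le_norm x w).trans (mul_le_mul_of_nonneg_left hv (norm_nonneg _))
  rw [inner_add_right, inner_add_right]
  have h4 := (abs_le.1 h2).1
  have h5 := (abs_le.1 h3).2
  nlinarith [h.pos, sq_nonneg ‖x‖, mul_nonneg h.pos.le (sq_nonneg ‖x‖)]

/-- The error is at most `c / 2 * ‖x‖ ^ 2`. In the cone `‖x‖²` is at most twice the squared
transverse norm, so half of the rate `2 * c` remains. -/
lemma contract_of_norm_sub_le (h : IsSaddle A e c) {x v : E} (hv : ‖v - A x‖ ≤ c / 8 * ‖x‖)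
    (hx : 2 * ⟪e, x⟫ ^ 2 - ‖x‖ ^ 2 ≤ 0) :
    2 * ⟪x, v⟫ - 2 * ⟪e, x⟫ * ⟪e, v⟫ ≤ -c * (‖x‖ ^ 2 - ⟪e, x⟫ ^ 2) := by
  obtain ⟨w, rfl⟩ : ∃ w, v = A x + w := ⟨v - A x, by abel⟩
  rw [add_sub_cancel_left] at hv
  have h1 := h.contract x
  have h2 : |⟪e, x⟫ * ⟪e, w⟫| ≤ ‖x‖ * (c / 8 * ‖x‖) := by
    rw [abs_mul]
    exact mul_le_mul (h.abs_inner_le x) ((h.abs_inner_le w).trans hv) (abs_nonneg _)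
      (norm_nonneg _)
  have h3 : |⟪x, w⟫| ≤ ‖x‖ * (c / 8 * ‖x‖) :=
    (abs_real_inner_le_norm x w).trans (mul_le_mul_of_nonneg_left hv (norm_nonneg _))
  rw [inner_add_right, inner_add_right]
  have h4 := (abs_le.1 h2).1
  have h5 := (abs_le.1 h3).2
  nlinarith [mul_nonneg h.pos.le (sub_nonneg.2 hx)]

end IsSaddle

/-- The flow `Φ` of a vector field which is a small perturbation of a linear saddle. -/
structure IsSaddleFlow (A : E →L[ℝ] E) (e : E) (c : ℝ) (W : E → E) (Φ : ℝ → E → E) : Prop where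
  saddle : IsSaddle A e c
  close : ∀ x y, ‖W x - W y - A (x - y)‖ ≤ c / 8 * ‖x - y‖
  zero : ∀ t, Φ t 0 = 0
  init : ∀ x, Φ 0 x = x
  deriv : ∀ t x, HasDerivAt (fun s => Φ s x) (W (Φ t x)) t
  add : ∀ s t x, Φ (s + t) x = Φ s (Φ t x)
  cont : ContinuousOn (fun p : ℝ × E => Φ p.1 p.2) (Ici 0 ×ˢ univ)

/-- The points whose trajectories remain in the cone around the contracted directions. -/
def stableSet (e : E) (Φ : ℝ → E → E) : Set E :=
  {x | ∀ t, 0 ≤ t → 2 * ⟪e, Φ t x⟫ ^ 2 - ‖Φ t x‖ ^ 2 ≤ 0}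

namespace IsSaddleFlow

variable {W : E → E} {Φ : ℝ → E → E}

lemma hasDerivAt_inner {γ : ℝ → E} {v : E} {t : ℝ} (hγ : HasDerivAt γ v t) :
    HasDerivAt (fun s => ⟪e, γ s⟫) ⟪e, v⟫ t := by
  simpa using (hasDerivAt_const t e).inner ℝ hγ

/-- The bound `close` concerns differences, so the expansion estimate applies to any two
trajectories and not merely to one compared with the rest point. -/
lemma monotone_cone (h : IsSaddleFlow A e c W Φ) (x y : E) :
    Monotone fun t => 2 * ⟪e, Φ t x - Φ t y⟫ ^ 2 - ‖Φ t x - Φ t y‖ ^ 2 := by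
  have hd : ∀ t, HasDerivAt (fun t => 2 * ⟪e, Φ t x - Φ t y⟫ ^ 2 - ‖Φ t x - Φ t y‖ ^ 2)
      (4 * ⟪e, Φ t x - Φ t y⟫ * ⟪e, W (Φ t x) - W (Φ t y)⟫ -
        2 * ⟪Φ t x - Φ t y, W (Φ t x) - W (Φ t y)⟫) t := fun t => by
    have h1 : HasDerivAt (fun s => Φ s x - Φ s y) (W (Φ t x) - W (Φ t y)) t :=
      (h.deriv t x).sub (h.deriv t y)
    refine ((((hasDerivAt_inner (e := e) h1).pow 2).const_mul 2).sub h1.norm_sq).congr_deriv ?_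
    simp
    ring
  refine monotone_of_hasDerivAt_nonneg hd fun t => ?_
  exact le_trans (mul_nonneg h.saddle.pos.le (sq_nonneg _))
    (h.saddle.expand_of_norm_sub_le (h.close _ _))

lemma transverse_le (h : IsSaddleFlow A e c W Φ) {x : E} (hx : x ∈ stableSet e Φ) {t : ℝ}
    (ht : 0 ≤ t) : ‖Φ t x‖ ^ 2 - ⟪e, Φ t x⟫ ^ 2 ≤
      (‖x‖ ^ 2 - ⟪e, x⟫ ^ 2) * Real.exp (-(c * t)) := by
  have hd : ∀ t, HasDerivAt (fun t => (‖Φ t x‖ ^ 2 - ⟪e, Φ t x⟫ ^ 2) * Real.exp (c * t))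
      ((2 * ⟪Φ t x, W (Φ t x)⟫ - 2 * ⟪e, Φ t x⟫ * ⟪e, W (Φ t x)⟫) * Real.exp (c * t) +
        (‖Φ t x‖ ^ 2 - ⟪e, Φ t x⟫ ^ 2) * (Real.exp (c * t) * c)) t := fun t => by
    have h1 := h.deriv t x
    refine ((h1.norm_sq.sub ((hasDerivAt_inner (e := e) h1).pow 2)).mul
      (((hasDerivAt_id t).const_mul c).exp)).congr_deriv ?_
    simp
  have hanti : AntitoneOn (fun t => (‖Φ t x‖ ^ 2 - ⟪e, Φ t x⟫ ^ 2) * Real.exp (c * t)) (Ici 0) :=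
    antitoneOn_of_hasDerivWithinAt_nonpos (convex_Ici 0)
      (fun t _ => (hd t).continuousAt.continuousWithinAt) (fun t _ => (hd t).hasDerivWithinAt)
      fun t ht => by
        have ht' : 0 ≤ t := interior_subset ht
        have h0 : W 0 = 0 := by
          have := (h.deriv 0 0).unique (by simpa [h.zero] using hasDerivAt_const (0 : ℝ) (0 : E))
          simpa [h.init] using this
        have h1 := h.close (Φ t x) 0
        rw [h0, sub_zero, sub_zero] at h1
        have h2 := h.saddle.contract_of_norm_sub_le h1 (hx t ht')
        nlinarith [Real.exp_pos (c * t)]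
  have h1 := hanti (mem_Ici.2 le_rfl) (mem_Ici.2 ht) ht
  simp only [h.init, mul_zero, Real.exp_zero, mul_one] at h1
  rw [Real.exp_neg, ← div_eq_mul_inv, le_div_iff₀ (Real.exp_pos _)]
  exact h1

lemma norm_sq_le (h : IsSaddleFlow A e c W Φ) {x : E} (hx : x ∈ stableSet e Φ) {t : ℝ}
    (ht : 0 ≤ t) : ‖Φ t x‖ ^ 2 ≤ 2 * (‖x‖ ^ 2 - ⟪e, x⟫ ^ 2) * Real.exp (-(c * t)) := by
  have h1 := h.transverse_le hx ht
  have h2 := hx t ht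
  linarith

lemma tendsto_zero (h : IsSaddleFlow A e c W Φ) {x : E} (hx : x ∈ stableSet e Φ) :
    Tendsto (fun t => Φ t x) atTop (𝓝 0) := by
  rw [tendsto_zero_iff_norm_tendsto_zero]
  have h1 : Tendsto (fun t => ‖Φ t x‖ ^ 2) atTop (𝓝 0) := by
    have h2 : Tendsto (fun t : ℝ => 2 * (‖x‖ ^ 2 - ⟪e, x⟫ ^ 2) * Real.exp (-(c * t))) atTop
        (𝓝 (2 * (‖x‖ ^ 2 - ⟪e, x⟫ ^ 2) * 0)) :=
      (Real.tendsto_exp_neg_atTop_nhds_zero.comp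
        (tendsto_id.const_mul_atTop h.saddle.pos)).const_mul _
    rw [mul_zero] at h2
    refine squeeze_zero' (Eventually.of_forall fun t => sq_nonneg _) ?_ h2
    filter_upwards [eventually_ge_atTop 0] with t ht using h.norm_sq_le hx ht
  simpa using h1.sqrt

/-- The stable set is a Lipschitz graph. -/
lemma sub_mem_cone (h : IsSaddleFlow A e c W Φ) {x y : E} (hx : x ∈ stableSet e Φ)
    (hy : y ∈ stableSet e Φ) : 2 * ⟪e, x - y⟫ ^ 2 - ‖x - y‖ ^ 2 ≤ 0 := by
  have h1 : Tendsto (fun t => 2 * ⟪e, Φ t x - Φ t y⟫ ^ 2 - ‖Φ t x - Φ t y‖ ^ 2) atTop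
      (𝓝 (2 * ⟪e, (0 : E) - 0⟫ ^ 2 - ‖(0 : E) - 0‖ ^ 2)) := by
    have h2 := (h.tendsto_zero hx).sub (h.tendsto_zero hy)
    exact (((tendsto_const_nhds.inner h2).pow 2).const_mul 2).sub (h2.norm.pow 2)
  -- Both trajectories tend to the origin, so a nondecreasing function with limit `0` is nonpositive
  -- at time `0`.
  have h3 := (h.monotone_cone x y).ge_of_tendsto h1 0
  simpa [h.init] using h3

lemma continuous_apply (h : IsSaddleFlow A e c W Φ) {t : ℝ} (ht : 0 ≤ t) : Continuous (Φ t) :=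
  h.cont.comp_continuous (f := fun x => (t, x)) (by fun_prop) fun x => ⟨ht, trivial⟩

lemma inner_ne_zero_of_cone {x : E} (hx : 0 < 2 * ⟪e, x⟫ ^ 2 - ‖x‖ ^ 2) : ⟪e, x⟫ ≠ 0 := by
  intro h0
  rw [h0] at hx
  nlinarith [sq_nonneg ‖x‖]

/-- A trajectory that enters the open cone around `e` stays there, and this cone does not meet `⟪e,
·⟫ = 0`; so it cannot pass from one half to the other. -/
lemma not_both_sides (h : IsSaddleFlow A e c W Φ) {x : E} {t₁ t₂ : ℝ}
    (h₁ : 0 < 2 * ⟪e, Φ t₁ x⟫ ^ 2 - ‖Φ t₁ x‖ ^ 2) (h₂ : 0 < 2 * ⟪e, Φ t₂ x⟫ ^ 2 - ‖Φ t₂ x‖ ^ 2)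
    (hp : 0 < ⟪e, Φ t₁ x⟫) (hn : ⟪e, Φ t₂ x⟫ < 0) : False := by
  have hmono : Monotone fun t => 2 * ⟪e, Φ t x⟫ ^ 2 - ‖Φ t x‖ ^ 2 := by
    simpa [h.zero] using h.monotone_cone x 0
  have hc : Continuous fun t => ⟪e, Φ t x⟫ :=
    continuous_iff_continuousAt.2 fun t => (hasDerivAt_inner (h.deriv t x)).continuousAt
  have hz : ∃ t ∈ uIcc t₁ t₂, ⟪e, Φ t x⟫ = 0 :=
    intermediate_value_uIcc hc.continuousOn (by
      rw [uIcc_of_ge (hn.trans hp).le]; exact ⟨hn.le, hp.le⟩)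
  obtain ⟨t, ht, h0⟩ := hz
  refine inner_ne_zero_of_cone (e := e) (x := Φ t x) ?_ h0
  rcases le_total t₁ t₂ with hle | hle
  · rw [uIcc_of_le hle] at ht
    exact h₁.trans_le (hmono ht.1)
  · rw [uIcc_of_ge hle] at ht
    exact h₂.trans_le (hmono ht.1)

/-- Otherwise every point of the line `z + ℝ e` eventually enters one half of the expanding cone.
The points entering either half form open sets, nonempty because far points of the line start inside
the cone, and disjoint by `not_both_sides`; this contradicts connectedness. -/
lemma exists_mem_stableSet (h : IsSaddleFlow A e c W Φ) {z : E} (hz : ⟪e, z⟫ = 0) :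
    ∃ r : ℝ, z + r • e ∈ stableSet e Φ := by
  by_contra! hcon
  have hee : ⟪e, e⟫ = 1 := by rw [real_inner_self_eq_norm_sq, h.saddle.unit, one_pow]
  have hzr : ∀ r : ℝ, ⟪e, z + r • e⟫ = r := fun r => by
    rw [inner_add_right, inner_smul_right, hz, hee]; ring
  have hnorm : ∀ r : ℝ, ‖z + r • e‖ ^ 2 = ‖z‖ ^ 2 + r ^ 2 := fun r => by
    rw [norm_add_sq_real, inner_smul_right, real_inner_comm, hz, norm_smul, h.saddle.unit]
    simp
  have hcont : ∀ t, 0 ≤ t → Continuous fun r : ℝ => Φ t (z + r • e) := fun t ht =>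
    (h.continuous_apply ht).comp (by fun_prop)
  have hopen : ∀ σ : ℝ, IsOpen {r : ℝ | ∃ t, 0 ≤ t ∧
      0 < 2 * ⟪e, Φ t (z + r • e)⟫ ^ 2 - ‖Φ t (z + r • e)‖ ^ 2 ∧
      0 < σ * ⟪e, Φ t (z + r • e)⟫} := fun σ => by
    have : {r : ℝ | ∃ t, 0 ≤ t ∧ 0 < 2 * ⟪e, Φ t (z + r • e)⟫ ^ 2 - ‖Φ t (z + r • e)‖ ^ 2 ∧
        0 < σ * ⟪e, Φ t (z + r • e)⟫} = ⋃ t ∈ Ici (0 : ℝ), {r : ℝ |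
        0 < 2 * ⟪e, Φ t (z + r • e)⟫ ^ 2 - ‖Φ t (z + r • e)‖ ^ 2} ∩
        {r : ℝ | 0 < σ * ⟪e, Φ t (z + r • e)⟫} := by
      ext r; simp [and_left_comm]
    rw [this]
    refine isOpen_biUnion fun t ht => ?_
    have hi : Continuous fun r : ℝ => ⟪e, Φ t (z + r • e)⟫ := continuous_const.inner (hcont t ht)
    exact (isOpen_lt continuous_const
      (((hi.pow 2).const_mul 2).sub ((hcont t ht).norm.pow 2))).inter
      (isOpen_lt continuous_const (hi.const_mul σ))
  have hmem : ∀ σ r : ℝ, ‖z‖ < |r| → 0 < σ * r → r ∈ {r : ℝ | ∃ t, 0 ≤ t ∧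
      0 < 2 * ⟪e, Φ t (z + r • e)⟫ ^ 2 - ‖Φ t (z + r • e)‖ ^ 2 ∧
      0 < σ * ⟪e, Φ t (z + r • e)⟫} := fun σ r hr hσ => by
    refine ⟨0, le_rfl, ?_, ?_⟩
    · rw [h.init, hzr, hnorm]
      have := pow_lt_pow_left₀ hr (norm_nonneg z) two_ne_zero
      rw [sq_abs] at this
      linarith
    · rwa [h.init, hzr]
  have hcov : (univ : Set ℝ) ⊆ {r : ℝ | ∃ t, 0 ≤ t ∧
      0 < 2 * ⟪e, Φ t (z + r • e)⟫ ^ 2 - ‖Φ t (z + r • e)‖ ^ 2 ∧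
      0 < (1 : ℝ) * ⟪e, Φ t (z + r • e)⟫} ∪ {r : ℝ | ∃ t, 0 ≤ t ∧
      0 < 2 * ⟪e, Φ t (z + r • e)⟫ ^ 2 - ‖Φ t (z + r • e)‖ ^ 2 ∧
      0 < (-1 : ℝ) * ⟪e, Φ t (z + r • e)⟫} := fun r _ => by
    have h1 := hcon r
    simp only [stableSet, mem_ofPred_eq, not_forall, not_le] at h1
    obtain ⟨t, ht, h2⟩ := h1
    rcases lt_or_gt_of_ne (inner_ne_zero_of_cone h2) with h3 | h3
    · exact Or.inr ⟨t, ht, h2, by linarith⟩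
    · exact Or.inl ⟨t, ht, h2, by linarith⟩
  have hzn := norm_nonneg z
  obtain ⟨r, -, ⟨t₁, _, h1, h1'⟩, ⟨t₂, _, h2, h2'⟩⟩ :=
    isPreconnected_univ _ _ (hopen 1) (hopen (-1))
    hcov ⟨‖z‖ + 1, trivial, hmem 1 _ (by rw [abs_of_pos (by linarith)]; linarith) (by linarith)⟩
    ⟨-(‖z‖ + 1), trivial, hmem (-1) _ (by rw [abs_neg, abs_of_pos (by linarith)]; linarith)
      (by linarith)⟩
  exact h.not_both_sides h1 h2 (by linarith) (by linarith)

end IsSaddleFlow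

end Saddle

/-! ### The sphere of trajectories converging to a saddle -/

section StableFamily

open scoped RealInnerProductSpace NNReal

variable {E : Type*} [NormedAddCommGroup E] [InnerProductSpace ℝ E]

lemma exists_isSaddleFlow [CompleteSpace E] {A : E →L[ℝ] E} {e : E} {c : ℝ} (hA : IsSaddle A e c)
    {N : E → E} {K : ℝ≥0} (hN : LipschitzWith K N) (hK : (K : ℝ) ≤ c / 8) (hN0 : N 0 = 0) :
    ∃ Φ : ℝ → E → E, IsSaddleFlow A e c (fun x => A x + N x) Φ := by
  have hW : LipschitzWith (‖A‖₊ + K) (fun x => A x + N x) := A.lipschitz.add hN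
  obtain ⟨Φ, h0, hd, hadd, hdist⟩ := exists_flow hW
  refine ⟨Φ, hA, fun x y => ?_, fun t => ?_, h0, hd, hadd, ?_⟩
  · have h1 : A x + N x - (A y + N y) - A (x - y) = N x - N y := by rw [map_sub]; abel
    rw [h1, ← dist_eq_norm, ← dist_eq_norm]
    exact (hN.dist_le_mul x y).trans (mul_le_mul_of_nonneg_right hK dist_nonneg)
  · have h1 : (fun t => Φ t 0) = fun _ => 0 :=
      ODE_solution_unique_univ (v := fun _ x => A x + N x) (s := fun _ => univ) (t₀ := 0)
        (fun _ => hW.lipschitzOnWith) (fun t => ⟨hd t 0, trivial⟩)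
        (fun t => ⟨by simpa [hN0] using hasDerivAt_const t (0 : E), trivial⟩) (h0 0)
    exact congrFun h1 t
  · rintro ⟨t, x⟩ ⟨ht, -⟩
    have hct : ContinuousAt (fun s => Φ s x) t := (hd t x).continuousAt
    rw [ContinuousWithinAt, tendsto_iff_dist_tendsto_zero]
    have hb : Tendsto (fun p : ℝ × E => dist p.2 x * Real.exp ((‖A‖₊ + K : ℝ≥0) * p.1) +
        dist (Φ p.1 x) (Φ t x)) (𝓝[Ici 0 ×ˢ univ] (t, x)) (𝓝 0) := by
      have h1 : ContinuousAt (fun p : ℝ × E => dist p.2 x * Real.exp ((‖A‖₊ + K : ℝ≥0) * p.1) +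
          dist (Φ p.1 x) (Φ t x)) (t, x) := by
        refine ContinuousAt.add (by fun_prop) ?_
        exact Tendsto.dist (ContinuousAt.comp (f := Prod.fst) (x := (t, x)) hct
          continuousAt_fst) continuousAt_const
      have h2 := h1.tendsto
      simp only [dist_self, zero_mul, add_zero] at h2
      exact h2.mono_left nhdsWithin_le_nhds
    refine squeeze_zero' (Eventually.of_forall fun p => dist_nonneg) ?_ hb
    filter_upwards [self_mem_nhdsWithin] with p hp
    exact (dist_triangle _ (Φ p.1 x) _).trans (add_le_add_left (hdist p.1 hp.1 p.2 x) _)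

/-- Near a rest point at which the linearization is a saddle with one expanding direction, there
is a sphere of trajectories converging to the rest point, of codimension two. -/
theorem exists_stable_family [FiniteDimensional ℝ E] {k : ℕ} (hk : Module.finrank ℝ E = k + 1)
    {V : E → E} {A : E →L[ℝ] E} {e x₀ : E} {c : ℝ} (hA : IsSaddle A e c) (hV0 : V x₀ = 0)
    (hV : HasStrictFDerivAt V A x₀) {s : Set E} (hs : s ∈ 𝓝 x₀) :
    ∃ X : Metric.sphere (0 : 𝔼 k) 1 → ℝ → E,
      (∀ θ u, 0 ≤ u → HasDerivAt (X θ) (V (X θ u)) u) ∧ (∀ θ u, 0 ≤ u → X θ u ∈ s) ∧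
      ContinuousOn (fun θu : Metric.sphere (0 : 𝔼 k) 1 × ℝ => X θu.1 θu.2) (univ ×ˢ Ici 0) ∧
      (∀ θ, Tendsto (X θ) atTop (𝓝 x₀)) ∧ (∀ θ u, 0 ≤ u → X θ u ≠ x₀) ∧
      ∀ θ θ' u u', 0 ≤ u → 0 ≤ u' → X θ u = X θ' u' → θ = θ' := by
  have : CompleteSpace E := FiniteDimensional.complete ℝ E
  have hc := hA.pos
  set C := lipschitzExtensionConstant E with hC
  have hCpos : 0 < C := lipschitzExtensionConstant_pos E
  -- Extending the nonlinear part from a neighbourhood to `E` multiplies its Lipschitz constant by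
  -- `C`; dividing first leaves the admissible `c / 8`.
  set K : ℝ≥0 := (c / 8).toNNReal / C with hKdef
  have hK : 0 < K := div_pos (Real.toNNReal_pos.2 (by linarith)) hCpos
  have hg : HasStrictFDerivAt (fun x => V (x₀ + x) - A x) (0 : E →L[ℝ] E) 0 := by
    have h1 : HasStrictFDerivAt (fun x => V (x₀ + x)) A 0 := by
      have h2 : HasStrictFDerivAt (fun x : E => x₀ + x) (ContinuousLinearMap.id ℝ E) 0 :=
        (hasStrictFDerivAt_id (0 : E)).const_add x₀
      have h3 : HasStrictFDerivAt V A (x₀ + 0) := by rwa [add_zero]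
      simpa using h3.comp (0 : E) h2
    have h2 := h1.sub A.hasStrictFDerivAt (x := 0)
    rwa [sub_self] at h2
  obtain ⟨t, ht, hLt⟩ := hg.exists_lipschitzOnWith_of_nnnorm_lt K (by simpa using hK)
  obtain ⟨N, hN, hNt⟩ := hLt.extend_finite_dimension
  have hN0 : N 0 = 0 := by
    rw [← hNt (mem_of_mem_nhds ht)]; simp [hV0]
  have hNK : ((C * K : ℝ≥0) : ℝ) ≤ c / 8 := by
    rw [hKdef, mul_div_cancel₀ _ hCpos.ne', Real.coe_toNNReal _ (by linarith)]
  obtain ⟨Φ, hΦ⟩ := exists_isSaddleFlow hA hN hNK hN0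
  have hst : {x : E | x ∈ t ∧ x₀ + x ∈ s} ∈ 𝓝 (0 : E) := by
    refine inter_mem ht ?_
    have hca : ContinuousAt (fun x : E => x₀ + x) 0 := by fun_prop
    exact hca.preimage_mem_nhds (by simpa using hs)
  obtain ⟨R, hR, hball⟩ := Metric.mem_nhds_iff.1 hst
  have hWV : ∀ x ∈ Metric.ball (0 : E) R, A x + N x = V (x₀ + x) := fun x hx => by
    rw [← hNt (hball hx).1]; simp
  -- On the stable set the squared norm is at most twice the initial squared transverse norm, and `2
  -- * ρ ^ 2 < R ^ 2`. So the trajectories never leave the ball where the cutoff is invisible.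
  set ρ := R / 2 with hρ
  have hρ0 : 0 < ρ := by positivity
  have he0 : e ≠ 0 := fun h => by simpa [h] using hA.unit
  have : Fact (Module.finrank ℝ E = k + 1) := ⟨hk⟩
  have hfr : Module.finrank ℝ (ℝ ∙ e)ᗮ = k := Submodule.finrank_orthogonal_span_singleton he0
  set ι : 𝔼 k ≃ₗᵢ[ℝ] (ℝ ∙ e)ᗮ :=
    ((stdOrthonormalBasis ℝ (ℝ ∙ e)ᗮ).reindex (finCongr hfr)).repr.symm
  have hιe : ∀ v, ⟪e, (ι v : E)⟫ = 0 := fun v =>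
    Submodule.mem_orthogonal_singleton_iff_inner_right.1 (ι v).2
  have hιn : ∀ v, ‖(ι v : E)‖ = ‖v‖ := fun v => ι.norm_map v
  have hze : ∀ v, ⟪e, ρ • (ι v : E)⟫ = 0 := fun v => by rw [inner_smul_right, hιe, mul_zero]
  choose r hr using fun v => hΦ.exists_mem_stableSet (hze v)
  set P : 𝔼 k → E := fun v => ρ • (ι v : E) + r v • e with hP
  have hee : ⟪e, e⟫ = 1 := by rw [real_inner_self_eq_norm_sq, hA.unit, one_pow]
  have hPe : ∀ v, ⟪e, P v⟫ = r v := fun v => by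
    simp only [hP]
    rw [inner_add_right, hze, inner_smul_right, hee]; ring
  have hPn : ∀ v w, ‖P v - P w‖ ^ 2 - ⟪e, P v - P w⟫ ^ 2 = (ρ * ‖v - w‖) ^ 2 := fun v w => by
    have h1 : P v - P w = ρ • (ι (v - w) : E) + (r v - r w) • e := by
      simp only [hP, map_sub, Submodule.coe_sub]
      module
    rw [h1, inner_add_right, hze, inner_smul_right, hee, norm_add_sq_real, inner_smul_right,
      real_inner_comm, hze, norm_smul, norm_smul, hιn, hA.unit, Real.norm_of_nonneg hρ0.le,
      Real.norm_eq_abs, mul_one, sq_abs]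
    ring
  have hPc : Continuous P := by
    have hrL : LipschitzWith ⟨ρ, hρ0.le⟩ r := LipschitzWith.of_dist_le_mul fun v w => by
      have h1 := hΦ.sub_mem_cone (hr v) (hr w)
      change 2 * ⟪e, P v - P w⟫ ^ 2 - ‖P v - P w‖ ^ 2 ≤ 0 at h1
      have h2 := hPn v w
      rw [inner_sub_right, hPe, hPe] at h1 h2
      rw [Real.dist_eq, dist_eq_norm]
      have h3 : (r v - r w) ^ 2 ≤ (ρ * ‖v - w‖) ^ 2 := by linarith
      exact abs_le_of_sq_le_sq h3 (by positivity)
    have hιc : Continuous fun v => (ι v : E) := continuous_subtype_val.comp ι.continuous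
    exact (hιc.const_smul ρ).add (hrL.continuous.smul continuous_const)
  have hPt : ∀ v, ‖v‖ = 1 → ‖P v‖ ^ 2 - ⟪e, P v⟫ ^ 2 = ρ ^ 2 := fun v hv => by
    rw [hPe]
    simp only [hP]
    rw [norm_add_sq_real, inner_smul_right, real_inner_comm, hze, norm_smul, norm_smul, hιn, hv,
      hA.unit, Real.norm_of_nonneg hρ0.le, Real.norm_eq_abs, mul_one, mul_one, sq_abs]
    ring
  have hPs : ∀ v, P v ∈ stableSet e Φ := hr
  have hsm : ∀ v, ‖v‖ = 1 → ∀ u, 0 ≤ u → Φ u (P v) ∈ Metric.ball (0 : E) R := fun v hv u hu => by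
    have h1 := hΦ.norm_sq_le (hPs v) hu
    rw [hPt v hv] at h1
    have h2 : Real.exp (-(c * u)) ≤ 1 := Real.exp_le_one_iff.2 (by nlinarith)
    rw [mem_ball_zero_iff]
    refine lt_of_pow_lt_pow_left₀ 2 hR.le ?_
    have h3 : 2 * ρ ^ 2 * Real.exp (-(c * u)) ≤ 2 * ρ ^ 2 * 1 := by gcongr
    rw [hρ] at h1 h3
    nlinarith
  have hnorm : ∀ θ : Metric.sphere (0 : 𝔼 k) 1, ‖(θ : 𝔼 k)‖ = 1 := fun θ => by simp
  have hinv : ∀ u x, Φ (-u) (Φ u x) = x := fun u x => by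
    rw [← hΦ.add, neg_add_cancel, hΦ.init]
  refine ⟨fun θ u => x₀ + Φ u (P θ), fun θ u hu => ?_, fun θ u hu => ?_, ?_, fun θ => ?_,
    fun θ u hu h0 => ?_, ?_⟩
  · have h1 := (hΦ.deriv u (P θ)).const_add x₀
    rwa [hWV _ (hsm θ (hnorm θ) u hu)] at h1
  · exact (hball (hsm θ (hnorm θ) u hu)).2
  · refine continuousOn_const.add (hΦ.cont.comp (f := fun θu : Metric.sphere (0 : 𝔼 k) 1 × ℝ =>
      (θu.2, P θu.1)) ?_ fun θu h => ⟨h.2, trivial⟩)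
    exact (continuous_snd.prodMk
      (hPc.comp (continuous_subtype_val.comp continuous_fst))).continuousOn
  · simpa using (hΦ.tendsto_zero (hPs θ)).const_add x₀
  · have h1 : Φ u (P θ) = 0 := by simpa using h0
    have h2 : P θ = 0 := by rw [← hinv u (P θ), h1, hΦ.zero]
    have h3 := hPt θ (hnorm θ)
    rw [h2] at h3
    simp only [norm_zero, inner_zero_right, sub_self] at h3
    nlinarith [mul_pos hρ0 hρ0]
  -- All initial points have transverse norm `ρ`, which decays strictly along the flow. If
  -- trajectories meet, the time difference is therefore zero, and the initial points coincide.
  · have key : ∀ θ θ' : Metric.sphere (0 : 𝔼 k) 1, ∀ u u', 0 ≤ u → u ≤ u' →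
        Φ u (P θ) = Φ u' (P θ') → θ = θ' := fun θ θ' u u' hu huu' h => by
      have h1 : P θ = Φ (u' - u) (P θ') := by
        rw [← hinv u (P θ), h, ← hΦ.add]; congr 1; ring
      have h2 := hΦ.transverse_le (hPs θ') (sub_nonneg.2 huu')
      rw [← h1, hPt θ (hnorm θ), hPt θ' (hnorm θ')] at h2
      have h3 : 1 ≤ Real.exp (-(c * (u' - u))) := by
        by_contra! hlt
        nlinarith [mul_pos hρ0 hρ0]
      have h4 : u' - u = 0 := by
        have := Real.one_le_exp_iff.1 h3
        nlinarith
      rw [h4, hΦ.init] at h1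
      have h5 := hPn θ θ'
      rw [h1] at h5
      simp only [sub_self, norm_zero, inner_zero_right] at h5
      have h6 : ‖(θ : 𝔼 k) - θ'‖ = 0 := by
        have : ρ * ‖(θ : 𝔼 k) - θ'‖ = 0 := by
          rw [← sq_eq_zero_iff, ← h5]
        exact (mul_eq_zero.1 this).resolve_left hρ0.ne'
      exact Subtype.ext (sub_eq_zero.1 (norm_eq_zero.1 h6))
    intro θ θ' u u' hu hu' h
    have h' : Φ u (P θ) = Φ u' (P θ') := by simpa using h
    rcases le_total u u' with hle | hle
    · exact key θ θ' u u' hu hle h'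
    · exact (key θ' θ u' u hu' hle h'.symm).symm

end StableFamily

/-! ## The linearization at a rest point -/

section Cubic

open scoped RealInnerProductSpace

/-- Positivity at `ξ` gives a positive eigenvalue, and negativity on a hyperplane leaves room for
only one. -/
lemma exists_isSaddle {E : Type*} [NormedAddCommGroup E] [InnerProductSpace ℝ E]
    [FiniteDimensional ℝ E] {A : E →L[ℝ] E} (hA : ∀ x y, ⟪A x, y⟫ = ⟪x, A y⟫) {ξ : E} {d : ℝ}
    (hd : 0 < d) (hneg : ∀ x, ⟪ξ, x⟫ = 0 → ⟪x, A x⟫ ≤ -d * ‖x‖ ^ 2) (hpos : 0 < ⟪ξ, A ξ⟫) :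
    ∃ (e : E) (c : ℝ), IsSaddle A e c := by
  have hT : (A : E →ₗ[ℝ] E).IsSymmetric := hA
  obtain ⟨l, e, hl, he, hAe⟩ : ∃ (l : ℝ) (e : E), 0 < l ∧ ‖e‖ = 1 ∧ A e = l • e := by
    by_contra! hcon
    set b := hT.eigenvectorBasis rfl
    have hb : ∀ i, A (b i) = hT.eigenvalues rfl i • b i := fun i => by
      exact hT.apply_eigenvectorBasis rfl i
    have hle : ∀ i, hT.eigenvalues rfl i ≤ 0 := fun i => by
      by_contra! h
      exact hcon _ (b i) h (b.orthonormal.1 i) (hb i)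
    rw [← b.sum_inner_mul_inner] at hpos
    refine hpos.not_ge (Finset.sum_nonpos fun i _ => ?_)
    rw [← hA, hb, real_inner_smul_left, real_inner_comm]
    nlinarith [hle i, mul_self_nonneg ⟪b i, ξ⟫]
  have hee : ⟪e, e⟫ = 1 := by rw [real_inner_self_eq_norm_sq, he, one_pow]
  have ha : ⟪ξ, e⟫ ≠ 0 := fun h0 => by
    have h1 := hneg e h0
    rw [hAe, inner_smul_right, hee, he] at h1
    linarith
  -- The combination `⟪ξ, z⟫ • e - ⟪ξ, e⟫ • z` is orthogonal to `ξ`; as `e` and `z` are orthogonal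
  -- for both forms, its bound gives the one for `z`.
  have horth : ∀ z, ⟪e, z⟫ = 0 → ⟪z, A z⟫ ≤ -d * ‖z‖ ^ 2 := fun z hz => by
    have hze : ⟪z, e⟫ = 0 := by rwa [real_inner_comm]
    have h1 := hneg (⟪ξ, z⟫ • e - ⟪ξ, e⟫ • z) (by
      rw [inner_sub_right, inner_smul_right, inner_smul_right]; ring)
    have h2 : ⟪e, A z⟫ = 0 := by rw [← hA, hAe, real_inner_smul_left, hz, mul_zero]
    rw [← real_inner_self_eq_norm_sq] at h1 ⊢
    simp only [map_sub, map_smul, hAe, inner_sub_left, inner_sub_right, inner_smul_right,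
      real_inner_smul_left, hee, hz, hze, h2] at h1
    have h3 : 0 < ⟪ξ, e⟫ ^ 2 := by positivity
    have h4 : 0 ≤ (d + l) * ⟪ξ, z⟫ ^ 2 := by positivity
    have h5 : ⟪ξ, e⟫ ^ 2 * ⟪z, A z⟫ ≤ ⟪ξ, e⟫ ^ 2 * (-d * ⟪z, z⟫) := by nlinarith
    exact le_of_mul_le_mul_left h5 h3
  have hdec : ∀ x, ⟪e, A x⟫ = l * ⟪e, x⟫ ∧ ⟪x, A x⟫ ≤
      l * ⟪e, x⟫ ^ 2 - d * (‖x‖ ^ 2 - ⟪e, x⟫ ^ 2) := fun x => by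
    have h1 : ⟪e, A x⟫ = l * ⟪e, x⟫ := by rw [← hA, hAe, real_inner_smul_left]
    refine ⟨h1, ?_⟩
    have h2 := horth (x - ⟪e, x⟫ • e) (by
      rw [inner_sub_right, inner_smul_right, hee]; ring)
    rw [← real_inner_self_eq_norm_sq] at h2 ⊢
    simp only [map_sub, map_smul, hAe, inner_sub_left, inner_sub_right, inner_smul_right,
      real_inner_smul_left, hee, h1, real_inner_comm e x] at h2
    nlinarith
  refine ⟨e, min l d, he, lt_min hl hd, fun x => ?_, fun x => ?_⟩
  · obtain ⟨h1, h2⟩ := hdec x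
    have h3 : 0 ≤ ‖x‖ ^ 2 - ⟪e, x⟫ ^ 2 := by
      have := abs_real_inner_le_norm e x
      rw [he, one_mul] at this
      have := pow_le_pow_left₀ (abs_nonneg _) this 2
      rw [sq_abs] at this
      linarith
    rw [h1]
    nlinarith [min_le_left l d, min_le_right l d, sq_nonneg ⟪e, x⟫,
      mul_le_mul_of_nonneg_right (min_le_left l d) (sq_nonneg ⟪e, x⟫),
      mul_le_mul_of_nonneg_right (min_le_right l d) h3]
  · obtain ⟨h1, h2⟩ := hdec x
    have h3 : 0 ≤ ‖x‖ ^ 2 - ⟪e, x⟫ ^ 2 := by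
      have := abs_real_inner_le_norm e x
      rw [he, one_mul] at this
      have := pow_le_pow_left₀ (abs_nonneg _) this 2
      rw [sq_abs] at this
      linarith
    rw [h1]
    nlinarith [mul_le_mul_of_nonneg_right (min_le_right l d) h3]

variable {ι : Type*} [Fintype ι]

/-- The system in normalized coordinates. -/
def cubicField (α β : ι → ℝ) (x : EuclideanSpace ℝ ι) : EuclideanSpace ℝ ι :=
  WithLp.toLp 2 fun i => x i * (∑ j, x j ^ 2 - α i * x i + β i * x i ^ 2)

/-- The derivative of the normalized system at a rest point. -/
def cubicDeriv (β : ι → ℝ) (ξ : EuclideanSpace ℝ ι) :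
    EuclideanSpace ℝ ι →L[ℝ] EuclideanSpace ℝ ι :=
  ((EuclideanSpace.equiv ι ℝ).symm : (ι → ℝ) →L[ℝ] EuclideanSpace ℝ ι).comp
    (ContinuousLinearMap.pi fun i => (2 * ξ i) • innerSL ℝ ξ -
      (∑ j, ξ j ^ 2 - β i * ξ i ^ 2) • (EuclideanSpace.proj i : EuclideanSpace ℝ ι →L[ℝ] ℝ))

lemma cubicDeriv_apply (β : ι → ℝ) (ξ h : EuclideanSpace ℝ ι) (i : ι) :
    cubicDeriv β ξ h i = 2 * ξ i * ⟪ξ, h⟫ - (∑ j, ξ j ^ 2 - β i * ξ i ^ 2) * h i := by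
  simp [cubicDeriv]

variable {α β : ι → ℝ} {ξ : EuclideanSpace ℝ ι}

lemma hasStrictFDerivAt_cubicField (hξ : ∀ i, ∑ j, ξ j ^ 2 - α i * ξ i + β i * ξ i ^ 2 = 0) :
    HasStrictFDerivAt (cubicField α β) (cubicDeriv β ξ) ξ := by
  rw [hasStrictFDerivAt_euclidean]
  intro i
  have hx : ∀ j, HasStrictFDerivAt (fun x : EuclideanSpace ℝ ι => x j)
      (EuclideanSpace.proj j : EuclideanSpace ℝ ι →L[ℝ] ℝ) ξ := fun j =>
    (EuclideanSpace.proj j : EuclideanSpace ℝ ι →L[ℝ] ℝ).hasStrictFDerivAt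
  have h1 := (hx i).mul (((HasStrictFDerivAt.fun_sum (u := Finset.univ)
    fun j _ => (hx j).pow 2).sub ((hx i).const_mul (α i))).add (((hx i).pow 2).const_mul (β i)))
  refine h1.congr_fderiv ?_
  ext h
  have h2 : ⟪ξ, h⟫ = ∑ j, ξ j * h j := by
    simp [PiLp.inner_apply, mul_comm]
  have h3 : ∑ j, 2 * ξ j * h j = 2 * ⟪ξ, h⟫ := by
    rw [h2, Finset.mul_sum]
    exact Finset.sum_congr rfl fun j _ => mul_assoc _ _ _
  simp [cubicDeriv_apply, h3]
  -- The rest equation eliminates `α`, which is why `cubicDeriv` depends only on `β` and `ξ`.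
  linear_combination (2 * h i) * hξ i

lemma inner_cubicDeriv (β : ι → ℝ) (ξ x y : EuclideanSpace ℝ ι) :
    ⟪x, cubicDeriv β ξ y⟫ = 2 * ⟪ξ, x⟫ * ⟪ξ, y⟫ -
      ∑ i, (∑ j, ξ j ^ 2 - β i * ξ i ^ 2) * (x i * y i) := by
  rw [PiLp.inner_apply]
  have h2 : ∑ i, ξ i * x i = ⟪ξ, x⟫ := by
    simp [PiLp.inner_apply, mul_comm]
  rw [← h2, Finset.mul_sum, Finset.sum_mul, ← Finset.sum_sub_distrib]
  refine Finset.sum_congr rfl fun i _ => ?_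
  rw [cubicDeriv_apply]
  simp only [RCLike.inner_apply, conj_trivial]
  ring

/-- The linearization at a rest point with at least two nonzero coordinates is a saddle. -/
theorem exists_isSaddle_cubicDeriv [Nontrivial ι] (hβ0 : ∀ i, 0 ≤ β i) (hβ1 : ∀ i, β i ≤ 1)
    (hpos : ∀ i, 0 < ξ i) : ∃ (e : EuclideanSpace ℝ ι) (c : ℝ), IsSaddle (cubicDeriv β ξ) e c := by
  -- A second nonzero coordinate makes this strict even when `β i = 1`, the case of complex
  -- dimension one.
  have hlt : ∀ i, 0 < ∑ j, ξ j ^ 2 - β i * ξ i ^ 2 := fun i => by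
    obtain ⟨k, hk⟩ := exists_ne i
    have h1 : ξ i ^ 2 + ξ k ^ 2 ≤ ∑ j, ξ j ^ 2 := by
      classical
      rw [← Finset.sum_pair (f := fun j => ξ j ^ 2) hk.symm]
      exact Finset.sum_le_sum_of_subset_of_nonneg (Finset.subset_univ _)
        fun j _ _ => sq_nonneg _
    nlinarith [pow_pos (hpos k) 2, mul_le_mul_of_nonneg_right (hβ1 i) (sq_nonneg (ξ i))]
  obtain ⟨i₀⟩ : Nonempty ι := inferInstance
  obtain ⟨k, -, hk⟩ := Finset.exists_min_image Finset.univ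
    (fun i => ∑ j, ξ j ^ 2 - β i * ξ i ^ 2) ⟨i₀, Finset.mem_univ _⟩
  refine exists_isSaddle (ξ := ξ) (fun x y => ?_) (hlt k) (fun x hx => ?_) ?_
  · rw [real_inner_comm, inner_cubicDeriv, inner_cubicDeriv]
    simp only [mul_comm (x _)]
    ring
  · rw [inner_cubicDeriv, hx, EuclideanSpace.real_norm_sq_eq, neg_mul, Finset.mul_sum, mul_zero,
      zero_sub]
    refine neg_le_neg (Finset.sum_le_sum fun i _ => ?_)
    rw [← sq]
    exact mul_le_mul_of_nonneg_right (hk i (Finset.mem_univ i)) (sq_nonneg _)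
  · rw [inner_cubicDeriv, real_inner_self_eq_norm_sq, EuclideanSpace.real_norm_sq_eq]
    have h1 : ∑ i, (∑ j, ξ j ^ 2 - β i * ξ i ^ 2) * (ξ i * ξ i) ≤
        (∑ j, ξ j ^ 2) * ∑ j, ξ j ^ 2 := by
      rw [Finset.mul_sum]
      refine Finset.sum_le_sum fun i _ => ?_
      rw [← sq]
      refine mul_le_mul_of_nonneg_right ?_ (sq_nonneg _)
      linarith [mul_nonneg (hβ0 i) (sq_nonneg (ξ i))]
    have h2 : 0 < ∑ j, ξ j ^ 2 :=
      Finset.sum_pos (fun j _ => pow_pos (hpos j) 2) ⟨i₀, Finset.mem_univ _⟩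
    nlinarith

end Cubic

/-! ## Rest points -/

section RestPoint

variable {m : ℕ} {n : Fin m → ℕ} {p q : Fin m → ℤ} {θ : Finset (Fin m)} {v w : Fin m → ℝ}

lemma IsRestPoint.energy_eq (hv : IsRestPoint n p q θ v) {i : Fin m} (hi : i ∈ θ) :
    energy n q v = v i * (2 * p i - (q i : ℝ) ^ 2 * v i) := by
  have h := (hv.1 i hi).2
  rw [rate] at h
  linarith

/-- The energy contains at least `qᵢ² vᵢ²`, which places `vᵢ` on the smaller-root branch of `x (2 pᵢ
- qᵢ² x) = E(v)`, where the left side is increasing. -/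
lemma IsRestPoint.sq_mul_le (hn : ∀ i, 1 ≤ n i) (hv : IsRestPoint n p q θ v) {i : Fin m}
    (hi : i ∈ θ) : (q i : ℝ) ^ 2 * v i ≤ p i := by
  have h1 : (n i : ℝ) * (q i : ℝ) ^ 2 * v i ^ 2 ≤ energy n q v :=
    Finset.single_le_sum (f := fun i => (n i : ℝ) * (q i : ℝ) ^ 2 * v i ^ 2)
      (fun j _ => by positivity) (Finset.mem_univ i)
  have h2 : (1 : ℝ) * ((q i : ℝ) ^ 2 * v i ^ 2) ≤ n i * ((q i : ℝ) ^ 2 * v i ^ 2) :=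
    mul_le_mul_of_nonneg_right (by exact_mod_cast hn i) (by positivity)
  rw [hv.energy_eq hi] at h1
  have h3 : v i * ((q i : ℝ) ^ 2 * v i) ≤ v i * p i := by nlinarith
  exact le_of_mul_le_mul_left h3 (hv.1 i hi).1

/-- Monotonicity on the smaller-root branch gives `v ≤ w`. Then every `E(v) wᵢ² - E(w) vᵢ² = 2 pᵢ vᵢ
wᵢ (wᵢ - vᵢ)` with `i ∈ θ` is nonnegative, while the weighted sum is `E(v) E(w) - E(w) E(v) = 0`. -/
lemma IsRestPoint.eq_of_energy_le (hn : ∀ i, 1 ≤ n i) (hp : ∀ i, 0 < p i) (hq : ∀ i, q i ≠ 0)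
    (hv : IsRestPoint n p q θ v) (hw : IsRestPoint n p q θ w)
    (h : energy n q v ≤ energy n q w) : v = w := by
  have hle : ∀ i ∈ θ, v i ≤ w i := fun i hi => by
    by_contra! hlt
    have h1 := hv.sq_mul_le hn hi
    have h2 := hw.sq_mul_le hn hi
    rw [hv.energy_eq hi, hw.energy_eq hi] at h
    have hq' : 0 < (q i : ℝ) ^ 2 := by have := hq i; positivity
    nlinarith [mul_pos (sub_pos.2 hlt) (mul_pos hq' (sub_pos.2 hlt)),
      mul_nonneg (sub_pos.2 hlt).le (sub_nonneg.2 h1)]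
  have hterm : ∀ i ∈ θ, energy n q v * w i ^ 2 - energy n q w * v i ^ 2 =
      2 * p i * (v i * w i) * (w i - v i) := fun i hi => by
    nth_rw 1 [hv.energy_eq hi, hw.energy_eq hi]
    ring
  have hsum : ∑ i, (n i : ℝ) * (q i : ℝ) ^ 2 *
      (energy n q v * w i ^ 2 - energy n q w * v i ^ 2) = 0 := by
    have : ∑ i, (n i : ℝ) * (q i : ℝ) ^ 2 *
        (energy n q v * w i ^ 2 - energy n q w * v i ^ 2) =
        energy n q v * energy n q w - energy n q w * energy n q v := by
      conv_rhs => rw [energy, energy, Finset.mul_sum, Finset.mul_sum, ← Finset.sum_sub_distrib]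
      exact Finset.sum_congr rfl fun i _ => by simp only [energy]; ring
    rw [this]
    ring
  rw [Finset.sum_eq_zero_iff_of_nonneg] at hsum
  · funext i
    by_cases hi : i ∈ θ
    · have h1 := hsum i (Finset.mem_univ i)
      rw [hterm i hi] at h1
      have hn' : n i ≠ 0 := Nat.one_le_iff_ne_zero.1 (hn i)
      have h2 : w i - v i = 0 := by
        simpa [hn', hq i, (hp i).ne', (hv.1 i hi).1.ne', (hw.1 i hi).1.ne'] using h1
      linarith
    · rw [hv.2 i hi, hw.2 i hi]
  · intro i _
    refine mul_nonneg (by positivity) ?_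
    by_cases hi : i ∈ θ
    · rw [hterm i hi]
      have hp' : (0 : ℝ) < p i := by exact_mod_cast hp i
      have := (hv.1 i hi).1
      have := (hw.1 i hi).1
      have := sub_nonneg.2 (hle i hi)
      positivity
    · rw [hv.2 i hi, hw.2 i hi]
      simp

theorem IsRestPoint.unique (hn : ∀ i, 1 ≤ n i) (hp : ∀ i, 0 < p i) (hq : ∀ i, q i ≠ 0)
    (hv : IsRestPoint n p q θ v) (hw : IsRestPoint n p q θ w) : v = w :=
  (le_total (energy n q v) (energy n q w)).elim (hv.eq_of_energy_le hn hp hq hw)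
    fun h => (hw.eq_of_energy_le hn hp hq hv h).symm

/-- For prescribed energy `c` the smaller root is `c / r i c`. Consistency, after division by `c`,
is `g c = 1`, solved between `0` and the largest `c` for which all the square roots are real. -/
theorem exists_isRestPoint (hn : ∀ i, 1 ≤ n i) (hp : ∀ i, 0 < p i) (hq : ∀ i, q i ≠ 0)
    (hθ : θ.Nonempty) : ∃ v, IsRestPoint n p q θ v := by
  have hp' : ∀ i, (0 : ℝ) < p i := fun i => by exact_mod_cast hp i
  have hq' : ∀ i, (0 : ℝ) < (q i : ℝ) ^ 2 := fun i => by have := hq i; positivity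
  obtain ⟨k, hk, hmin⟩ := Finset.exists_min_image θ (fun i => (p i : ℝ) ^ 2 / (q i : ℝ) ^ 2) hθ
  set r : Fin m → ℝ → ℝ := fun i c => p i + √((p i : ℝ) ^ 2 - (q i : ℝ) ^ 2 * c)
  have hr : ∀ i c, 0 < r i c := fun i c => add_pos_of_pos_of_nonneg (hp' i) (Real.sqrt_nonneg _)
  set g : ℝ → ℝ := fun c => ∑ i ∈ θ, (n i : ℝ) * (q i : ℝ) ^ 2 * (c / r i c ^ 2)
  have hg : Continuous g := by
    refine continuous_finsetSum _ fun i _ => continuous_const.mul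
      (continuous_id.div ?_ fun c => (pow_pos (hr i c) 2).ne')
    fun_prop
  have hC : (0 : ℝ) ≤ (p k : ℝ) ^ 2 / (q k : ℝ) ^ 2 := by positivity
  -- At this endpoint the root with index `k` is double, so its term alone equals `n k ≥ 1`.
  have h1 : 1 ≤ g ((p k : ℝ) ^ 2 / (q k : ℝ) ^ 2) := by
    refine le_trans ?_ (Finset.single_le_sum (f := fun i => (n i : ℝ) * (q i : ℝ) ^ 2 *
      ((p k : ℝ) ^ 2 / (q k : ℝ) ^ 2 / r i ((p k : ℝ) ^ 2 / (q k : ℝ) ^ 2) ^ 2))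
      (fun i _ => by positivity) hk)
    have h2 : r k ((p k : ℝ) ^ 2 / (q k : ℝ) ^ 2) = p k := by
      simp only [r]
      rw [mul_div_cancel₀ _ (hq' k).ne', sub_self, Real.sqrt_zero, add_zero]
    have h3 : (n k : ℝ) * (q k : ℝ) ^ 2 *
        ((p k : ℝ) ^ 2 / (q k : ℝ) ^ 2 / (p k : ℝ) ^ 2) = n k := by
      rw [div_div_cancel_left' (pow_pos (hp' k) 2).ne', mul_inv_cancel_right₀ (hq' k).ne']
    rw [h2, h3]
    exact_mod_cast hn k
  have h0 : g 0 = 0 := by simp [g]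
  obtain ⟨c, hc, hgc⟩ := intermediate_value_Icc hC hg.continuousOn
    (show (1 : ℝ) ∈ Icc _ _ from ⟨by rw [h0]; exact zero_le_one, h1⟩)
  have hc0 : 0 < c := hc.1.lt_of_ne fun h => by
    rw [← h, h0] at hgc
    exact zero_ne_one hgc
  set v : Fin m → ℝ := fun i => if i ∈ θ then c / r i c else 0
  have hvi : ∀ i ∈ θ, v i = c / r i c := fun i hi => if_pos hi
  have hE : energy n q v = c := by
    calc energy n q v = ∑ i ∈ θ, (n i : ℝ) * (q i : ℝ) ^ 2 * v i ^ 2 := by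
          refine (Finset.sum_subset (Finset.subset_univ θ) fun i _ hi => ?_).symm
          simp [v, hi]
      _ = c * g c := by
          rw [Finset.mul_sum]
          refine Finset.sum_congr rfl fun i hi => ?_
          rw [hvi i hi, div_pow]
          ring
      _ = c := by rw [hgc, mul_one]
  refine ⟨v, fun i hi => ⟨?_, ?_⟩, fun i hi => if_neg hi⟩
  · rw [hvi i hi]
    exact div_pos hc0 (hr i c)
  · have hle : (q i : ℝ) ^ 2 * c ≤ (p i : ℝ) ^ 2 := by
      rw [mul_comm, ← le_div_iff₀ (hq' i)]
      exact hc.2.trans (hmin i hi)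
    have h2 : r i c ^ 2 = 2 * p i * r i c - (q i : ℝ) ^ 2 * c := by
      have := Real.sq_sqrt (sub_nonneg.2 hle)
      simp only [r]
      linear_combination this
    rw [rate, hE, hvi i hi]
    have h3 : c / r i c * r i c = c := div_mul_cancel₀ c (hr i c).ne'
    have h4 : r i c ≠ 0 := (hr i c).ne'
    refine mul_right_cancel₀ (pow_ne_zero 2 h4) ?_
    generalize c / r i c = z at h3
    generalize r i c = s at *
    rw [← h3] at h2 ⊢
    linear_combination -(z * s) * h2

end RestPoint

/-! ## Solutions tending to a rest point -/

section Family

open scoped RealInnerProductSpace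

variable {m : ℕ} {n : Fin m → ℕ} {p q : Fin m → ℤ} {θ : Finset (Fin m)} {v : Fin m → ℝ}

/-- The factor that turns the energy into the square of the Euclidean norm. -/
def weight (n : Fin m → ℕ) (q : Fin m → ℤ) (i : Fin m) : ℝ := √(n i : ℝ) * |(q i : ℝ)|

lemma weight_pos (hn : ∀ i, 1 ≤ n i) (hq : ∀ i, q i ≠ 0) (i : Fin m) : 0 < weight n q i := by
  have h1 : (0 : ℝ) < n i := by exact_mod_cast hn i
  have h2 : (q i : ℝ) ≠ 0 := by exact_mod_cast hq i
  rw [weight]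
  positivity

lemma weight_sq (i : Fin m) : weight n q i ^ 2 = n i * (q i : ℝ) ^ 2 := by
  rw [weight, mul_pow, Real.sq_sqrt (Nat.cast_nonneg _), sq_abs]

/-- Normalized coordinates on `ℝ^θ`, extended by zero. -/
def extendByZero (n : Fin m → ℕ) (q : Fin m → ℤ) (θ : Finset (Fin m))
    (x : EuclideanSpace ℝ θ) (i : Fin m) : ℝ :=
  if h : i ∈ θ then x ⟨i, h⟩ / weight n q i else 0

lemma extendByZero_coe (x : EuclideanSpace ℝ θ) (i : θ) :
    extendByZero n q θ x i = x i / weight n q i := by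
  simp [extendByZero]

lemma extendByZero_of_notMem (x : EuclideanSpace ℝ θ) {i : Fin m} (hi : i ∉ θ) :
    extendByZero n q θ x i = 0 := by
  simp [extendByZero, hi]

lemma extendByZero_injective (hn : ∀ i, 1 ≤ n i) (hq : ∀ i, q i ≠ 0) :
    Function.Injective (extendByZero n q θ) := fun x y h => by
  ext i
  have := congrFun h i
  rwa [extendByZero_coe, extendByZero_coe, div_left_inj' (weight_pos hn hq _).ne'] at this

lemma continuous_extendByZero : Continuous (extendByZero n q θ) := by
  refine continuous_pi fun i => ?_
  by_cases hi : i ∈ θ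
  · simp only [extendByZero, hi, dif_pos]
    fun_prop
  · simp only [extendByZero, hi, dif_neg, not_false_eq_true]
    exact continuous_const

lemma energy_extendByZero (hn : ∀ i, 1 ≤ n i) (hq : ∀ i, q i ≠ 0) (x : EuclideanSpace ℝ θ) :
    energy n q (extendByZero n q θ x) = ∑ j, x j ^ 2 := by
  rw [energy, ← Finset.sum_subset (Finset.subset_univ θ), ← Finset.sum_coe_sort]
  · refine Finset.sum_congr rfl fun i _ => ?_
    rw [extendByZero_coe, ← weight_sq, ← mul_pow, mul_div_cancel₀ _ (weight_pos hn hq _).ne']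
  · intro i _ hi
    rw [extendByZero_of_notMem _ hi]
    ring

lemma cubicField_eq_rate (hn : ∀ i, 1 ≤ n i) (hq : ∀ i, q i ≠ 0) (x : EuclideanSpace ℝ θ)
    (i : θ) : ∑ j, x j ^ 2 - 2 * p i / weight n q i * x i + (n i : ℝ)⁻¹ * x i ^ 2 =
      -rate n p q i (extendByZero n q θ x) := by
  have hw := (weight_pos hn hq i).ne'
  have hn' : (n i : ℝ) ≠ 0 := by
    have := hn i
    positivity
  have hq' : (q i : ℝ) ^ 2 = (n i : ℝ)⁻¹ * weight n q i ^ 2 := by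
    rw [weight_sq, inv_mul_cancel_left₀ hn']
  rw [rate, energy_extendByZero hn hq, extendByZero_coe, hq', div_pow, mul_assoc _ (_ ^ 2),
    mul_div_cancel₀ _ (pow_ne_zero 2 hw)]
  ring

/-- A rest point with support `θ` is the limit of a family of solutions with support `θ`,
parametrized by a sphere of dimension `|θ| - 2`. -/
theorem exists_isSolutionFamily (hn : ∀ i, 1 ≤ n i) (hq : ∀ i, q i ≠ 0) (hθ : θ.Nonempty)
    (hv : IsRestPoint n p q θ v) :
    ∃ Y : Metric.sphere (0 : 𝔼 (θ.card - 1)) 1 → ℝ → Fin m → ℝ,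
      IsSolutionFamily n p q (θ.card - 1) v Y ∧
      (∀ s u, 0 ≤ u → ∀ i ∈ θ, 0 < Y s u i) ∧ ∀ s u, ∀ k ∉ θ, Y s u k = 0 := by
  have hw := weight_pos hn hq
  -- For a single index the parameter sphere lies in `ℝ⁰` and is empty; the saddle argument needs
  -- two indices.
  obtain h1 | h1 := hθ.card_pos.nat_succ_le.eq_or_lt
  · have : IsEmpty (Metric.sphere (0 : 𝔼 (θ.card - 1)) 1) := by
      rw [← h1]
      refine ⟨fun s : Metric.sphere (0 : 𝔼 0) 1 => ?_⟩
      have h2 := norm_eq_of_mem_sphere s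
      rw [Subsingleton.elim (s : 𝔼 0) 0, norm_zero] at h2
      exact zero_ne_one h2
    exact ⟨isEmptyElim, ⟨isEmptyElim, isEmptyElim, by simp [Set.eq_empty_of_isEmpty], isEmptyElim,
      isEmptyElim, isEmptyElim⟩, isEmptyElim, isEmptyElim⟩
  have : Nontrivial θ := by
    rw [← Fintype.one_lt_card_iff_nontrivial, Fintype.card_coe]
    exact h1
  set ξ : EuclideanSpace ℝ θ := WithLp.toLp 2 fun i => weight n q i * v i with hξdef
  have hξv : extendByZero n q θ ξ = v := funext fun i => by
    by_cases hi : i ∈ θ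
    · simp [extendByZero, hi, hξdef, mul_div_cancel_left₀ _ (hw i).ne']
    · rw [extendByZero_of_notMem _ hi, hv.2 i hi]
  have hξ : ∀ i : θ, ∑ j, ξ j ^ 2 - 2 * p i / weight n q i * ξ i + (n i : ℝ)⁻¹ * ξ i ^ 2 = 0 :=
    fun i => by rw [cubicField_eq_rate hn hq, hξv, (hv.1 i i.2).2, neg_zero]
  have hpos : ∀ i, 0 < ξ i := fun i => mul_pos (hw i) (hv.1 i i.2).1
  obtain ⟨e, c, hA⟩ := exists_isSaddle_cubicDeriv (β := fun i : θ => (n i : ℝ)⁻¹)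
    (fun i => by positivity) (fun i => inv_le_one_of_one_le₀ (by exact_mod_cast hn i)) hpos
  have hs : {x : EuclideanSpace ℝ θ | ∀ i, 0 < x i} ∈ 𝓝 ξ := by
    have : ∀ i, ∀ᶠ x : EuclideanSpace ℝ θ in 𝓝 ξ, 0 < x i := fun i =>
      (EuclideanSpace.proj i : EuclideanSpace ℝ θ →L[ℝ] ℝ).continuous.continuousAt.eventually
        (lt_mem_nhds (hpos i))
    exact eventually_all.2 this
  obtain ⟨X, hX, hXs, hXc, hXt, hXne, hXd⟩ := exists_stable_family (k := θ.card - 1)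
    (V := cubicField (fun i : θ => 2 * p i / weight n q i) fun i : θ => (n i : ℝ)⁻¹)
    (by rw [finrank_euclideanSpace, Fintype.card_coe]; omega) hA
    (by ext i; exact (congrArg (ξ i * ·) (hξ i)).trans (mul_zero _))
    (hasStrictFDerivAt_cubicField hξ) hs
  have hYpos : ∀ s u, 0 ≤ u → ∀ i ∈ θ, 0 < extendByZero n q θ (X s u) i := fun s u hu i hi => by
    rw [extendByZero_coe (X s u) ⟨i, hi⟩]
    exact div_pos (hXs s u hu _) (hw i)
  refine ⟨fun s u => extendByZero n q θ (X s u), ⟨fun s u hu i => ?_, fun s u hu i => ?_, ?_,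
    fun s => ?_, fun s u hu h => ?_, fun s s' u u' hu hu' h => ?_⟩, hYpos,
    fun s u k hk => extendByZero_of_notMem _ hk⟩
  · by_cases hi : i ∈ θ
    · have h2 := ((EuclideanSpace.proj (⟨i, hi⟩ : θ) : EuclideanSpace ℝ θ →L[ℝ] ℝ).hasFDerivAt
        |>.comp_hasDerivAt u (hX s u hu)).div_const (weight n q i)
      simp only [extendByZero, hi, dif_pos]
      refine h2.hasDerivWithinAt.congr_deriv ?_
      have h3 := cubicField_eq_rate (p := p) hn hq (X s u) ⟨i, hi⟩
      change X s u ⟨i, hi⟩ * _ / weight n q i = _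
      rw [h3]
      ring
    · simp only [extendByZero_of_notMem _ hi, zero_mul, neg_zero]
      exact hasDerivWithinAt_const _ _ _
  · by_cases hi : i ∈ θ
    · exact (hYpos s u hu i hi).le
    · exact (extendByZero_of_notMem _ hi).ge
  · exact continuous_extendByZero.comp_continuousOn hXc
  · rw [← hξv]
    exact (continuous_extendByZero.tendsto ξ).comp (hXt s)
  · rw [← hξv] at h
    exact hXne s u hu (extendByZero_injective hn hq h)
  · exact hXd s s' u u' hu hu' (extendByZero_injective hn hq h)

end Family

/-! ### Which solutions give ancient flows -/

section Ancient

variable {m : ℕ} {n : Fin m → ℕ} {p q : Fin m → ℤ}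

/-- Positive solutions of the system give ancient Ricci flows. -/
theorem KECircleBundle.givesAncient (P : KECircleBundle.{u} n p q) {Y : ℝ → Fin m → ℝ}
    (hY : IsSolution n p q Y) (hpos : ∀ u, 0 ≤ u → ∀ i, 0 < Y u i) : P.GivesAncient Y := by
  intro a₀ ha₀
  obtain ⟨a, b, h0, hc, hab, hbb, ha', hb'⟩ := exists_corresponds hY hpos ha₀
  exact ⟨a, b, h0, hc, P.isAncient hab hbb hc.a_pos hc.b_pos ha' hb'⟩

/-- At `τ = 0` the rescaled time is `0`, so `Y 0 i` is a quotient of positive numbers. This is the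
obstruction for solutions in coordinate subspaces. -/
lemma Corresponds.ne_zero {Y : ℝ → Fin m → ℝ} {a : ℝ → ℝ} {b : ℝ → Fin m → ℝ}
    (h : Corresponds n q Y a b) (i : Fin m) : Y 0 i ≠ 0 := by
  have h1 := h.ratio 0 le_rfl i
  rw [intervalIntegral.integral_same] at h1
  rw [h1]
  exact (div_pos (h.a_pos 0 le_rfl) (h.b_pos 0 le_rfl i)).ne'

end Ancient

end CircleFlow

end

/-! ### Assembly of the three statements -/

theorem mainTheorem2 (m : ℕ) (hm : 1 ≤ m) (n : Fin m → ℕ) (hn : ∀ i, 1 ≤ n i)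
    (p q : Fin m → ℤ) (hp : ∀ i, 0 < p i) (hq : ∀ i, q i ≠ 0) :
    -- (i) solutions starting close to the origin
    (∃ c₀ : ℝ, 0 < c₀ ∧
      (∀ y : Fin m → ℝ, (∀ i, 0 ≤ y i) → ∑ i, y i ≤ c₀ →
        ∃ Y : ℝ → Fin m → ℝ, CircleFlow.IsSolution n p q Y ∧ Y 0 = y ∧
          ∀ u, 0 ≤ u → ∀ i, 0 ≤ Y u i) ∧
      ∀ Y : ℝ → Fin m → ℝ, CircleFlow.IsSolution n p q Y →
        (∀ u, 0 ≤ u → ∀ i, 0 ≤ Y u i) → ∑ i, Y 0 i ≤ c₀ →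
        Tendsto Y atTop (𝓝 0) ∧
        ((∀ u, 0 ≤ u → ∀ i, 0 < Y u i) →
          ∀ P : CircleFlow.KECircleBundle.{u} n p q, P.GivesAncient Y)) ∧
    -- (ii) solutions tending to the Einstein point
    (∃ ξ : Fin m → ℝ, CircleFlow.IsRestPoint n p q Finset.univ ξ ∧
      (∀ ζ, CircleFlow.IsRestPoint n p q Finset.univ ζ → ζ = ξ) ∧
      ∃ Y : Metric.sphere (0 : EuclideanSpace ℝ (Fin (m - 1))) 1 → ℝ → Fin m → ℝ,
        CircleFlow.IsSolutionFamily n p q (m - 1) ξ Y ∧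
        (∀ s u, 0 ≤ u → ∀ i, 0 < Y s u i) ∧
        ∀ s, ∀ P : CircleFlow.KECircleBundle.{u} n p q, P.GivesAncient (Y s)) ∧
    -- (iii) solutions in the coordinate subspaces
    (∀ θ : Finset (Fin m), θ.Nonempty → θ ≠ Finset.univ →
      ∃ v : Fin m → ℝ, CircleFlow.IsRestPoint n p q θ v ∧
        (∀ w, CircleFlow.IsRestPoint n p q θ w → w = v) ∧
        ∃ Y : Metric.sphere (0 : EuclideanSpace ℝ (Fin (θ.card - 1))) 1 → ℝ → Fin m → ℝ,
          CircleFlow.IsSolutionFamily n p q (θ.card - 1) v Y ∧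
          (∀ s u, 0 ≤ u → ∀ k, k ∉ θ → Y s u k = 0) ∧
          ∀ s, ∀ P : CircleFlow.KECircleBundle.{u} n p q,
            ¬ ∃ (a : ℝ → ℝ) (b : ℝ → Fin m → ℝ),
              CircleFlow.Corresponds n q (Y s) a b ∧ P.IsAncient a b) := by
  have hm' : (0 : ℝ) < m := by exact_mod_cast hm
  have hfam : ∀ θ : Finset (Fin m), θ.Nonempty → ∃ v : Fin m → ℝ,
      CircleFlow.IsRestPoint n p q θ v ∧ (∀ w, CircleFlow.IsRestPoint n p q θ w → w = v) ∧
      ∃ Y : Metric.sphere (0 : EuclideanSpace ℝ (Fin (θ.card - 1))) 1 → ℝ → Fin m → ℝ,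
        CircleFlow.IsSolutionFamily n p q (θ.card - 1) v Y ∧
        (∀ s u, 0 ≤ u → ∀ i ∈ θ, 0 < Y s u i) ∧ ∀ s u, ∀ k ∉ θ, Y s u k = 0 := fun θ hθ => by
    obtain ⟨v, hv⟩ := CircleFlow.exists_isRestPoint hn hp hq hθ
    exact ⟨v, hv, fun w hw => hw.unique hn hp hq hv,
      CircleFlow.exists_isSolutionFamily hn hq hθ hv⟩
  have hne : (Finset.univ : Finset (Fin m)).Nonempty := ⟨⟨0, hm⟩, Finset.mem_univ _⟩
  refine ⟨?_, ?_, fun θ hθ hθu => ?_⟩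
  · set C := ∑ i, ((n i : ℝ) + 1) * (q i : ℝ) ^ 2
    have hC : 0 < C := Finset.sum_pos (fun i _ => by have := hq i; positivity) hne
    -- Existence through the clamped field requires `C * (m * c₀) ≤ 1`, while convergence needs only
    -- `C * c₀ ≤ 1`; this value serves both.
    have hc₀ : 0 < 1 / (C * m) := by positivity
    have hc : C * (m * (1 / (C * m))) = 1 := by field_simp
    refine ⟨1 / (C * m), hc₀, fun y hy hys =>
      CircleFlow.exists_solution_near_zero hp hc₀ hc.le hy hys, fun Y hY hnn hs =>
      ⟨CircleFlow.tendsto_zero_of_small hp hc₀ (le_trans ?_ hc.le) hY hnn hs,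
        fun hY' P => P.givesAncient hY hY'⟩⟩
    exact mul_le_mul_of_nonneg_left (le_mul_of_one_le_left hc₀.le (by exact_mod_cast hm)) hC.le
  · obtain ⟨ξ, hξ, huniq, hY⟩ := hfam Finset.univ hne
    rw [Finset.card_fin] at hY
    obtain ⟨Y, hY, hY', -⟩ := hY
    have hY'' : ∀ s u, 0 ≤ u → ∀ i, 0 < Y s u i := fun s u hu i => hY' s u hu i (Finset.mem_univ i)
    exact ⟨ξ, hξ, huniq, Y, hY, hY'', fun s P => P.givesAncient (hY.solution s) (hY'' s)⟩
  · obtain ⟨v, hv, huniq, Y, hY, -, hY'⟩ := hfam θ hθ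
    obtain ⟨k, hk⟩ : ∃ k, k ∉ θ := by
      by_contra! h
      exact hθu (Finset.eq_univ_iff_forall.2 h)
    refine ⟨v, hv, huniq, Y, hY, fun s u _ k hk => hY' s u k hk, fun s P => ?_⟩
    rintro ⟨a, b, hc, -⟩
    exact hc.ne_zero k (hY' s 0 k hk)
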